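/- Let $K$ be a field, let $m,n\ge 1$ be integers, and let $q,v_1,\dots,v_m\in K$ with $q\ne 0$, $q^2\neq 1$. For $k\ge 0$ let $H(m,1,k)$ be the cyclotomic Hecke algebra over $K$: $H(m,1,0)=K$, and for $k\ge 1$ it is generated by $\tau,\sigma_1,\dots,\sigma_{k-1}$ with the relations $$\sigma_i\sigma_{i+1}\sigma_i=\sigma_{i+1}\sigma_i\sigma_{i+1},\quad \sigma_i\sigma_j=\sigma_j\sigma_i\ (|i-j|>1),\quad \tau\sigma_1\tau\sigma_1=\sigma_1\tau\sigma_1\tau,\quad \tau\sigma_i=\sigma_i\tau\ (i>1),$$ $$\sigma_i^2=(q-q^{-1})\sigma_i+1,\qquad (\tau-v_1)\cdots(\tau-v_m)=0 .$$ Let $J_1=\tau$, $J_{i+1}=\sigma_iJ_i\sigma_i$ be the Jucys–Murphy elements. Assume 1. $1+q^2+\dots+q^{2N}\ne 0$ for all integers $0\le N<n$; 2. $q^{2i}v_j-v_k\ne 0$ for all $j\neq k$ and all integers $-n<i<n$; 3. $v_j\ne 0$ for $j=1,\dots,m$. For an $m$-partition $\lambda$ of $k$ (an $m$-tuple of Young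 diagrams of total size $k$) let $V_\lambda$ have as a basis the standard $m$-tableaux $X$ of shape $\lambda$. Write $c(X|i)=v_pq^{2(s-r)}$ if the number $i$ sits in row $r$ and column $s$ of the $p$-th diagram, and let $X^{s_i}$ be $X$ with $i$ and $i+1$ exchanged, read as $0$ in $V_\lambda$ if it is not standard. Put $$\tau X=c(X|1)X,\qquad \sigma_iX=\frac{(q-q^{-1})\,c(X|i+1)}{c(X|i+1)-c(X|i)}\,X+\frac{q\,c(X|i+1)-q^{-1}c(X|i)}{c(X|i+1)-c(X|i)}\,X^{s_i}.$$ Then the following hold. (a) The homomorphism $H(m,1,n-1)\to H(m,1,n)$ with $\tau\mapsto\tau$, $\sigma_i\mapsto\sigma_i$ is injective. For every $0\le k\le n$ and every $m$-partition $\lambda$ of $k$ the formulas above define an $H(m,1,k)$-module $V_\lambda$, and the $V_\lambda$ form a complete list of pairwise non-isomorphic irreducible $H(m,1,k)$-modules. (b) For every $m$-partition $\lambda$ of $n$, the restriction of $V_\lambda$ to $H(m,1,n-1)$ is isomorphic to $\bigoplus_{\alpha}V_{\lambda\setminus\{\alpha\}}$, the sum over the removable $m$-nodes $\alpha$ of $\lambda$.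 (c) The branching from $H(m,1,n)$ to $H(m,1,n-1)$ is multiplicity-free: the restriction of every irreducible $H(m,1,n)$-module to $H(m,1,n-1)$ is a finite direct sum of irreducible modules, in which every irreducible $H(m,1,n-1)$-module occurs with multiplicity $0$ or $1$. (d) The centralizer of $H(m,1,n-1)$ in $H(m,1,n)$ is commutative. (e) This centralizer is the subalgebra generated by the center of $H(m,1,n-1)$ and $J_n$. (f) The subalgebra of $H(m,1,n)$ generated by $J_1,\dots,J_n$ is a maximal commutative subalgebra. -/

import Mathlib

universe u w

namespace CyclotomicHecke

/-! Indices are 0-based: `sigma i` is the generator `σ_{i+1}`, `JM i` is the Jucys-Murphy element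
`J_{i+1}`, and the entries `1, …, n` of a tableau are the elements `0, …, n-1` of `Fin n`.
Rows, columns and components of diagrams are counted from `0` as well. -/

section Algebra

/-- The generators `τ` (present for `n ≥ 1`) and `σ_1, …, σ_{n-1}` of `H(m,1,n)`. -/
inductive Gen (n : ℕ) : Type
  | tau (h : 0 < n) : Gen n
  | sigma (i : ℕ) (h : i + 1 < n) : Gen n

variable {K : Type u} [Field K] {m : ℕ}

/-- The letter `τ` of the free algebra. -/
def freeTau (K : Type u) [Field K] {n : ℕ} (h : 0 < n) : FreeAlgebra K (Gen n) :=
  FreeAlgebra.ι K (Gen.tau h)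

/-- The letter `σ_{i+1}` of the free algebra. -/
def freeSigma (K : Type u) [Field K] {n : ℕ} (i : ℕ) (h : i + 1 < n) : FreeAlgebra K (Gen n) :=
  FreeAlgebra.ι K (Gen.sigma i h)

/-- The defining relations of the cyclotomic Hecke algebra `H(m,1,n)` with parameters `q` and
`v_1, …, v_m`. For `q ≠ 0` and nonzero `v_j` the generators are automatically invertible, so that
this presents the quotient of the group algebra of the braid group of type B. -/
inductive Rel (n : ℕ) (q : K) (v : Fin m → K) :
    FreeAlgebra K (Gen n) → FreeAlgebra K (Gen n) → Prop
  | braid (i : ℕ) (h : i + 2 < n) : Rel n q v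
      (freeSigma K i (by omega) * freeSigma K (i + 1) h * freeSigma K i (by omega))
      (freeSigma K (i + 1) h * freeSigma K i (by omega) * freeSigma K (i + 1) h)
  | far (i j : ℕ) (hi : i + 1 < n) (hj : j + 1 < n) (hij : i + 1 < j ∨ j + 1 < i) : Rel n q v
      (freeSigma K i hi * freeSigma K j hj) (freeSigma K j hj * freeSigma K i hi)
  | tauBraid (h : 1 < n) : Rel n q v
      (freeTau K (by omega) * freeSigma K 0 h * freeTau K (by omega) * freeSigma K 0 h)
      (freeSigma K 0 h * freeTau K (by omega) * freeSigma K 0 h * freeTau K (by omega))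
  | tauFar (i : ℕ) (hi : i + 1 < n) (h : 0 < i) : Rel n q v
      (freeTau K (by omega) * freeSigma K i hi) (freeSigma K i hi * freeTau K (by omega))
  | quad (i : ℕ) (h : i + 1 < n) : Rel n q v
      (freeSigma K i h * freeSigma K i h) ((q - q⁻¹) • freeSigma K i h + 1)
  | cyclo (h : 0 < n) : Rel n q v
      (List.ofFn fun j : Fin m => freeTau K h - algebraMap K _ (v j)).prod 0

/-- The cyclotomic Hecke algebra `H(m,1,n)`. -/
def Hecke (n : ℕ) (q : K) (v : Fin m → K) : Type u := RingQuot (Rel n q v)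

variable (n : ℕ) (q : K) (v : Fin m → K)

noncomputable instance : Ring (Hecke n q v) := inferInstanceAs (Ring (RingQuot (Rel n q v)))

noncomputable instance : Algebra K (Hecke n q v) :=
  inferInstanceAs (Algebra K (RingQuot (Rel n q v)))

/-- The quotient map from the free algebra. -/
noncomputable def mk : FreeAlgebra K (Gen n) →ₐ[K] Hecke n q v :=
  RingQuot.mkAlgHom K (Rel n q v)

variable {n} in
theorem mk_rel {a b : FreeAlgebra K (Gen n)} (h : Rel n q v a b) : mk n q v a = mk n q v b :=
  RingQuot.mkAlgHom_rel K h

variable {n}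

/-- The generator `τ` of `H(m,1,n)`. -/
noncomputable def tau (h : 0 < n) : Hecke n q v := mk n q v (freeTau K h)

/-- The generator `σ_{i+1}` of `H(m,1,n)`. -/
noncomputable def sigma (i : ℕ) (h : i + 1 < n) : Hecke n q v := mk n q v (freeSigma K i h)

/-- The Jucys-Murphy elements: `JM 0 = J_1 = τ` and `J_{i+1} = σ_i J_i σ_i`. -/
noncomputable def JM : (i : ℕ) → i < n → Hecke n q v
  | 0, h => tau q v h
  | i + 1, h => sigma q v i h * JM i (by omega) * sigma q v i h

/-- The map `H(m,1,n) → H(m,1,n+1)` on generators, with values in the free algebra. -/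
def genSucc {n : ℕ} : Gen n → Gen (n + 1)
  | Gen.tau h => Gen.tau (by omega)
  | Gen.sigma i h => Gen.sigma i (by omega)

/-- The map of free algebras sending `τ` to `τ` and `σ_i` to `σ_i`. -/
noncomputable def freeIncl (K : Type u) [Field K] (n : ℕ) :
    FreeAlgebra K (Gen n) →ₐ[K] FreeAlgebra K (Gen (n + 1)) :=
  FreeAlgebra.lift K fun g => FreeAlgebra.ι K (genSucc g)

theorem freeIncl_tau (h : 0 < n) :
    freeIncl K n (freeTau K h) = freeTau K (by omega) := by
  simp [freeIncl, freeTau, genSucc]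

theorem freeIncl_sigma (i : ℕ) (h : i + 1 < n) :
    freeIncl K n (freeSigma K i h) = freeSigma K i (by omega) := by
  simp [freeIncl, freeSigma, genSucc]

theorem freeIncl_rel {a b : FreeAlgebra K (Gen n)} (h : Rel n q v a b) :
    Rel (n + 1) q v (freeIncl K n a) (freeIncl K n b) := by
  cases h with
  | braid i h =>
    simp only [map_mul, freeIncl_sigma]
    exact Rel.braid i (by omega)
  | far i j hi hj hij =>
    simp only [map_mul, freeIncl_sigma]
    exact Rel.far i j _ _ hij
  | tauBraid h =>
    simp only [map_mul, freeIncl_sigma, freeIncl_tau]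
    exact Rel.tauBraid (by omega)
  | tauFar i hi h =>
    simp only [map_mul, freeIncl_sigma, freeIncl_tau]
    exact Rel.tauFar i _ h
  | quad i h =>
    simp only [map_mul, map_add, map_smul, map_one, freeIncl_sigma]
    exact Rel.quad i _
  | cyclo h =>
    simp only [map_list_prod, List.map_ofFn, map_zero, Function.comp_def, map_sub, freeIncl_tau,
      AlgHom.commutes]
    exact Rel.cyclo _

variable (n)

/-- The natural homomorphism `H(m,1,n) → H(m,1,n+1)` with `τ ↦ τ` and `σ_i ↦ σ_i`. Its image is
the subalgebra generated by `τ, σ_1, …, σ_{n-1}`. -/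
noncomputable def incl : Hecke n q v →ₐ[K] Hecke (n + 1) q v :=
  RingQuot.liftAlgHom K
    ⟨(mk (n + 1) q v).comp (freeIncl K n), fun _ _ h => mk_rel q v (freeIncl_rel q v h)⟩

end Algebra

section Modules

variable {K : Type u} [Field K] {A : Type*} [Ring A] [Algebra K A]
  {V : Type*} [AddCommGroup V] [Module K V]

/-- The space of the representation `ρ` of `A`, viewed as an `A`-module. -/
def RepMod (_ρ : A →ₐ[K] Module.End K V) : Type _ := V

instance (ρ : A →ₐ[K] Module.End K V) : AddCommGroup (RepMod ρ) := inferInstanceAs (AddCommGroup V)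

instance (ρ : A →ₐ[K] Module.End K V) : Module A (RepMod ρ) :=
  Module.compHom V ρ.toRingHom

/-- The submodules `S 0, …, S (k-1)` of `M` are irreducible, and `M` is their direct sum. -/
def IsIrredDecomp (A M : Type*) [Ring A] [AddCommGroup M] [Module A M] {k : ℕ}
    (S : Fin k → Submodule A M) : Prop :=
  DirectSum.IsInternal S ∧ ∀ i, IsSimpleModule A (S i)

/-- `M` is a finite direct sum of irreducible modules, and no irreducible module appears more than
once (up to isomorphism) in such a decomposition. -/
def IsMultiplicityFree (A M : Type*) [Ring A] [AddCommGroup M] [Module A M] : Prop :=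
  (∃ (k : ℕ) (S : Fin k → Submodule A M), IsIrredDecomp A M S) ∧
  ∀ (k : ℕ) (S : Fin k → Submodule A M), IsIrredDecomp A M S →
    ∀ i j, Nonempty (S i ≃ₗ[A] S j) → i = j

end Modules

section Combinatorics

/-- An `m`-partition of `n`: an `m`-tuple of Young diagrams of total size `n`. -/
structure MPartition (m n : ℕ) where
  diag : Fin m → YoungDiagram
  size : ∑ p, (diag p).card = n

/-- An `m`-node `(p, r, s)`: position `p`, line `r`, column `s`. -/
abbrev MNode (m : ℕ) : Type := Fin m × ℕ × ℕ

variable {m n : ℕ}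

/-- An `m`-node of `Λ` is removable if `Λ` without it is still an `m`-partition. -/
def MPartition.IsRemovable (Λ : MPartition m n) (α : MNode m) : Prop :=
  α.2 ∈ Λ.diag α.1 ∧ IsLowerSet (((Λ.diag α.1).cells.erase α.2 : Finset (ℕ × ℕ)) : Set (ℕ × ℕ))

/-- The `m`-partition `Λ \ {α}`. -/
def MPartition.remove (Λ : MPartition m (n + 1)) (α : MNode m) (h : Λ.IsRemovable α) :
    MPartition m n where
  diag := Function.update Λ.diag α.1 ⟨(Λ.diag α.1).cells.erase α.2, h.2⟩
  size := by
    have h1 : α.2 ∈ (Λ.diag α.1).cells := h.1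
    have h2 := Λ.size
    rw [← Finset.add_sum_erase _ _ (Finset.mem_univ α.1)] at h2 ⊢
    have h3 : ∑ p ∈ Finset.univ.erase α.1,
        (Function.update Λ.diag α.1 ⟨(Λ.diag α.1).cells.erase α.2, h.2⟩ p).card =
        ∑ p ∈ Finset.univ.erase α.1, (Λ.diag p).card := by
      refine Finset.sum_congr rfl fun p hp => ?_
      rw [Function.update_of_ne (Finset.ne_of_mem_erase hp)]
    rw [h3, Function.update_self]
    have h4 := Finset.card_erase_add_one h1
    simp only [YoungDiagram.card] at h2 ⊢
    omega

/-- A filling of `Λ` by the numbers of `Fin n` is given by the `m`-node `T i` that carries `i`.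
It is standard if the numbers increase along the rows and down the columns of each diagram. -/
structure IsStandard (Λ : MPartition m n) (T : Fin n → MNode m) : Prop where
  bij : Set.BijOn T Set.univ {α | α.2 ∈ Λ.diag α.1}
  row : ∀ i j, (T i).1 = (T j).1 → (T i).2.1 = (T j).2.1 → (T i).2.2 < (T j).2.2 → i < j
  col : ∀ i j, (T i).1 = (T j).1 → (T i).2.2 = (T j).2.2 → (T i).2.1 < (T j).2.1 → i < j

/-- The standard `m`-tableaux of shape `Λ`. -/
def StdTableau (Λ : MPartition m n) : Type := {T : Fin n → MNode m // IsStandard Λ T}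

variable {K : Type u} [Field K]

/-- The content `v_p q^{2(s-r)}` of an `m`-node. -/
def content (q : K) (v : Fin m → K) (α : MNode m) : K :=
  v α.1 * q ^ (2 * ((α.2.2 : ℤ) - (α.2.1 : ℤ)))

/-- The vector space with a basis labelled by the standard `m`-tableaux of shape `Λ`. -/
abbrev TableauSpace (K : Type u) [Field K] (Λ : MPartition m n) : Type u := StdTableau Λ →₀ K

open Classical in
/-- The basis vector labelled by the filling `T`, or `0` if `T` is not standard. -/
noncomputable def tabVec (K : Type u) [Field K] (Λ : MPartition m n) (T : Fin n → MNode m) :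
    TableauSpace K Λ :=
  if h : IsStandard Λ T then Finsupp.single ⟨T, h⟩ 1 else 0

/-- `ρ` is the seminormal representation `V_Λ` of `H(m,1,n)`: with `c = c(T|i)`, `c' = c(T|i+1)`,
`τ T = c(T|1) T` and
`σ_i T = (q-q⁻¹)c'/(c'-c) T + (qc'-q⁻¹c)/(c'-c) T^{s_i}`,
where `T^{s_i}` is `T` with the numbers `i` and `i+1` exchanged, read as `0` if not standard. -/
structure IsSeminormal {q : K} {v : Fin m → K} (Λ : MPartition m n)
    (ρ : Hecke n q v →ₐ[K] Module.End K (TableauSpace K Λ)) : Prop where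
  tau : ∀ (h : 0 < n) (T : Fin n → MNode m), IsStandard Λ T →
    ρ (tau q v h) (tabVec K Λ T) = content q v (T ⟨0, h⟩) • tabVec K Λ T
  sigma : ∀ (i : ℕ) (h : i + 1 < n) (T : Fin n → MNode m), IsStandard Λ T →
    ρ (sigma q v i h) (tabVec K Λ T) =
      ((q - q⁻¹) * content q v (T ⟨i + 1, h⟩) /
        (content q v (T ⟨i + 1, h⟩) - content q v (T ⟨i, by omega⟩))) • tabVec K Λ T +
      ((q * content q v (T ⟨i + 1, h⟩) - q⁻¹ * content q v (T ⟨i, by omega⟩)) /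
        (content q v (T ⟨i + 1, h⟩) - content q v (T ⟨i, by omega⟩))) •
          tabVec K Λ (T ∘ Equiv.swap ⟨i, by omega⟩ ⟨i + 1, h⟩)

end Combinatorics

end CyclotomicHecke

open CyclotomicHecke

/-! The seminormal formulas identify the Hecke algebra with the product of the matrix algebras End
V_λ over all shapes λ (`Generic.repEquiv`), and every claim is read off from this product. The
identification is a squeeze of dimensions.

Upper bound: as a right module over the image of H(m,1,n), the algebra H(m,1,n+1) is spanned by the
(n+1)m elements σ_j⁻¹⋯σ_1⁻¹ τ^a σ_1⋯σ_n with j ≤ n and a < m (`cosetSpan_eq_top`,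
`tau_pow_mem_span`). Hence dim H(m,1,n) ≤ m^n n!.

Lower bound: the formulas respect the relations (`Generic.lift_genOp_rel`), and J_i acts on a
tableau X by the scalar c(X|i) (`Generic.rep_JM`). For generic parameters the contents determine the
tableau and its shape (`Generic.content_sep`), so polynomials in the J_i realize every diagonal
action. The off-diagonal coefficients of σ_i do not vanish on admissible exchanges, and such
exchanges connect all tableaux of one shape, so every matrix unit occurs
(`Generic.exists_isColumn_single`). Thus H(m,1,n) maps onto a product of dimension Σ f_λ², where f_λ
counts the standard tableaux. Since an m-partition has at least m more addable than removable nodes,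
Σ f_λ² ≥ m^n n! (`le_sum_sq_numTableaux`).

Consequences: sorting the tableaux by the node of the largest entry splits the restriction of V_λ
(`branchEquiv`). Every shape arises by removing a node from a larger one, so no nonzero element of
the smaller algebra dies in the larger one. An element of the centralizer of H(m,1,n) commutes with
J_1, …, J_n, whose joint eigenspaces in each V_λ are lines, so it is diagonal. Its eigenvalue
depends only on the shape below the largest entry and on the content of that entry, and
interpolation writes it through the center and J_{n+1}. Finally the J_i generate exactly the
diagonal elements, an algebra equal to its own centralizer. -/

namespace CyclotomicHecke

/-! ### Relations, induction principle and extensionality for the Hecke algebra. -/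

section Relations

variable {K : Type u} [Field K] {m n : ℕ} (q : K) (v : Fin m → K)

theorem mk_freeTau (h : 0 < n) : mk n q v (freeTau K h) = tau q v h := rfl

theorem mk_freeSigma (i : ℕ) (h : i + 1 < n) : mk n q v (freeSigma K i h) = sigma q v i h := rfl

theorem sigma_braid (i : ℕ) (h : i + 2 < n) :
    sigma q v i (by omega) * sigma q v (i + 1) h * sigma q v i (by omega) =
      sigma q v (i + 1) h * sigma q v i (by omega) * sigma q v (i + 1) h := by
  simpa only [map_mul, mk_freeTau, mk_freeSigma] using mk_rel q v (Rel.braid i h)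

theorem sigma_far (i j : ℕ) (hi : i + 1 < n) (hj : j + 1 < n) (hij : i + 1 < j ∨ j + 1 < i) :
    sigma q v i hi * sigma q v j hj = sigma q v j hj * sigma q v i hi := by
  simpa only [map_mul, mk_freeTau, mk_freeSigma] using mk_rel q v (Rel.far i j hi hj hij)

theorem tau_braid (h : 1 < n) :
    tau q v (by omega) * sigma q v 0 h * tau q v (by omega) * sigma q v 0 h =
      sigma q v 0 h * tau q v (by omega) * sigma q v 0 h * tau q v (by omega) := by
  simpa only [map_mul, mk_freeTau, mk_freeSigma] using mk_rel q v (Rel.tauBraid h)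

theorem tau_far (i : ℕ) (hi : i + 1 < n) (h : 0 < i) :
    tau q v (by omega) * sigma q v i hi = sigma q v i hi * tau q v (by omega) := by
  simpa only [map_mul, mk_freeTau, mk_freeSigma] using mk_rel q v (Rel.tauFar i hi h)

theorem sigma_quad (i : ℕ) (h : i + 1 < n) :
    sigma q v i h * sigma q v i h = (q - q⁻¹) • sigma q v i h + 1 := by
  simpa only [map_mul, map_add, map_smul, map_one, mk_freeSigma] using mk_rel q v (Rel.quad i h)

theorem tau_cyclotomic (h : 0 < n) :
    (List.ofFn fun j : Fin m => tau q v h - algebraMap K _ (v j)).prod = 0 := by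
  have := mk_rel q v (Rel.cyclo h)
  simpa only [map_list_prod, List.map_ofFn, map_zero, Function.comp_def, map_sub,
    AlgHom.commutes, mk_freeTau] using this

theorem aeval_tau_eq_zero (h : 0 < n) :
    Polynomial.aeval (tau q v h) (∏ j : Fin m, (Polynomial.X - Polynomial.C (v j))) = 0 := by
  rw [← tau_cyclotomic q v h, ← List.prod_ofFn, map_list_prod, List.map_ofFn]
  simp [Function.comp_def]

theorem incl_mk (x : FreeAlgebra K (Gen n)) :
    incl n q v (mk n q v x) = mk (n + 1) q v (freeIncl K n x) :=
  RingQuot.liftAlgHom_mkAlgHom_apply K _ _ x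

@[simp]
theorem incl_tau (h : 0 < n) : incl n q v (tau q v h) = tau q v (by omega) := by
  rw [← mk_freeTau, incl_mk, freeIncl_tau, mk_freeTau]

@[simp]
theorem incl_sigma (i : ℕ) (h : i + 1 < n) :
    incl n q v (sigma q v i h) = sigma q v i (by omega) := by
  rw [← mk_freeSigma, incl_mk, freeIncl_sigma, mk_freeSigma]

variable {q v}

@[elab_as_elim]
theorem Hecke.induction {P : Hecke n q v → Prop} (x : Hecke n q v)
    (algebraMap : ∀ a : K, P (algebraMap K _ a)) (tau : ∀ h, P (tau q v h))
    (sigma : ∀ i h, P (sigma q v i h)) (mul : ∀ x y, P x → P y → P (x * y))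
    (add : ∀ x y, P x → P y → P (x + y)) : P x := by
  obtain ⟨y, rfl⟩ := RingQuot.mkAlgHom_surjective K (Rel n q v) x
  change P (mk n q v y)
  induction y using FreeAlgebra.induction with
  | grade0 r => simpa using algebraMap r
  | grade1 g =>
    cases g with
    | tau h => exact tau h
    | sigma i h => exact sigma i h
  | mul a b ha hb => simpa using mul _ _ ha hb
  | add a b ha hb => simpa using add _ _ ha hb

theorem Hecke.algHom_ext {B : Type*} [Semiring B] [Algebra K B] {f g : Hecke n q v →ₐ[K] B}
    (htau : ∀ h, f (tau q v h) = g (tau q v h))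
    (hsigma : ∀ i h, f (sigma q v i h) = g (sigma q v i h)) : f = g := by
  ext x
  induction x using Hecke.induction with
  | algebraMap a => simp
  | tau h => exact htau h
  | sigma i h => exact hsigma i h
  | mul x y hx hy => simp [hx, hy]
  | add x y hx hy => simp [hx, hy]

/-- A linear map that commutes with the action of the generators commutes with the action of the
whole algebra. -/
theorem Hecke.intertwines {V W : Type*} [AddCommGroup V] [Module K V] [AddCommGroup W] [Module K W]
    (θ : Hecke n q v →ₐ[K] Module.End K V) (θ' : Hecke n q v →ₐ[K] Module.End K W)
    (f : V →ₗ[K] W)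
    (htau : ∀ h x, f (θ (CyclotomicHecke.tau q v h) x) = θ' (CyclotomicHecke.tau q v h) (f x))
    (hsigma : ∀ i h x, f (θ (CyclotomicHecke.sigma q v i h) x) =
      θ' (CyclotomicHecke.sigma q v i h) (f x))
    (a : Hecke n q v) (x : V) : f (θ a x) = θ' a (f x) := by
  induction a using Hecke.induction generalizing x with
  | algebraMap a => simp [Module.algebraMap_end_apply]
  | tau h => exact htau h x
  | sigma i h => exact hsigma i h x
  | mul a b ha hb => simp [ha, hb]
  | add a b ha hb => simp [ha, hb]

end Relations

/-! ### Commutation identities in an algebra with the braid relations of type B. -/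

section Spanning

/-! Coset representatives of `H(m,1,n)` in `H(m,1,n+1)`. -/

variable {K : Type*} [Field K] {A : Type*} [Ring A] [Algebra K A]

/-- The product `σ_j⁻¹ ⋯ σ_1⁻¹`, where `σ_i⁻¹ = σ_i - c`. -/
def descProd (c : K) (s : ℕ → A) : ℕ → A
  | 0 => 1
  | j + 1 => (s j - algebraMap K A c) * descProd c s j

/-- The product `σ_1 ⋯ σ_j`. -/
def ascProd (s : ℕ → A) : ℕ → A
  | 0 => 1
  | j + 1 => ascProd s j * s j

/-- The relations of the braid group of type B and the quadratic relation, for elements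
`τ, s_0, …, s_{n-1}` of an algebra. -/
structure HeckeRelations (n : ℕ) (c : K) (s : ℕ → A) (τ : A) : Prop where
  far : ∀ i j, i + 1 < j → Commute (s i) (s j)
  tauFar : ∀ i, 0 < i → Commute τ (s i)
  braid : ∀ i, i + 1 < n → s i * s (i + 1) * s i = s (i + 1) * s i * s (i + 1)
  tauBraid : 0 < n → τ * s 0 * τ * s 0 = s 0 * τ * s 0 * τ
  quad : ∀ i < n, s i * s i = algebraMap K A c * s i + 1

namespace HeckeRelations

variable {n : ℕ} {c : K} {s : ℕ → A} {τ : A} (R : HeckeRelations n c s τ)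
include R

theorem inv_mul {i : ℕ} (h : i < n) : (s i - algebraMap K A c) * s i = 1 := by
  rw [sub_mul, R.quad i h]; abel

theorem mul_inv {i : ℕ} (h : i < n) : s i * (s i - algebraMap K A c) = 1 := by
  rw [mul_sub, R.quad i h, Algebra.commutes]; abel

theorem commute_descProd {i j : ℕ} (h : j < i) : Commute (s i) (descProd c s j) := by
  induction j with
  | zero => exact Commute.one_right _
  | succ j ih =>
    exact ((R.far j i h).symm.sub_right (Algebra.commute_algebraMap_right _ _)).mul_right
      (ih (by omega))

theorem commute_ascProd {i j : ℕ} (h : j < i) : Commute (s i) (ascProd s j) := by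
  induction j with
  | zero => exact Commute.one_right _
  | succ j ih => exact (ih (by omega)).mul_right (R.far j i h).symm

/-- The letters before `s i` commute with `s (i + 1)`, the braid relation turns `s (i + 1)` into `s
i` across the pair `s i * s (i + 1)`, and all later letters commute with `s i`. -/
theorem mul_ascProd {i j : ℕ} (hi : i + 1 < j) (hj : j ≤ n) :
    s (i + 1) * ascProd s j = ascProd s j * s i := by
  induction j, hi using Nat.le_induction with
  | base =>
    have h1 := (R.commute_ascProd (show i < i + 1 by omega)).eq
    calc s (i + 1) * (ascProd s i * s i * s (i + 1))
        = (s (i + 1) * ascProd s i) * s i * s (i + 1) := by noncomm_ring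
      _ = ascProd s i * (s (i + 1) * s i * s (i + 1)) := by rw [h1]; noncomm_ring
      _ = ascProd s i * s i * s (i + 1) * s i := by
          rw [← R.braid i (by omega)]; noncomm_ring
  | succ j hi ih =>
    have h1 := (R.far i j (by omega)).eq
    change s (i + 1) * (ascProd s j * s j) = ascProd s j * s j * s i
    rw [← mul_assoc, ih (by omega), mul_assoc, mul_assoc, h1]

/-- This is the braid relation multiplied by inverses: inserting b'b and a'a creates the factor aba,
which becomes bab, and the inverses then cancel. -/
theorem inv_braid {i : ℕ} (h : i + 1 < n) :
    s i * ((s (i + 1) - algebraMap K A c) * (s i - algebraMap K A c)) =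
      (s (i + 1) - algebraMap K A c) * (s i - algebraMap K A c) * s (i + 1) := by
  have e1 := R.inv_mul h
  have e2 := R.mul_inv (i := i) (by omega)
  have e3 := R.braid i h
  set a := s i
  set b := s (i + 1)
  set a' := a - algebraMap K A c
  set b' := b - algebraMap K A c
  calc a * (b' * a') = (b' * b) * a * (b' * a') := by rw [e1, one_mul]
    _ = b' * (a' * a) * b * a * b' * a' := by
        rw [R.inv_mul (i := i) (by omega)]; noncomm_ring
    _ = b' * a' * (a * b * a) * b' * a' := by noncomm_ring
    _ = b' * a' * b * a * (b * b') * a' := by rw [e3]; noncomm_ring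
    _ = b' * a' * b * (a * a') := by rw [R.mul_inv h]; noncomm_ring
    _ = _ := by rw [e2, mul_one]

theorem mul_descProd {i j : ℕ} (hi : i + 1 < j) (hj : j ≤ n) :
    s i * descProd c s j = descProd c s j * s (i + 1) := by
  induction j, hi using Nat.le_induction with
  | base =>
    have h1 := (R.commute_descProd (show i < i + 1 by omega)).eq
    change s i * ((s (i + 1) - _) * ((s i - _) * descProd c s i)) =
      (s (i + 1) - _) * ((s i - _) * descProd c s i) * s (i + 1)
    rw [mul_assoc, mul_assoc, ← h1, ← mul_assoc (s (i + 1) - _), ← mul_assoc (s i),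
      R.inv_braid (by omega)]
    noncomm_ring
  | succ j hi ih =>
    have h1 : Commute (s i) (s j - algebraMap K A c) :=
      (R.far i j (by omega)).sub_right (Algebra.commute_algebraMap_right _ _)
    change s i * ((s j - _) * descProd c s j) = (s j - _) * descProd c s j * s (i + 1)
    rw [← mul_assoc, h1.eq, mul_assoc, ih (by omega), mul_assoc]

theorem descProd_mul_ascProd {j : ℕ} (hj : j ≤ n) : descProd c s j * ascProd s j = 1 := by
  -- The free right factor lets the inductive step absorb the new letter `s j`, which stands at the
  -- inner end and only then meets its inverse.
  suffices ∀ x, descProd c s j * (ascProd s j * x) = x by simpa using this 1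
  intro x
  induction j generalizing x with
  | zero => simp [descProd, ascProd]
  | succ j ih =>
    change (s j - _) * descProd c s j * (ascProd s j * s j * x) = x
    rw [mul_assoc, mul_assoc (ascProd s j), ih (by omega), ← mul_assoc, R.inv_mul hj, one_mul]

/-- By the type B braid relation σ_1τσ_1 commutes with τ, hence with τ^a. So σ_1⁻¹τ^aσ_1τ =
τσ_1τ^aσ_1⁻¹, and expanding σ_1⁻¹ = σ_1 - c on both sides leaves the correction term. -/
theorem tau_mul_inv (hn : 0 < n) (a : ℕ) :
    τ * (s 0 - algebraMap K A c) * τ ^ a * s 0 =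
      (s 0 - algebraMap K A c) * τ ^ a * s 0 * τ +
        algebraMap K A c * (τ * s 0 * τ ^ a - τ ^ (a + 1) * s 0) := by
  have h1 : Commute (s 0 * τ * s 0) (τ ^ a) := by
    refine Commute.pow_right ?_ a
    have := R.tauBraid hn
    change s 0 * τ * s 0 * τ = τ * (s 0 * τ * s 0)
    rw [← this]; noncomm_ring
  have h2 : (s 0 - algebraMap K A c) * τ ^ a * s 0 * τ =
      τ * s 0 * τ ^ a * (s 0 - algebraMap K A c) := by
    calc (s 0 - algebraMap K A c) * τ ^ a * s 0 * τ
        = (s 0 - algebraMap K A c) * (τ ^ a * (s 0 * τ * (s 0 * (s 0 - algebraMap K A c)))) := by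
          rw [R.mul_inv hn, mul_one]; noncomm_ring
      _ = (s 0 - algebraMap K A c) * (τ ^ a * (s 0 * τ * s 0)) * (s 0 - algebraMap K A c) := by
          noncomm_ring
      _ = ((s 0 - algebraMap K A c) * s 0) * τ * s 0 * τ ^ a * (s 0 - algebraMap K A c) := by
          rw [← h1.eq]; noncomm_ring
      _ = _ := by rw [R.inv_mul hn]; noncomm_ring
  have h3 : τ * s 0 * τ ^ a * algebraMap K A c = algebraMap K A c * (τ * s 0 * τ ^ a) :=
    (Algebra.commutes _ _).symm
  have h4 : τ * algebraMap K A c * τ ^ a * s 0 = algebraMap K A c * (τ * τ ^ a * s 0) := by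
    rw [← Algebra.commutes]; noncomm_ring
  rw [h2, mul_sub, sub_mul, mul_sub, h3, sub_mul, h4, pow_succ' τ a, mul_sub (algebraMap K A c)]
  noncomm_ring

/-- The only obstruction to moving τ to the right is σ_1. The correction terms begin with a power of
τ times the full ascending product, so they are representatives with j = 0, followed by a factor
from the smaller algebra. -/
theorem tau_mul_descProd {j : ℕ} (hj : j < n) (a : ℕ) :
    τ * descProd c s (j + 1) * τ ^ a * ascProd s n =
      descProd c s (j + 1) * τ ^ a * ascProd s n * τ +
        algebraMap K A c * (τ * ascProd s n * descProd c s j * τ ^ a -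
          τ ^ (a + 1) * ascProd s n * descProd c s j) := by
  induction j with
  | zero =>
    -- The ascending product is built up one letter at a time: after the first letter all others
    -- commute with τ.
    have key : ∀ k, 0 < k → k ≤ n →
        τ * descProd c s 1 * τ ^ a * ascProd s k =
          descProd c s 1 * τ ^ a * ascProd s k * τ +
            algebraMap K A c * (τ * ascProd s k * τ ^ a - τ ^ (a + 1) * ascProd s k) := by
      intro k hk hkn
      induction k, hk using Nat.le_induction with
      | base => simpa [descProd, ascProd] using R.tau_mul_inv hj a
      | succ k hk ih =>
        have h1 := (R.tauFar k hk).eq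
        have h2 := ((R.tauFar k hk).pow_left a).eq
        change τ * descProd c s 1 * τ ^ a * (ascProd s k * s k) =
          descProd c s 1 * τ ^ a * (ascProd s k * s k) * τ +
            algebraMap K A c * (τ * (ascProd s k * s k) * τ ^ a - τ ^ (a + 1) * (ascProd s k * s k))
        rw [← mul_assoc, ih (by omega), add_mul]
        congr 1
        · simp only [mul_assoc, h1]
        · simp only [mul_assoc, sub_mul, h2]
    simpa [descProd] using key n hj le_rfl
  | succ j ih =>
    have h1 : Commute τ (s (j + 1) - algebraMap K A c) :=
      (R.tauFar _ (by omega)).sub_right (Algebra.commute_algebraMap_right _ _)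
    have h2 : (s (j + 1) - algebraMap K A c) * ascProd s n =
        ascProd s n * (s j - algebraMap K A c) := by
      rw [sub_mul, R.mul_ascProd hj le_rfl, mul_sub, Algebra.commutes]
    have h3 : (s (j + 1) - algebraMap K A c) * algebraMap K A c =
      algebraMap K A c * (s (j + 1) - algebraMap K A c) := (Algebra.commutes _ _).symm
    change τ * ((s (j + 1) - algebraMap K A c) * descProd c s (j + 1)) * τ ^ a * ascProd s n =
      (s (j + 1) - algebraMap K A c) * descProd c s (j + 1) * τ ^ a * ascProd s n * τ + _ *
       (τ * ascProd s n * ((s j - algebraMap K A c) * descProd c s j) * τ ^ a -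
        τ ^ (a + 1) * ascProd s n * ((s j - algebraMap K A c) * descProd c s j))
    rw [← mul_assoc τ, h1.eq, mul_assoc (s (j + 1) - algebraMap K A c), mul_assoc, mul_assoc,
      ← mul_assoc _ (τ ^ a), ih (by omega), mul_add]
    congr 1
    · simp only [mul_assoc]
    · rw [← mul_assoc, h3, mul_assoc, mul_sub]
      congr 2
      · calc (s (j + 1) - algebraMap K A c) * (τ * ascProd s n * descProd c s j * τ ^ a)
            = ((s (j + 1) - algebraMap K A c) * τ) * (ascProd s n * descProd c s j * τ ^ a) := by
              simp only [mul_assoc]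
          _ = τ * ((s (j + 1) - algebraMap K A c) * ascProd s n) * (descProd c s j * τ ^ a) := by
              rw [← h1.eq]; simp only [mul_assoc]
          _ = _ := by rw [h2]; simp only [mul_assoc]
      · calc (s (j + 1) - algebraMap K A c) * (τ ^ (a + 1) * ascProd s n * descProd c s j)
            = ((s (j + 1) - algebraMap K A c) * τ ^ (a + 1)) * (ascProd s n * descProd c s j) := by
              simp only [mul_assoc]
          _ = τ ^ (a + 1) * ((s (j + 1) - algebraMap K A c) * ascProd s n) * descProd c s j := by
              rw [← (h1.pow_left _).eq]; simp only [mul_assoc]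
          _ = _ := by rw [h2]; simp only [mul_assoc]

end HeckeRelations

end Spanning

/-! ### The upper bound m^n n! for the dimension. -/

section Dimension

variable {K : Type u} [Field K] {m n : ℕ} {q : K} {v : Fin m → K}

/-- The generator `σ_{i+1}` of `H(m,1,n+1)`, extended by `1` to all indices. -/
noncomputable def sigmaOrOne (n : ℕ) (q : K) (v : Fin m → K) (i : ℕ) : Hecke (n + 1) q v :=
  if h : i + 1 < n + 1 then sigma q v i h else 1

theorem sigmaOrOne_of_lt {i : ℕ} (h : i < n) :
    sigmaOrOne n q v i = sigma q v i (Nat.succ_lt_succ h) :=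
  dif_pos (Nat.succ_lt_succ h)

theorem incl_sigmaOrOne {i : ℕ} (h : i < n) :
    incl (n + 1) q v (sigmaOrOne n q v i) = sigmaOrOne (n + 1) q v i := by
  rw [sigmaOrOne_of_lt h, incl_sigma, sigmaOrOne_of_lt (by omega)]

/-- Padding with 1 is harmless because the commutation relations hold trivially for it; the braid
and quadratic relations, which could fail for it, are required only in range. -/
theorem heckeRelations : HeckeRelations n (q - q⁻¹) (sigmaOrOne n q v) (tau q v n.succ_pos) where
  far i j h := by
    unfold sigmaOrOne
    split_ifs with hi hj
    · exact sigma_far q v i j hi hj (Or.inl h)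
    · exact Commute.one_right _
    · exact Commute.one_left _
    · exact Commute.one_left _
  tauFar i h := by
    unfold sigmaOrOne
    split_ifs with hi
    · exact tau_far q v i hi h
    · exact Commute.one_right _
  braid i h := by
    rw [sigmaOrOne_of_lt h, sigmaOrOne_of_lt (i := i) (by omega)]
    exact sigma_braid q v i _
  tauBraid h := by
    rw [sigmaOrOne_of_lt h]
    exact tau_braid q v _
  quad i h := by
    rw [sigmaOrOne_of_lt h, sigma_quad, Algebra.smul_def]

/-- The representatives `σ_j⁻¹ ⋯ σ_1⁻¹ τ^a σ_1 ⋯ σ_n`, which generate `H(m,1,n+1)` as a right module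
over `H(m,1,n)`. -/
noncomputable def cosetRep (n : ℕ) (q : K) (v : Fin m → K) (j a : ℕ) : Hecke (n + 1) q v :=
  descProd (q - q⁻¹) (sigmaOrOne n q v) j * tau q v n.succ_pos ^ a * ascProd (sigmaOrOne n q v) n

theorem descProd_mem_range_incl {j : ℕ} (h : j < n) :
    descProd (q - q⁻¹) (sigmaOrOne n q v) j ∈ (incl n q v).range := by
  obtain ⟨n, rfl⟩ : ∃ k, n = k + 1 := ⟨n - 1, by omega⟩
  induction j with
  | zero => exact one_mem _
  | succ j ih =>
    refine mul_mem (sub_mem ?_ (Subalgebra.algebraMap_mem _ _)) (ih (by omega))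
    exact ⟨_, incl_sigmaOrOne (by omega)⟩

/-- The right `H(m,1,n)`-submodule of `H(m,1,n+1)` generated by the representatives. -/
noncomputable def cosetSpan (n : ℕ) (q : K) (v : Fin m → K) : Submodule K (Hecke (n + 1) q v) :=
  Submodule.span K {x | ∃ j ≤ n, ∃ a, ∃ b ∈ (incl n q v).range, x = cosetRep n q v j a * b}

theorem cosetRep_mul_mem {j : ℕ} (hj : j ≤ n) (a : ℕ) {b : Hecke (n + 1) q v}
    (hb : b ∈ (incl n q v).range) : cosetRep n q v j a * b ∈ cosetSpan n q v :=
  Submodule.subset_span ⟨j, hj, a, b, hb, rfl⟩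

/-- For i = j - 1 the letter cancels and shortens the descending product; for i = j the quadratic
relation lengthens it, with a multiple of the old representative as correction. Otherwise the letter
slides through all three factors and leaves on the right inside H(m,1,n): the descending product
raises the index by one (i < j - 1) or keeps it (i > j), and the ascending product lowers it by one.
-/
theorem sigma_mul_cosetRep (i : ℕ) (hi : i < n) {j : ℕ} (hj : j ≤ n) (a : ℕ)
    {b : Hecke (n + 1) q v} (hb : b ∈ (incl n q v).range) :
    sigmaOrOne n q v i * (cosetRep n q v j a * b) ∈ cosetSpan n q v := by
  have R := heckeRelations (n := n) (q := q) (v := v)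
  have hmem : ∀ i, i + 1 < n → sigmaOrOne n q v i ∈ (incl n q v).range := by
    intro i hi
    obtain ⟨n, rfl⟩ : ∃ k, n = k + 1 := ⟨n - 1, by omega⟩
    exact ⟨_, incl_sigmaOrOne (by omega)⟩
  rw [← mul_assoc]
  unfold cosetRep
  rcases lt_trichotomy i j with hij | rfl | hij
  · obtain ⟨k, rfl⟩ : ∃ k, j = k + 1 := ⟨j - 1, by omega⟩
    rcases eq_or_lt_of_le (Nat.lt_succ_iff.1 hij) with rfl | hik
    · have : sigmaOrOne n q v i * descProd (q - q⁻¹) (sigmaOrOne n q v) (i + 1) =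
          descProd (q - q⁻¹) (sigmaOrOne n q v) i := by
        rw [descProd, ← mul_assoc, R.mul_inv hi, one_mul]
      rw [← mul_assoc, ← mul_assoc, this]
      exact cosetRep_mul_mem (by omega) a hb
    · have h1 := R.mul_descProd (c := q - q⁻¹) (i := i) (j := k + 1) (by omega) hj
      have h2 := ((R.tauFar (i + 1) (by omega)).pow_left a).eq
      have h3 := R.mul_ascProd (i := i) (j := n) (by omega) le_rfl
      rw [← mul_assoc, ← mul_assoc, h1, mul_assoc (descProd _ _ _), ← h2, ← mul_assoc,
        mul_assoc _ _ (ascProd _ _), h3, ← mul_assoc, mul_assoc]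
      exact cosetRep_mul_mem hj a (mul_mem (hmem i (by omega)) hb)
  · have h1 : sigmaOrOne n q v i * descProd (q - q⁻¹) (sigmaOrOne n q v) i =
        descProd (q - q⁻¹) (sigmaOrOne n q v) (i + 1) +
          (q - q⁻¹) • descProd (q - q⁻¹) (sigmaOrOne n q v) i := by
      rw [descProd, sub_mul, Algebra.smul_def, sub_add_cancel]
    rw [← mul_assoc, ← mul_assoc, h1, add_mul, add_mul, add_mul, smul_mul_assoc, smul_mul_assoc,
      smul_mul_assoc]
    exact add_mem (cosetRep_mul_mem (by omega) a hb)
      (Submodule.smul_mem _ _ (cosetRep_mul_mem hj a hb))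
  · obtain ⟨k, rfl⟩ : ∃ k, i = k + 1 := ⟨i - 1, by omega⟩
    have h1 := (R.commute_descProd (c := q - q⁻¹) hij).eq
    have h2 := ((R.tauFar (k + 1) (by omega)).pow_left a).eq
    have h3 := R.mul_ascProd (i := k) (j := n) (by omega) le_rfl
    rw [← mul_assoc, ← mul_assoc, h1, mul_assoc (descProd _ _ _), ← h2, ← mul_assoc,
      mul_assoc _ _ (ascProd _ _), h3, ← mul_assoc, mul_assoc]
    exact cosetRep_mul_mem hj a (mul_mem (hmem k (by omega)) hb)

/-- For j = 0 the exponent of τ grows; it is not yet bounded by m. For j > 0 the factors left over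
by `tau_mul_descProd` lie in H(m,1,n), since the shorter descending product has fewer than n
letters. -/
theorem tau_mul_cosetRep {j : ℕ} (hj : j ≤ n) (a : ℕ)
    {b : Hecke (n + 1) q v} (hb : b ∈ (incl n q v).range) :
    tau q v n.succ_pos * (cosetRep n q v j a * b) ∈ cosetSpan n q v := by
  have R := heckeRelations (n := n) (q := q) (v := v)
  cases j with
  | zero =>
    have := cosetRep_mul_mem hj (a + 1) hb
    simpa only [cosetRep, descProd, one_mul, pow_succ', mul_assoc] using this
  | succ k =>
    have hn : 0 < n := by omega
    have htau : tau q v n.succ_pos ∈ (incl n q v).range := ⟨tau q v hn, incl_tau q v hn⟩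
    have hP := descProd_mem_range_incl (q := q) (v := v) (show k < n by omega)
    have e : tau q v n.succ_pos * (cosetRep n q v (k + 1) a * b) =
        cosetRep n q v (k + 1) a * (tau q v n.succ_pos * b) + (q - q⁻¹) •
          (cosetRep n q v 0 1 * (descProd (q - q⁻¹) (sigmaOrOne n q v) k *
            tau q v n.succ_pos ^ a * b) -
          cosetRep n q v 0 (a + 1) * (descProd (q - q⁻¹) (sigmaOrOne n q v) k * b)) := by
      have h := congrArg (· * b) (R.tau_mul_descProd (c := q - q⁻¹) (j := k) hj a)
      simp only [Algebra.smul_def, cosetRep, descProd, one_mul, pow_one, mul_assoc, add_mul,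
        sub_mul, mul_sub] at h ⊢
      exact h
    rw [e]
    refine add_mem (cosetRep_mul_mem hj a (mul_mem htau hb))
      (Submodule.smul_mem _ _ (sub_mem ?_ ?_))
    · exact cosetRep_mul_mem (by omega) 1 (mul_mem (mul_mem hP (pow_mem htau a)) hb)
    · exact cosetRep_mul_mem (by omega) (a + 1) (mul_mem hP hb)

/-- The span is a left ideal by the two preceding computations, and it contains 1, which is the
representative with j = n and a = 0. -/
theorem cosetSpan_eq_top : cosetSpan n q v = ⊤ := by
  have hmul : ∀ x : Hecke (n + 1) q v, ∀ y ∈ cosetSpan n q v, x * y ∈ cosetSpan n q v := by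
    have lift : ∀ x : Hecke (n + 1) q v,
        (∀ j ≤ n, ∀ a, ∀ b ∈ (incl n q v).range, x * (cosetRep n q v j a * b) ∈ cosetSpan n q v) →
        ∀ y ∈ cosetSpan n q v, x * y ∈ cosetSpan n q v := by
      intro x hx y hy
      induction hy using Submodule.span_induction with
      | mem y hy =>
        obtain ⟨j, hj, a, b, hb, rfl⟩ := hy
        exact hx j hj a b hb
      | zero => simp
      | add y z _ _ hy hz => rw [mul_add]; exact add_mem hy hz
      | smul c y _ hy => rw [mul_smul_comm]; exact Submodule.smul_mem _ _ hy
    intro x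
    induction x using Hecke.induction with
    | algebraMap a =>
      intro y hy
      rw [← Algebra.smul_def]
      exact Submodule.smul_mem _ _ hy
    | tau h => exact lift _ fun j hj a b hb => tau_mul_cosetRep hj a hb
    | sigma i h =>
      refine lift _ fun j hj a b hb => ?_
      have := sigma_mul_cosetRep i (by omega) hj a hb
      rwa [sigmaOrOne_of_lt (by omega)] at this
    | mul x y hx hy => intro z hz; rw [mul_assoc]; exact hx _ (hy _ hz)
    | add x y hx hy => intro z hz; rw [add_mul]; exact add_mem (hx _ hz) (hy _ hz)
  have hone : (1 : Hecke (n + 1) q v) ∈ cosetSpan n q v := by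
    have := cosetRep_mul_mem (n := n) (q := q) (v := v) le_rfl 0 (one_mem _)
    rwa [cosetRep, pow_zero, mul_one, mul_one,
      (heckeRelations (n := n) (q := q) (v := v)).descProd_mul_ascProd le_rfl] at this
  exact eq_top_iff.2 fun x _ => by simpa using hmul x 1 hone

/-- Division with remainder by the cyclotomic polynomial, which is monic of degree m and annihilates
τ. -/
theorem tau_pow_mem_span (h : 0 < n) (a : ℕ) :
    tau q v h ^ a ∈ Submodule.span K (Set.range fun i : Fin m => tau q v h ^ (i : ℕ)) := by
  set p : Polynomial K := ∏ j : Fin m, (Polynomial.X - Polynomial.C (v j)) with hp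
  have hmonic : p.Monic := Polynomial.monic_prod_of_monic _ _ fun j _ => Polynomial.monic_X_sub_C _
  have hdeg : p.degree = m := by
    rw [hp, Polynomial.degree_prod]
    simp
  have e : tau q v h ^ a =
      Polynomial.aeval (tau q v h) ((Polynomial.X ^ a : Polynomial K) %ₘ p) := by
    conv_lhs => rw [← Polynomial.aeval_X_pow (R := K) (tau q v h) (n := a),
      ← Polynomial.modByMonic_add_div (Polynomial.X ^ a) p]
    rw [map_add, map_mul, aeval_tau_eq_zero, zero_mul, add_zero]
  rw [e, Polynomial.aeval_eq_sum_range]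
  refine sum_mem fun i hi => ?_
  by_cases hc : ((Polynomial.X ^ a : Polynomial K) %ₘ p).coeff i = 0
  · simp [hc]
  · refine Submodule.smul_mem _ _ (Submodule.subset_span ?_)
    have h1 := Polynomial.le_degree_of_ne_zero hc
    have h2 := Polynomial.degree_modByMonic_lt (Polynomial.X ^ a) hmonic
    rw [hdeg] at h2
    exact ⟨⟨i, by exact_mod_cast h1.trans_lt h2⟩, rfl⟩

/-- The action of the coset representatives, as a surjection onto `H(m,1,n+1)`. -/
noncomputable def cosetMap (n : ℕ) (q : K) (v : Fin m → K) :
    (Fin (n + 1) × Fin m → Hecke n q v) →ₗ[K] Hecke (n + 1) q v :=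
  ∑ x : Fin (n + 1) × Fin m, (LinearMap.mulLeft K (cosetRep n q v x.1 x.2)) ∘ₗ
    (incl n q v).toLinearMap ∘ₗ LinearMap.proj x

theorem cosetMap_surjective : Function.Surjective (cosetMap n q v) := by
  rw [← LinearMap.range_eq_top, ← top_le_iff, ← cosetSpan_eq_top]
  refine Submodule.span_le.2 ?_
  rintro _ ⟨j, hj, a, _, ⟨b, rfl⟩, rfl⟩
  have key : ∀ t ∈ Submodule.span K (Set.range fun i : Fin m => tau q v n.succ_pos ^ (i : ℕ)),
      descProd (q - q⁻¹) (sigmaOrOne n q v) j * t * ascProd (sigmaOrOne n q v) n * incl n q v b ∈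
        LinearMap.range (cosetMap n q v) := by
    intro t ht
    induction ht using Submodule.span_induction with
    | mem t ht =>
      obtain ⟨i, rfl⟩ := ht
      refine ⟨Pi.single (⟨j, by omega⟩, i) b, ?_⟩
      rw [cosetMap, LinearMap.sum_apply, Finset.sum_eq_single (⟨j, by omega⟩, i)]
      · simp [cosetRep, mul_assoc]
      · intro x _ hx
        simp [hx]
      · simp
    | zero => simp
    | add x y _ _ hx hy => simpa only [mul_add, add_mul] using add_mem hx hy
    | smul c x _ hx =>
      simpa only [mul_smul_comm, smul_mul_assoc] using Submodule.smul_mem _ c hx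
  exact key _ (tau_pow_mem_span _ a)

theorem Hecke.zero_eq_algebraMap (x : Hecke 0 q v) : ∃ a : K, algebraMap K _ a = x := by
  induction x using Hecke.induction with
  | algebraMap a => exact ⟨a, rfl⟩
  | tau h => omega
  | sigma i h => omega
  | mul x y hx hy =>
    obtain ⟨a, rfl⟩ := hx
    obtain ⟨b, rfl⟩ := hy
    exact ⟨a * b, map_mul _ _ _⟩
  | add x y hx hy =>
    obtain ⟨a, rfl⟩ := hx
    obtain ⟨b, rfl⟩ := hy
    exact ⟨a + b, map_add _ _ _⟩

theorem finite_and_finrank_le (n : ℕ) (q : K) (v : Fin m → K) :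
    Module.Finite K (Hecke n q v) ∧ Module.finrank K (Hecke n q v) ≤ m ^ n * n.factorial := by
  induction n with
  | zero =>
    have hs : Function.Surjective (Algebra.linearMap K (Hecke 0 q v)) := Hecke.zero_eq_algebraMap
    refine ⟨Module.Finite.of_surjective _ hs, ?_⟩
    simpa using LinearMap.finrank_le_finrank_of_surjective hs
  | succ n ih =>
    obtain ⟨_, ih⟩ := ih
    refine ⟨Module.Finite.of_surjective _ cosetMap_surjective, ?_⟩
    refine (LinearMap.finrank_le_finrank_of_surjective
      (cosetMap_surjective (n := n) (q := q) (v := v))).trans ?_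
    rw [Module.finrank_pi_fintype]
    simp only [Finset.sum_const, Finset.card_univ, Fintype.card_prod, Fintype.card_fin, smul_eq_mul]
    calc (n + 1) * m * Module.finrank K (Hecke n q v) ≤ (n + 1) * m * (m ^ n * n.factorial) :=
          Nat.mul_le_mul_left _ ih
      _ = m ^ (n + 1) * (n + 1).factorial := by rw [Nat.factorial_succ]; ring

instance : Module.Finite K (Hecke n q v) := (finite_and_finrank_le n q v).1

theorem finrank_hecke_le : Module.finrank K (Hecke n q v) ≤ m ^ n * n.factorial :=
  (finite_and_finrank_le n q v).2

end Dimension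

/-! ### Combinatorics of standard tableaux. -/

section Tableaux

variable {m n : ℕ}

/-- The diagonal `s - r` of an `m`-node. -/
def MNode.diagonal (α : MNode m) : ℤ := (α.2.2 : ℤ) - α.2.1

/-- Two `m`-nodes lie in the same line or column of the same component. -/
def MNode.InLine (α β : MNode m) : Prop := α.1 = β.1 ∧ (α.2.1 = β.2.1 ∨ α.2.2 = β.2.2)

theorem MNode.InLine.symm {α β : MNode m} (h : MNode.InLine α β) : MNode.InLine β α :=
  ⟨h.1.symm, h.2.imp Eq.symm Eq.symm⟩

namespace IsStandard

variable {Λ M : MPartition m n} {T S : Fin n → MNode m}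

theorem injective (hT : IsStandard Λ T) : Function.Injective T :=
  Set.injOn_univ.1 hT.bij.injOn

theorem mem (hT : IsStandard Λ T) (i : Fin n) : (T i).2 ∈ Λ.diag (T i).1 :=
  hT.bij.mapsTo (Set.mem_univ i)

theorem exists_eq (hT : IsStandard Λ T) {α : MNode m} (h : α.2 ∈ Λ.diag α.1) : ∃ i, T i = α := by
  obtain ⟨i, -, hi⟩ := hT.bij.surjOn h
  exact ⟨i, hi⟩

/-- Standardness compares only along rows and columns; the general comparison passes through the
corner in the row of `j` and the column of `i`, which belongs to the diagram. -/
theorem lt_of_le (hT : IsStandard Λ T) {i j : Fin n} (h1 : (T i).1 = (T j).1)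
    (h2 : (T i).2.1 ≤ (T j).2.1) (h3 : (T i).2.2 ≤ (T j).2.2) (hne : T i ≠ T j) : i < j := by
  have hmem : ((T j).2.1, (T i).2.2) ∈ Λ.diag (T j).1 :=
    (Λ.diag (T j).1).isLowerSet (show ((T j).2.1, (T i).2.2) ≤ (T j).2 from ⟨le_rfl, h3⟩) (hT.mem j)
  obtain ⟨k, hk⟩ := hT.exists_eq (α := ((T j).1, (T j).2.1, (T i).2.2)) hmem
  have hik : i ≤ k := by
    rcases h2.eq_or_lt with h2 | h2
    · refine (hT.injective ?_).le
      rw [hk]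
      exact Prod.ext h1 (Prod.ext h2 rfl)
    · exact (hT.col i k (by rw [hk]; exact h1) (by rw [hk]) (by rw [hk]; exact h2)).le
  have hkj : k ≤ j := by
    rcases h3.eq_or_lt with h3 | h3
    · refine (hT.injective ?_).le
      rw [hk]
      exact Prod.ext rfl (Prod.ext rfl h3)
    · exact (hT.row k j (by rw [hk]) (by rw [hk]) (by rw [hk]; exact h3)).le
  refine lt_of_le_of_ne (hik.trans hkj) fun h => hne (by rw [h])

theorem exists_pred (hT : IsStandard Λ T) (j : Fin n) {r s : ℕ} (hr : r ≤ (T j).2.1)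
    (hs : s ≤ (T j).2.2) (hne : (r, s) ≠ (T j).2) : ∃ i < j, T i = ((T j).1, r, s) := by
  have hmem : (r, s) ∈ Λ.diag (T j).1 :=
    (Λ.diag (T j).1).isLowerSet (show (r, s) ≤ (T j).2 from ⟨hr, hs⟩) (hT.mem j)
  obtain ⟨i, hi⟩ := hT.exists_eq (α := ((T j).1, r, s)) hmem
  refine ⟨i, hT.lt_of_le ?_ ?_ ?_ ?_, hi⟩ <;> rw [hi]
  · exact hr
  · exact hs
  · exact fun h => hne (congrArg Prod.snd h)

/-- The nodes above `T j` in its column carry distinct smaller numbers. This bounds a diagonal by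
the number of earlier entries in the same component. -/
theorem row_le_card (hT : IsStandard Λ T) (j : Fin n) :
    (T j).2.1 ≤ (Finset.univ.filter fun i => i < j ∧ (T i).1 = (T j).1).card := by
  have hc : ∀ r : Fin (T j).2.1, ∃ i < j, T i = ((T j).1, (r : ℕ), (T j).2.2) := fun r =>
    hT.exists_pred j r.2.le le_rfl fun h => r.2.ne (congrArg Prod.fst h)
  choose f hf1 hf2 using hc
  have := Finset.card_le_card_of_injOn (s := (Finset.univ : Finset (Fin (T j).2.1))) f
    (t := Finset.univ.filter fun i => i < j ∧ (T i).1 = (T j).1)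
    (fun r _ => by simp [hf1, hf2]) (fun r _ r' _ h => ?_)
  · simpa using this
  · have h' := congrArg T h
    rw [hf2, hf2] at h'
    simpa [Fin.ext_iff] using h'

theorem col_le_card (hT : IsStandard Λ T) (j : Fin n) :
    (T j).2.2 ≤ (Finset.univ.filter fun i => i < j ∧ (T i).1 = (T j).1).card := by
  have hc : ∀ s : Fin (T j).2.2, ∃ i < j, T i = ((T j).1, (T j).2.1, (s : ℕ)) := fun s =>
    hT.exists_pred j le_rfl s.2.le fun h => s.2.ne (congrArg Prod.snd h)
  choose f hf1 hf2 using hc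
  have := Finset.card_le_card_of_injOn (s := (Finset.univ : Finset (Fin (T j).2.2))) f
    (t := Finset.univ.filter fun i => i < j ∧ (T i).1 = (T j).1)
    (fun r _ => by simp [hf1, hf2]) (fun r _ r' _ h => ?_)
  · simpa using this
  · have h' := congrArg T h
    rw [hf2, hf2] at h'
    simpa [Fin.ext_iff] using h'

/-- The nodes to the left of `T j` and those above `S j` are all occupied by numbers below `j`,
where the two tableaux agree. A row and a column share at most one node, which accounts for the
extra 1. -/
theorem col_add_row_le (hT : IsStandard Λ T) (hS : IsStandard M S) (j : Fin n)
    (hag : ∀ i < j, T i = S i) (hp : (T j).1 = (S j).1) :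
    (T j).2.2 + (S j).2.1 ≤ (j : ℕ) + 1 := by
  classical
  set A : Finset (MNode m) := (Finset.range (T j).2.2).image fun s => ((T j).1, (T j).2.1, s)
  set B : Finset (MNode m) := (Finset.range (S j).2.1).image fun r => ((T j).1, r, (S j).2.2)
  have hA : A.card = (T j).2.2 := by
    rw [Finset.card_image_of_injective, Finset.card_range]
    intro a b h
    simpa using h
  have hB : B.card = (S j).2.1 := by
    rw [Finset.card_image_of_injective, Finset.card_range]
    intro a b h
    simpa using h
  have hAB : (A ∩ B).card ≤ 1 := by
    have : A ∩ B ⊆ {((T j).1, (T j).2.1, (S j).2.2)} := by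
      intro x hx
      simp only [A, B, Finset.mem_inter, Finset.mem_image] at hx
      obtain ⟨⟨s, -, rfl⟩, ⟨r, -, h⟩⟩ := hx
      simp only [Prod.mk.injEq, true_and] at h
      simp [h.2]
    simpa using Finset.card_le_card this
  have hU : (A ∪ B).card ≤ j := by
    have : A ∪ B ⊆ (Finset.univ.filter fun i => i < j).image T := by
      refine Finset.union_subset ?_ ?_ <;> intro x hx <;>
        obtain ⟨t, ht, rfl⟩ := Finset.mem_image.1 hx <;> rw [Finset.mem_range] at ht
      · obtain ⟨i, hi, hi'⟩ := hT.exists_pred j le_rfl ht.le fun h => ht.ne (congrArg Prod.snd h)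
        exact Finset.mem_image.2 ⟨i, by simpa using hi, hi'⟩
      · obtain ⟨i, hi, hi'⟩ := hS.exists_pred j ht.le le_rfl fun h => ht.ne (congrArg Prod.fst h)
        exact Finset.mem_image.2 ⟨i, by simpa using hi, by rw [hag i hi, hi', hp]⟩
    refine (Finset.card_le_card this).trans (Finset.card_image_le.trans ?_)
    have : (Finset.univ.filter fun i : Fin n => i < j) = Finset.Iio j := by ext; simp
    rw [this, Fin.card_Iio]
  have := Finset.card_union_add_card_inter A B
  omega

/-- Two standard tableaux of the same shape that agree below `j`: the nodes in position `j` are not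
strictly ordered in their component. -/
theorem not_lt_of_agree (hT : IsStandard Λ T) (hS : IsStandard M S) {j : Fin n}
    (hag : ∀ i < j, T i = S i) (hp : (T j).1 = (S j).1) (h1 : (T j).2.1 ≤ (S j).2.1)
    (h2 : (T j).2.2 ≤ (S j).2.2) : T j = S j := by
  by_contra hne
  -- In `S` the node `T j` already carries some `i < j`; by agreement `T` puts the same `i` there,
  -- against injectivity.
  obtain ⟨i, hi, h⟩ := hS.exists_pred j h1 h2 fun h => hne (Prod.ext hp h)
  rw [← hag i hi, ← hp] at h
  exact hi.ne (hT.injective h)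

/-- Two nodes on one diagonal are comparable in both coordinates, and `not_lt_of_agree` then
identifies them. -/
theorem eq_of_diagonal_eq (hT : IsStandard Λ T) (hS : IsStandard M S) {j : Fin n}
    (hag : ∀ i < j, T i = S i) (hp : (T j).1 = (S j).1)
    (hd : (T j).diagonal = (S j).diagonal) : T j = S j := by
  unfold MNode.diagonal at hd
  rcases le_total (T j).2.1 (S j).2.1 with h | h
  · exact hT.not_lt_of_agree hS hag hp h (by omega)
  · exact (hS.not_lt_of_agree hT (fun i hi => (hag i hi).symm) hp.symm h (by omega)).symm

/-- Nodes on adjacent diagonals that share neither row nor column are comparable in both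
coordinates, hence equal by `not_lt_of_agree`, which is absurd. -/
theorem inLine_of_diagonal_succ (hT : IsStandard Λ T) (hS : IsStandard M S) {j : Fin n}
    (hag : ∀ i < j, T i = S i) (hp : (T j).1 = (S j).1)
    (hd : (T j).diagonal = (S j).diagonal + 1) : MNode.InLine (T j) (S j) := by
  have hag' : ∀ i < j, S i = T i := fun i hi => (hag i hi).symm
  unfold MNode.diagonal at hd
  refine ⟨hp, ?_⟩
  by_contra! hne
  rcases le_total (T j).2.1 (S j).2.1 with h | h
  · have := hT.not_lt_of_agree hS hag hp h (by omega)
    exact hne.1 (by rw [this])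
  · have := hS.not_lt_of_agree hT hag' hp.symm h (by omega)
    exact hne.1 (by rw [this])

/-- Exchanging consecutive numbers reverses the order of this single pair, which no row or column
condition compares. -/
theorem swap (hT : IsStandard Λ T) {i : ℕ} (hi : i + 1 < n)
    (h : ¬ MNode.InLine (T ⟨i, by omega⟩) (T ⟨i + 1, hi⟩)) :
    IsStandard Λ (T ∘ Equiv.swap ⟨i, by omega⟩ ⟨i + 1, hi⟩) := by
  have key : ∀ a b : Fin n, MNode.InLine (T (Equiv.swap ⟨i, by omega⟩ ⟨i + 1, hi⟩ a))
      (T (Equiv.swap ⟨i, by omega⟩ ⟨i + 1, hi⟩ b)) →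
      Equiv.swap ⟨i, by omega⟩ ⟨i + 1, hi⟩ a < Equiv.swap ⟨i, by omega⟩ ⟨i + 1, hi⟩ b → a < b := by
    intro a b hl hlt
    rw [Equiv.swap_apply_def, Equiv.swap_apply_def] at hlt hl
    split_ifs at hlt hl <;> simp only [Fin.lt_def, Fin.ext_iff] at * <;>
      first
      | omega
      | exact absurd hl h
  refine ⟨hT.bij.comp ((Equiv.swap _ _).bijective.bijOn_univ), ?_, ?_⟩
  · exact fun a b h1 h2 h3 => key a b ⟨h1, .inl h2⟩ (hT.row _ _ h1 h2 h3)
  · exact fun a b h1 h2 h3 => key a b ⟨h1, .inr h2⟩ (hT.col _ _ h1 h2 h3)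

/-- A node strictly between the two in their line would carry a number strictly between `i` and `i +
1`. -/
theorem row_succ_of_inLine (hT : IsStandard Λ T) {i : ℕ} (hi : i + 1 < n)
    (h : MNode.InLine (T ⟨i, by omega⟩) (T ⟨i + 1, hi⟩)) :
    ((T ⟨i, by omega⟩).2.1 = (T ⟨i + 1, hi⟩).2.1 ∧
        (T ⟨i + 1, hi⟩).2.2 = (T ⟨i, by omega⟩).2.2 + 1) ∨
      ((T ⟨i, by omega⟩).2.2 = (T ⟨i + 1, hi⟩).2.2 ∧
        (T ⟨i + 1, hi⟩).2.1 = (T ⟨i, by omega⟩).2.1 + 1) := by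
  set x := T ⟨i, by omega⟩ with hx
  set y := T ⟨i + 1, hi⟩ with hy
  have hne : x ≠ y := fun h => by
    have := hT.injective h
    simp [Fin.ext_iff] at this
  obtain ⟨hp, h | h⟩ := h
  · left
    refine ⟨h, ?_⟩
    have h1 : x.2.2 < y.2.2 := by
      by_contra hlt
      have := hT.lt_of_le (i := ⟨i + 1, hi⟩) (j := ⟨i, by omega⟩) hp.symm h.symm.le
        (not_lt.1 hlt) hne.symm
      simp [Fin.lt_def] at this
    by_contra hs
    obtain ⟨k, hk, hk'⟩ := hT.exists_pred ⟨i + 1, hi⟩ (r := y.2.1) (s := x.2.2 + 1) le_rfl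
      h1 (fun h => hs (congrArg Prod.snd h).symm)
    have := hT.lt_of_le (i := ⟨i, by omega⟩) (j := k) (by rw [hk']; exact hp)
      (by rw [hk']; exact h.le) (by rw [hk']; exact Nat.le_succ _)
      (fun h => by
        have := congrArg (fun z => z.2.2) (h.trans hk')
        exact (Nat.lt_succ_self _).ne this)
    simp only [Fin.lt_def] at this hk
    omega
  · right
    refine ⟨h, ?_⟩
    have h1 : x.2.1 < y.2.1 := by
      by_contra hlt
      have := hT.lt_of_le (i := ⟨i + 1, hi⟩) (j := ⟨i, by omega⟩) hp.symm
        (not_lt.1 hlt) h.symm.le hne.symm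
      simp [Fin.lt_def] at this
    by_contra hs
    obtain ⟨k, hk, hk'⟩ := hT.exists_pred ⟨i + 1, hi⟩ (r := x.2.1 + 1) (s := y.2.2)
      h1 le_rfl (fun h => hs (congrArg Prod.fst h).symm)
    have := hT.lt_of_le (i := ⟨i, by omega⟩) (j := k) (by rw [hk']; exact hp)
      (by rw [hk']; exact Nat.le_succ _) (by rw [hk']; exact h.le)
      (fun h => by
        have := congrArg (fun z => z.2.1) (h.trans hk')
        exact (Nat.lt_succ_self _).ne this)
    simp only [Fin.lt_def] at this hk
    omega

theorem zero_eq (hT : IsStandard Λ T) (hn : 0 < n) :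
    T ⟨0, hn⟩ = ((T ⟨0, hn⟩).1, 0, 0) := by
  by_contra hne
  obtain ⟨i, hi, -⟩ := hT.exists_pred ⟨0, hn⟩ (r := 0) (s := 0) (Nat.zero_le _) (Nat.zero_le _)
    (fun h => hne (Prod.ext rfl h.symm))
  simp [Fin.lt_def] at hi

/-- Three consecutive numbers of a standard tableau, each in line with the next one, lie all in one
line or all in one column. -/
theorem same_direction (hT : IsStandard Λ T) {i : ℕ} (hi : i + 2 < n)
    (h1 : MNode.InLine (T ⟨i, by omega⟩) (T ⟨i + 1, by omega⟩))
    (h2 : MNode.InLine (T ⟨i + 1, by omega⟩) (T ⟨i + 2, hi⟩)) :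
    (T ⟨i + 1, by omega⟩).diagonal - (T ⟨i, by omega⟩).diagonal =
      (T ⟨i + 2, hi⟩).diagonal - (T ⟨i + 1, by omega⟩).diagonal := by
  have e1 := hT.row_succ_of_inLine (by omega) h1
  have e2 := hT.row_succ_of_inLine (by omega) h2
  unfold MNode.diagonal
  set x := T ⟨i, by omega⟩ with hx
  set y := T ⟨i + 1, by omega⟩ with hy
  set z := T ⟨i + 2, hi⟩ with hz
  by_contra hne
  -- the fourth corner of the square lies strictly between `x` and `z`
  have corner : ∀ r s : ℕ, r ≤ z.2.1 → s ≤ z.2.2 → x.2.1 ≤ r → x.2.2 ≤ s → (r, s) ≠ z.2 →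
      (r, s) ≠ y.2 → (r, s) ≠ x.2 → False := by
    intro r s hr hs hr' hs' hn1 hn2 hn3
    obtain ⟨k, hk, hk'⟩ := hT.exists_pred ⟨i + 2, hi⟩ hr hs hn1
    have hxk := hT.lt_of_le (i := ⟨i, by omega⟩) (j := k)
      (by rw [hk']; exact h1.1.trans h2.1) (by rw [hk']; exact hr') (by rw [hk']; exact hs')
      (fun h => hn3 (congrArg Prod.snd (h.trans hk')).symm)
    have hky : k ≠ ⟨i + 1, by omega⟩ := by
      intro h
      rw [h] at hk'
      exact hn2 (congrArg Prod.snd hk').symm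
    simp only [Fin.lt_def, ne_eq, Fin.ext_iff] at hk hxk hky
    omega
  rcases e1 with ⟨a1, a2⟩ | ⟨a1, a2⟩ <;> rcases e2 with ⟨b1, b2⟩ | ⟨b1, b2⟩
  · omega
  · refine corner z.2.1 x.2.2 le_rfl (by omega) (by omega) le_rfl ?_ ?_ ?_ <;>
      simp only [ne_eq, Prod.ext_iff] <;> omega
  · refine corner x.2.1 z.2.2 (by omega) le_rfl le_rfl (by omega) ?_ ?_ ?_ <;>
      simp only [ne_eq, Prod.ext_iff] <;> omega
  · omega

theorem shape_unique (hT : IsStandard Λ T) (hT' : IsStandard M T) : Λ = M := by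
  have key : ∀ p x, x ∈ Λ.diag p ↔ x ∈ M.diag p := by
    have : ∀ {Λ M : MPartition m n}, IsStandard Λ T → IsStandard M T →
        ∀ p x, x ∈ Λ.diag p → x ∈ M.diag p := by
      intro Λ M hT hT' p x hx
      obtain ⟨i, hi⟩ := hT.exists_eq (α := (p, x)) hx
      simpa [hi] using hT'.mem i
    exact fun p x => ⟨this hT hT' p x, this hT' hT p x⟩
  obtain ⟨d, hd⟩ := Λ
  obtain ⟨e, he⟩ := M
  congr
  funext p
  ext x
  exact key p x

end IsStandard

end Tableaux

/-! ### Generic parameters and the separation of contents. -/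

section Content

variable {K : Type u} [Field K] {m n : ℕ}

/-- The genericity conditions on the parameters of `H(m,1,n)`. -/
structure Generic (n : ℕ) (q : K) (v : Fin m → K) : Prop where
  q_ne : q ≠ 0
  pow_ne : ∀ d : ℕ, 0 < d → d ≤ n → q ^ (2 * d) ≠ 1
  sep : ∀ (i : ℤ) (j k : Fin m), j ≠ k → |i| < n → q ^ (2 * i) * v j ≠ v k
  v_ne : ∀ j, v j ≠ 0

theorem Generic.mono {n k : ℕ} {q : K} {v : Fin m → K} (h : Generic n q v) (hk : k ≤ n) :
    Generic k q v :=
  ⟨h.q_ne, fun d h0 h1 => h.pow_ne d h0 (h1.trans hk),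
    fun i j l hj hi => h.sep i j l hj (hi.trans_le (by exact_mod_cast hk)), h.v_ne⟩

variable {q : K} {v : Fin m → K} (G : Generic n q v)
include G

theorem Generic.content_ne_zero (α : MNode m) : content q v α ≠ 0 :=
  mul_ne_zero (G.v_ne _) (zpow_ne_zero _ G.q_ne)

theorem Generic.zpow_ne_one {d : ℤ} (h0 : d ≠ 0) (h1 : |d| ≤ n) : q ^ (2 * d) ≠ 1 := by
  obtain ⟨e, rfl | rfl⟩ := d.eq_nat_or_neg
  · have := G.pow_ne e (by omega) (by simpa using h1)
    exact_mod_cast this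
  · have := G.pow_ne e (by omega) (by simpa using h1)
    rw [mul_neg, zpow_neg, ne_eq, inv_eq_one]
    exact_mod_cast this

variable {Λ M : MPartition m n} {T S : Fin n → MNode m}

/-- Separation of contents: for two standard tableaux that agree below `j`, the content of `j`
determines its component and its diagonal. -/
theorem Generic.content_sep (hT : IsStandard Λ T) (hS : IsStandard M S) (j : Fin n)
    (hag : ∀ i < j, T i = S i) (e : ℤ) (he : (j : ℤ) + |e| < n)
    (h : content q v (T j) = q ^ (2 * e) * content q v (S j)) :
    (T j).1 = (S j).1 ∧ (T j).diagonal = (S j).diagonal + e := by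
  have hag' : ∀ i < j, S i = T i := fun i hi => (hag i hi).symm
  have he1 := le_abs_self e
  have he2 := neg_le_abs e
  have h' : q ^ (2 * ((T j).diagonal - (S j).diagonal - e)) * v (T j).1 = v (S j).1 := by
    have e1 : (2 * ((T j).diagonal - (S j).diagonal - e)) =
      2 * (T j).diagonal - (2 * e + 2 * (S j).diagonal) := by ring
    rw [e1, zpow_sub₀ G.q_ne, zpow_add₀ G.q_ne, div_mul_eq_mul_div, div_eq_iff
      (mul_ne_zero (zpow_ne_zero _ G.q_ne) (zpow_ne_zero _ G.q_ne))]
    unfold content at h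
    unfold MNode.diagonal
    linear_combination h
  by_cases hp : (T j).1 = (S j).1
  · refine ⟨hp, ?_⟩
    rw [hp, mul_eq_right₀ (G.v_ne _)] at h'
    by_contra hd
    refine G.zpow_ne_one ?_ ?_ h'
    · omega
    · have h1 := hT.col_add_row_le hS j hag hp
      have h2 := hS.col_add_row_le hT j hag' hp.symm
      unfold MNode.diagonal
      rw [abs_le]
      constructor <;> omega
  · exfalso
    refine G.sep _ _ _ hp ?_ h'
    -- In different components rows and columns are bounded by the numbers of earlier entries in two
    -- disjoint sets, so the exponent is at most j + |e| < n in absolute value.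
    have h1 := hT.col_le_card j
    have h2 := hT.row_le_card j
    have h3 := hS.col_le_card j
    have h4 := hS.row_le_card j
    set a := (Finset.univ.filter fun i => i < j ∧ (T i).1 = (T j).1).card with ha
    set b := (Finset.univ.filter fun i => i < j ∧ (S i).1 = (S j).1).card with hb
    have hab : a + b ≤ j := by
      rw [ha, hb, ← Finset.card_union_of_disjoint]
      · refine (Finset.card_le_card (t := Finset.Iio j) ?_).trans (by simp)
        intro i hi
        simp only [Finset.mem_union, Finset.mem_filter, Finset.mem_univ, true_and] at hi
        rw [Finset.mem_Iio]
        exact hi.elim And.left And.left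
      · rw [Finset.disjoint_filter]
        rintro i - ⟨hi, hi1⟩ ⟨-, hi2⟩
        exact hp (hi1.symm.trans ((congrArg Prod.fst (hag i hi)).trans hi2))
    unfold MNode.diagonal
    rw [abs_lt]
    constructor <;> omega

theorem Generic.eq_of_content_eq (hT : IsStandard Λ T) (hS : IsStandard M S) (j : Fin n)
    (hag : ∀ i < j, T i = S i) (h : content q v (T j) = content q v (S j)) : T j = S j := by
  obtain ⟨h1, h2⟩ := G.content_sep hT hS j hag 0 (by simp) (by simpa using h)
  exact hT.eq_of_diagonal_eq hS hag h1 (by simpa using h2)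

/-- A standard tableau is determined by its sequence of contents. -/
theorem Generic.eq_of_contents_eq (hT : IsStandard Λ T) (hS : IsStandard M S)
    (h : ∀ i, content q v (T i) = content q v (S i)) : T = S := by
  funext j
  induction j using WellFoundedLT.induction with
  | _ j ih => exact G.eq_of_content_eq hT hS j ih (h j)

omit G in
theorem swap_agree {i : ℕ} (hi : i + 1 < n) (j : Fin n) (hj : j < ⟨i, by omega⟩) :
    T j = (T ∘ Equiv.swap (⟨i, by omega⟩ : Fin n) ⟨i + 1, hi⟩) j := by
  rw [Function.comp_apply, Equiv.swap_apply_of_ne_of_ne] <;>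
    simp only [ne_eq, Fin.ext_iff, Fin.lt_def] at * <;> omega

omit G in
theorem content_of_row_succ {α β : MNode m} (hq : q ≠ 0) (hp : α.1 = β.1) {d : ℤ}
    (hd : β.diagonal = α.diagonal + d) : content q v β = q ^ (2 * d) * content q v α := by
  unfold MNode.diagonal at hd
  unfold content
  rw [hd, hp, mul_add, zpow_add₀ hq]
  ring

/-- For consecutive numbers in line, the contents differ by `q^{±2}`. -/
theorem Generic.content_of_inLine (hT : IsStandard Λ T) {i : ℕ} (hi : i + 1 < n)
    (h : MNode.InLine (T ⟨i, by omega⟩) (T ⟨i + 1, hi⟩)) :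
    content q v (T ⟨i + 1, hi⟩) = q ^ 2 * content q v (T ⟨i, by omega⟩) ∨
      content q v (T ⟨i, by omega⟩) = q ^ 2 * content q v (T ⟨i + 1, hi⟩) := by
  rcases hT.row_succ_of_inLine hi h with ⟨h1, h2⟩ | ⟨h1, h2⟩
  · left
    refine (content_of_row_succ G.q_ne h.1 (d := 1) ?_).trans (by norm_cast)
    unfold MNode.diagonal
    omega
  · right
    refine (content_of_row_succ G.q_ne h.1.symm (d := 1) ?_).trans (by norm_cast)
    unfold MNode.diagonal
    omega

/-- In line, the ratio of the contents is q^{±2} ≠ 1. Otherwise the exchanged tableau is standard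
and agrees with `T` below `i`, so that the two nodes compete for the same position and separation
applies. -/
theorem Generic.content_ne (hT : IsStandard Λ T) {i : ℕ} (hi : i + 1 < n) :
    content q v (T ⟨i, by omega⟩) ≠ content q v (T ⟨i + 1, hi⟩) := by
  intro h
  by_cases hl : MNode.InLine (T ⟨i, by omega⟩) (T ⟨i + 1, hi⟩)
  · have hq2 : q ^ 2 ≠ 1 := G.pow_ne 1 one_pos (by omega)
    rcases G.content_of_inLine hT hi hl with h' | h'
    · rw [← h, eq_comm, mul_eq_right₀ (G.content_ne_zero _)] at h'
      exact hq2 h'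
    · rw [← h, eq_comm, mul_eq_right₀ (G.content_ne_zero _)] at h'
      exact hq2 h'
  · have := G.eq_of_content_eq hT (hT.swap hi hl) ⟨i, by omega⟩ (swap_agree hi) (by simpa using h)
    have := hT.injective this
    simp [Fin.ext_iff] at this

/-- Comparison with the exchanged tableau again, now with shift e = 1: a ratio q² would force
adjacent diagonals and thus a common line. This is what keeps the numerator of the off-diagonal
coefficient nonzero. -/
theorem Generic.content_ne_mul (hT : IsStandard Λ T) {i : ℕ} (hi : i + 1 < n)
    (hl : ¬ MNode.InLine (T ⟨i, by omega⟩) (T ⟨i + 1, hi⟩)) :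
    content q v (T ⟨i, by omega⟩) ≠ q ^ 2 * content q v (T ⟨i + 1, hi⟩) := by
  intro h
  have hS := hT.swap hi hl
  obtain ⟨h1, h2⟩ := G.content_sep hT hS ⟨i, by omega⟩ (swap_agree hi) 1
    (by simp; omega) (by simpa using h)
  exact hl (by simpa using hT.inLine_of_diagonal_succ hS (swap_agree hi) h1 h2)

end Content

/-! ### Rational identities between the seminormal coefficients. -/

section Coefficients

variable {K : Type u} [Field K] {m n : ℕ}

/-- The diagonal coefficient of `σ_i` in the seminormal form. -/
noncomputable def diagCoef (q : K) (v : Fin m → K) (α β : MNode m) : K :=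
  (q - q⁻¹) * content q v β / (content q v β - content q v α)

open Classical in
/-- The off-diagonal coefficient of `σ_i` in the seminormal form, replaced by `0` if the exchanged
tableau is not standard. -/
noncomputable def offCoef (q : K) (v : Fin m → K) (α β : MNode m) : K :=
  if MNode.InLine α β then 0
  else (q * content q v β - q⁻¹ * content q v α) / (content q v β - content q v α)

variable {q : K} {v : Fin m → K}

theorem offCoef_of_inLine {α β : MNode m} (h : MNode.InLine α β) : offCoef q v α β = 0 := if_pos h

theorem offCoef_of_not_inLine {α β : MNode m} (h : ¬ MNode.InLine α β) :
    offCoef q v α β =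
      (q * content q v β - q⁻¹ * content q v α) / (content q v β - content q v α) := if_neg h

/-- Out of line this is an identity of rational functions. In line the contents differ by q^{±2}, so
one of the two numerators vanishes anyway and the convention 0 does not spoil the identity. -/
theorem offCoef_mul_offCoef {α β : MNode m} (hq : q ≠ 0) (hne : content q v α ≠ content q v β)
    (h : MNode.InLine α β → content q v β = q ^ 2 * content q v α ∨
      content q v α = q ^ 2 * content q v β) :
    offCoef q v α β * offCoef q v β α =
      1 + (q - q⁻¹) * diagCoef q v α β - diagCoef q v α β ^ 2 := by
  have h1 : content q v β - content q v α ≠ 0 := sub_ne_zero.2 hne.symm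
  have h2 : content q v α - content q v β ≠ 0 := sub_ne_zero.2 hne
  have key : (q * content q v β - q⁻¹ * content q v α) / (content q v β - content q v α) *
      ((q * content q v α - q⁻¹ * content q v β) / (content q v α - content q v β)) =
      1 + (q - q⁻¹) * diagCoef q v α β - diagCoef q v α β ^ 2 := by
    unfold diagCoef
    rw [← neg_sub (content q v β), div_neg]
    field_simp
    ring
  by_cases hl : MNode.InLine α β
  · rw [offCoef_of_inLine hl, zero_mul, ← key]
    rcases h hl with h | h
    · have : q * content q v α - q⁻¹ * content q v β = 0 := by rw [h]; field_simp; ring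
      rw [this, zero_div, mul_zero]
    · have : q * content q v β - q⁻¹ * content q v α = 0 := by rw [h]; field_simp; ring
      rw [this, zero_div, zero_mul]
  · rw [offCoef_of_not_inLine hl, offCoef_of_not_inLine (fun h => hl h.symm), key]

theorem diagCoef_add {α β : MNode m} (hne : content q v α ≠ content q v β) :
    diagCoef q v α β + diagCoef q v β α = q - q⁻¹ := by
  have h1 : content q v β - content q v α ≠ 0 := sub_ne_zero.2 hne.symm
  unfold diagCoef
  rw [← neg_sub (content q v β) (content q v α), div_neg]
  field_simp
  ring

theorem diagCoef_mul_content {α β : MNode m} :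
    diagCoef q v α β * content q v α + diagCoef q v β α * content q v β = 0 := by
  unfold diagCoef
  rw [← neg_sub (content q v β) (content q v α), div_neg]
  ring

/-- The bracket stands for the product of the two off-diagonal coefficients, so this is the diagonal
entry of σ_i J_i σ_i at a tableau. -/
theorem diagCoef_content {α β : MNode m} (hne : content q v α ≠ content q v β) :
    diagCoef q v α β ^ 2 * content q v α +
      (1 + (q - q⁻¹) * diagCoef q v α β - diagCoef q v α β ^ 2) * content q v β =
        content q v β := by
  have h1 : content q v β - content q v α ≠ 0 := sub_ne_zero.2 hne.symm
  unfold diagCoef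
  field_simp
  ring

/-- Needed for the coefficients of the once-exchanged tableaux in the braid relation. -/
theorem diagCoef_three {α β γ : MNode m} (h1 : content q v α ≠ content q v β)
    (h2 : content q v β ≠ content q v γ) (h3 : content q v α ≠ content q v γ) :
    diagCoef q v α β * diagCoef q v β γ + diagCoef q v α γ * diagCoef q v β α =
      diagCoef q v β γ * diagCoef q v α γ := by
  have e1 : content q v β - content q v α ≠ 0 := sub_ne_zero.2 h1.symm
  have e2 : content q v γ - content q v β ≠ 0 := sub_ne_zero.2 h2.symm
  have e3 : content q v γ - content q v α ≠ 0 := sub_ne_zero.2 h3.symm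
  unfold diagCoef
  rw [← neg_sub (content q v β) (content q v α), div_neg]
  field_simp
  ring

/-- Inside one component the factor v_p cancels and only the difference of diagonals is left; three
consecutive entries in one line therefore give equal coefficients. -/
theorem diagCoef_of_diagonal {α β : MNode m} (hq : q ≠ 0) (hv : v α.1 ≠ 0) (hp : α.1 = β.1) :
    diagCoef q v α β = (q - q⁻¹) * q ^ (2 * (β.diagonal - α.diagonal)) /
      (q ^ (2 * (β.diagonal - α.diagonal)) - 1) := by
  have h := content_of_row_succ (v := v) hq hp (d := β.diagonal - α.diagonal) (by ring)
  have hc : content q v α ≠ 0 := mul_ne_zero hv (zpow_ne_zero _ hq)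
  unfold diagCoef
  rw [h, ← mul_assoc, ← sub_one_mul, mul_div_mul_right _ _ hc]

end Coefficients

/-! ### The seminormal operators and their relations. -/

section Operators

variable {K : Type u} [Field K] {m n : ℕ} (q : K) (v : Fin m → K) (Λ : MPartition m n)

/-- The filling that underlies a standard tableau. -/
def StdTableau.fill {Λ : MPartition m n} (T : StdTableau Λ) : Fin n → MNode m := Subtype.val T

theorem StdTableau.isStandard {Λ : MPartition m n} (T : StdTableau Λ) : IsStandard Λ T.fill :=
  Subtype.property T

/-- A standard filling as a standard tableau. -/
def StdTableau.of {Λ : MPartition m n} {T : Fin n → MNode m} (hT : IsStandard Λ T) :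
    StdTableau Λ := Subtype.mk T hT

@[simp]
theorem StdTableau.fill_of {Λ : MPartition m n} {T : Fin n → MNode m} (hT : IsStandard Λ T) :
    (StdTableau.of hT).fill = T := rfl

@[ext]
theorem StdTableau.ext {Λ : MPartition m n} {T S : StdTableau Λ} (h : T.fill = S.fill) : T = S :=
  Subtype.ext h

theorem tabVec_of_isStandard {Λ : MPartition m n} {T : Fin n → MNode m} (hT : IsStandard Λ T) :
    tabVec K Λ T = Finsupp.single (StdTableau.of hT) 1 := dif_pos hT

theorem tabVec_fill {Λ : MPartition m n} (T : StdTableau Λ) :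
    tabVec K Λ T.fill = Finsupp.single T 1 := tabVec_of_isStandard T.isStandard

theorem tableauSpace_hom_ext {Λ : MPartition m n} {V : Type*} [AddCommMonoid V] [Module K V]
    {f g : TableauSpace K Λ →ₗ[K] V}
    (h : ∀ T, IsStandard Λ T → f (tabVec K Λ T) = g (tabVec K Λ T)) : f = g := by
  refine Finsupp.lhom_ext' fun T => LinearMap.ext_ring ?_
  have := h T.fill T.isStandard
  rwa [tabVec_fill] at this

/-- The transposition of `i` and `i+1`. -/
abbrev swapSucc (i : ℕ) (h : i + 1 < n) : Equiv.Perm (Fin n) :=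
  Equiv.swap ⟨i, by omega⟩ ⟨i + 1, h⟩

/-- The action of `σ_i` in the seminormal form. -/
noncomputable def sigmaOp (i : ℕ) (h : i + 1 < n) : Module.End K (TableauSpace K Λ) :=
  Finsupp.linearCombination K fun T : StdTableau Λ =>
    diagCoef q v (T.fill ⟨i, by omega⟩) (T.fill ⟨i + 1, h⟩) • tabVec K Λ T.fill +
      offCoef q v (T.fill ⟨i, by omega⟩) (T.fill ⟨i + 1, h⟩) • tabVec K Λ (T.fill ∘ swapSucc i h)

/-- The diagonal operator with eigenvalue the content of `j`. -/
noncomputable def contentOp (j : Fin n) : Module.End K (TableauSpace K Λ) :=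
  Finsupp.linearCombination K fun T : StdTableau Λ => content q v (T.fill j) • tabVec K Λ T.fill

variable {q v Λ} {T : Fin n → MNode m}

theorem sigmaOp_tabVec (hT : IsStandard Λ T) (i : ℕ) (h : i + 1 < n) :
    sigmaOp q v Λ i h (tabVec K Λ T) =
      diagCoef q v (T ⟨i, by omega⟩) (T ⟨i + 1, h⟩) • tabVec K Λ T +
        offCoef q v (T ⟨i, by omega⟩) (T ⟨i + 1, h⟩) • tabVec K Λ (T ∘ swapSucc i h) := by
  rw [tabVec_of_isStandard hT, sigmaOp, Finsupp.linearCombination_single, one_smul,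
    StdTableau.fill_of, tabVec_of_isStandard hT]

theorem contentOp_tabVec (hT : IsStandard Λ T) (j : Fin n) :
    contentOp q v Λ j (tabVec K Λ T) = content q v (T j) • tabVec K Λ T := by
  rw [tabVec_of_isStandard hT, contentOp, Finsupp.linearCombination_single, one_smul,
    StdTableau.fill_of, tabVec_of_isStandard hT]

theorem contentOp_comm (i j : Fin n) :
    contentOp q v Λ i * contentOp q v Λ j = contentOp q v Λ j * contentOp q v Λ i := by
  refine tableauSpace_hom_ext fun T hT => ?_
  simp [contentOp_tabVec hT, smul_smul, mul_comm]

theorem swapSucc_apply_left (i : ℕ) (h : i + 1 < n) :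
    swapSucc i h ⟨i, by omega⟩ = ⟨i + 1, h⟩ := Equiv.swap_apply_left _ _

theorem swapSucc_apply_right (i : ℕ) (h : i + 1 < n) :
    swapSucc i h ⟨i + 1, h⟩ = ⟨i, by omega⟩ := Equiv.swap_apply_right _ _

theorem swapSucc_apply_of_ne (i : ℕ) (h : i + 1 < n) (j : Fin n) (h1 : (j : ℕ) ≠ i)
    (h2 : (j : ℕ) ≠ i + 1) : swapSucc i h j = j :=
  Equiv.swap_apply_of_ne_of_ne (fun e => h1 (congrArg Fin.val e)) fun e => h2 (congrArg Fin.val e)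

theorem comp_swapSucc_swapSucc (i : ℕ) (h : i + 1 < n) :
    (T ∘ swapSucc i h) ∘ swapSucc i h = T := by
  funext j
  simp

theorem swapSucc_braid (i : ℕ) (h : i + 2 < n) :
    ((T ∘ swapSucc i (by omega)) ∘ swapSucc (i + 1) h) ∘ swapSucc i (by omega) =
      ((T ∘ swapSucc (i + 1) h) ∘ swapSucc i (by omega)) ∘ swapSucc (i + 1) h := by
  have e : swapSucc i (n := n) (by omega) * swapSucc (i + 1) h * swapSucc i (by omega) =
      swapSucc (i + 1) h * swapSucc i (by omega) * swapSucc (i + 1) h := by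
    unfold swapSucc
    set a : Fin n := ⟨i, by omega⟩
    set b : Fin n := ⟨i + 1, by omega⟩
    set c : Fin n := ⟨i + 1 + 1, h⟩
    have hab : a ≠ b := by simp [a, b]
    have hbc : b ≠ c := by simp [b, c]
    have hac : a ≠ c := by simp [a, c]; omega
    have e1 := Equiv.swap_mul_swap_mul_swap hab hac
    have e2 := Equiv.swap_mul_swap_mul_swap hbc.symm hac.symm
    rw [Equiv.swap_comm b a, Equiv.swap_comm c b, Equiv.swap_comm a c] at e2
    exact e2.trans e1.symm
  funext j
  exact congrArg T (congrArg (fun f : Equiv.Perm (Fin n) => f j) e)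

theorem swapSucc_far (i j : ℕ) (hi : i + 1 < n) (hj : j + 1 < n) (hij : i + 1 < j ∨ j + 1 < i) :
    (T ∘ swapSucc i hi) ∘ swapSucc j hj = (T ∘ swapSucc j hj) ∘ swapSucc i hi := by
  have e : Commute (swapSucc i hi) (swapSucc j hj) := by
    refine Equiv.Perm.Disjoint.commute ?_
    intro k
    by_cases h : (k : ℕ) = i ∨ (k : ℕ) = i + 1
    · exact .inr (swapSucc_apply_of_ne _ _ _ (by omega) (by omega))
    · exact .inl (swapSucc_apply_of_ne _ _ _ (by omega) (by omega))
  funext k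
  exact congrArg T (congrArg (fun f : Equiv.Perm (Fin n) => f k) e.eq)

variable (G : Generic n q v)
include G

theorem Generic.offCoef_mul (hT : IsStandard Λ T) (i : ℕ) (h : i + 1 < n) :
    offCoef q v (T ⟨i, by omega⟩) (T ⟨i + 1, h⟩) * offCoef q v (T ⟨i + 1, h⟩) (T ⟨i, by omega⟩) =
      1 + (q - q⁻¹) * diagCoef q v (T ⟨i, by omega⟩) (T ⟨i + 1, h⟩) -
        diagCoef q v (T ⟨i, by omega⟩) (T ⟨i + 1, h⟩) ^ 2 :=
  offCoef_mul_offCoef G.q_ne (G.content_ne hT h) (G.content_of_inLine hT h)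

omit G in
/-- After an exchange with nonzero coefficient, `σ_i` acts on the exchanged tableau. -/
theorem offCoef_smul_sigmaOp (hT : IsStandard Λ T) (i : ℕ) (h : i + 1 < n) :
    offCoef q v (T ⟨i, by omega⟩) (T ⟨i + 1, h⟩) •
        sigmaOp q v Λ i h (tabVec K Λ (T ∘ swapSucc i h)) =
      offCoef q v (T ⟨i, by omega⟩) (T ⟨i + 1, h⟩) •
        (diagCoef q v (T ⟨i + 1, h⟩) (T ⟨i, by omega⟩) • tabVec K Λ (T ∘ swapSucc i h) +
          offCoef q v (T ⟨i + 1, h⟩) (T ⟨i, by omega⟩) • tabVec K Λ T) := by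
  by_cases hl : MNode.InLine (T ⟨i, by omega⟩) (T ⟨i + 1, h⟩)
  · simp [offCoef_of_inLine hl]
  · rw [sigmaOp_tabVec (hT.swap h hl), comp_swapSucc_swapSucc]
    simp only [Function.comp_apply, swapSucc_apply_left, swapSucc_apply_right]

/-- On a tableau and its exchange, σ_i acts by a 2×2 matrix with trace q - q⁻¹ and determinant -1,
so the relation is Cayley-Hamilton; for nodes in line the block degenerates. -/
theorem Generic.sigmaOp_quad (i : ℕ) (h : i + 1 < n) :
    sigmaOp q v Λ i h * sigmaOp q v Λ i h = (q - q⁻¹) • sigmaOp q v Λ i h + 1 := by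
  refine tableauSpace_hom_ext fun T hT => ?_
  have h1 := offCoef_smul_sigmaOp (K := K) (q := q) (v := v) hT i h
  have h2 := G.offCoef_mul hT i h
  have h3 := diagCoef_add (G.content_ne hT h)
  have h0 := sigmaOp_tabVec (q := q) (v := v) hT i h
  rw [Module.End.mul_apply, LinearMap.add_apply, LinearMap.smul_apply, Module.End.one_apply, h0,
    map_add, map_smul, map_smul, h0, h1]
  set a := diagCoef q v (T ⟨i, by omega⟩) (T ⟨i + 1, h⟩)
  set b := offCoef q v (T ⟨i, by omega⟩) (T ⟨i + 1, h⟩)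
  set a' := diagCoef q v (T ⟨i + 1, h⟩) (T ⟨i, by omega⟩)
  set b' := offCoef q v (T ⟨i + 1, h⟩) (T ⟨i, by omega⟩)
  linear_combination (norm := module) h2 • tabVec K Λ T + (b * h3) • tabVec K Λ (T ∘ swapSucc i h)

/-- The recursion of the Jucys-Murphy elements, satisfied by the diagonal operators. It makes every
J_i diagonal and also yields the type B braid relation. -/
theorem Generic.sigmaOp_contentOp_sigmaOp (i : ℕ) (h : i + 1 < n) :
    sigmaOp q v Λ i h * contentOp q v Λ ⟨i, by omega⟩ * sigmaOp q v Λ i h =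
      contentOp q v Λ ⟨i + 1, h⟩ := by
  refine tableauSpace_hom_ext fun T hT => ?_
  have h1 := offCoef_smul_sigmaOp (K := K) (q := q) (v := v) hT i h
  have h2 := G.offCoef_mul hT i h
  have h3 := diagCoef_mul_content (q := q) (v := v) (α := T ⟨i, by omega⟩) (β := T ⟨i + 1, h⟩)
  have h4 := diagCoef_content (G.content_ne hT h)
  have h0 := sigmaOp_tabVec (q := q) (v := v) hT i h
  have h5 : offCoef q v (T ⟨i, by omega⟩) (T ⟨i + 1, h⟩) •
        contentOp q v Λ ⟨i, by omega⟩ (tabVec K Λ (T ∘ swapSucc i h)) =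
      offCoef q v (T ⟨i, by omega⟩) (T ⟨i + 1, h⟩) • content q v (T ⟨i + 1, h⟩) •
        tabVec K Λ (T ∘ swapSucc i h) := by
    by_cases hl : MNode.InLine (T ⟨i, by omega⟩) (T ⟨i + 1, h⟩)
    · simp [offCoef_of_inLine hl]
    · rw [contentOp_tabVec (hT.swap h hl)]
      simp only [Function.comp_apply, swapSucc_apply_left]
  rw [Module.End.mul_apply, Module.End.mul_apply, h0, map_add, map_smul, map_smul,
    contentOp_tabVec hT, h5, map_add, map_smul, map_smul, map_smul, map_smul, h0,
    smul_comm (offCoef _ _ _ _) (content _ _ _), h1, contentOp_tabVec hT]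
  set a := diagCoef q v (T ⟨i, by omega⟩) (T ⟨i + 1, h⟩)
  set b := offCoef q v (T ⟨i, by omega⟩) (T ⟨i + 1, h⟩)
  set a' := diagCoef q v (T ⟨i + 1, h⟩) (T ⟨i, by omega⟩)
  set b' := offCoef q v (T ⟨i + 1, h⟩) (T ⟨i, by omega⟩)
  set x := content q v (T ⟨i, by omega⟩)
  set y := content q v (T ⟨i + 1, h⟩)
  linear_combination (norm := module) (h4 + y * h2) • tabVec K Λ T +
    (b * h3) • tabVec K Λ (T ∘ swapSucc i h)

omit G in
theorem contentOp_comm_sigmaOp (j : Fin n) (i : ℕ) (h : i + 1 < n) (h1 : (j : ℕ) ≠ i)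
    (h2 : (j : ℕ) ≠ i + 1) :
    contentOp q v Λ j * sigmaOp q v Λ i h = sigmaOp q v Λ i h * contentOp q v Λ j := by
  refine tableauSpace_hom_ext fun T hT => ?_
  rw [Module.End.mul_apply, Module.End.mul_apply, contentOp_tabVec hT, map_smul,
    sigmaOp_tabVec hT, map_add, map_smul, map_smul, contentOp_tabVec hT]
  by_cases hl : MNode.InLine (T ⟨i, by omega⟩) (T ⟨i + 1, h⟩)
  · rw [offCoef_of_inLine hl]
    module
  · rw [contentOp_tabVec (hT.swap h hl), Function.comp_apply, swapSucc_apply_of_ne i h j h1 h2]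
    module

omit G in
theorem sigmaOp_far (i j : ℕ) (hi : i + 1 < n) (hj : j + 1 < n) (hij : i + 1 < j ∨ j + 1 < i) :
    sigmaOp q v Λ i hi * sigmaOp q v Λ j hj = sigmaOp q v Λ j hj * sigmaOp q v Λ i hi := by
  have key : ∀ (i j : ℕ) (hi : i + 1 < n) (hj : j + 1 < n) (T : Fin n → MNode m),
      (i + 1 < j ∨ j + 1 < i) → IsStandard Λ T →
      sigmaOp q v Λ i hi (sigmaOp q v Λ j hj (tabVec K Λ T)) =
        diagCoef q v (T ⟨j, by omega⟩) (T ⟨j + 1, hj⟩) •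
          (diagCoef q v (T ⟨i, by omega⟩) (T ⟨i + 1, hi⟩) • tabVec K Λ T +
            offCoef q v (T ⟨i, by omega⟩) (T ⟨i + 1, hi⟩) • tabVec K Λ (T ∘ swapSucc i hi)) +
        offCoef q v (T ⟨j, by omega⟩) (T ⟨j + 1, hj⟩) •
          (diagCoef q v (T ⟨i, by omega⟩) (T ⟨i + 1, hi⟩) • tabVec K Λ (T ∘ swapSucc j hj) +
            offCoef q v (T ⟨i, by omega⟩) (T ⟨i + 1, hi⟩) •
              tabVec K Λ ((T ∘ swapSucc j hj) ∘ swapSucc i hi)) := by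
    intro i j hi hj T hij hT
    rw [sigmaOp_tabVec hT, map_add, map_smul, map_smul, sigmaOp_tabVec hT]
    congr 1
    by_cases hl : MNode.InLine (T ⟨j, by omega⟩) (T ⟨j + 1, hj⟩)
    · simp [offCoef_of_inLine hl]
    · rw [sigmaOp_tabVec (hT.swap hj hl)]
      simp only [Function.comp_apply]
      rw [swapSucc_apply_of_ne _ _ _ (by simp; omega) (by simp; omega),
        swapSucc_apply_of_ne _ _ _ (by simp; omega) (by simp; omega)]
  refine tableauSpace_hom_ext fun T hT => ?_
  rw [Module.End.mul_apply, Module.End.mul_apply, key i j hi hj T hij hT,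
    key j i hj hi T hij.symm hT, swapSucc_far i j hi hj hij]
  module

omit G in
/-- The braid relation for two operators that act on six vectors as in the seminormal form. -/
theorem braid_of_sixVectors {V : Type*} [AddCommGroup V] [Module K V] {A B : V →ₗ[K] V}
    {u0 u1 u2 u12 u21 u121 : V} {axy ayx axz ayz azy bxy byx bxz byz bzy : K}
    (h0A : A u0 = axy • u0 + bxy • u1) (h0B : B u0 = ayz • u0 + byz • u2)
    (h1A : bxy • A u1 = bxy • (ayx • u1 + byx • u0))
    (h1B : bxy • B u1 = bxy • (axz • u1 + bxz • u12))
    (h2B : byz • B u2 = byz • (azy • u2 + bzy • u0))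
    (h2A : byz • A u2 = byz • (axz • u2 + bxz • u21))
    (h12A : (bxy * bxz) • A u12 = (bxy * bxz) • (ayz • u12 + byz • u121))
    (h21B : (byz * bxz) • B u21 = (byz * bxz) • (axy • u21 + bxy • u121))
    (e0 : axy ^ 2 * ayz + bxy * byx * axz = ayz ^ 2 * axy + byz * bzy * axz)
    (e1 : bxy * (axy * ayz + axz * ayx) = bxy * (ayz * axz))
    (e2 : byz * (axy * axz) = byz * (ayz * axy + axz * azy)) :
    A (B (A u0)) = B (A (B u0)) := by
  -- Actions on exchanged vectors are known only after multiplication by the coefficient with which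
  -- the vector occurs. For an exchange that is not standard this coefficient is 0, so no case
  -- distinction is needed here.
  have hBA : B (A u0) = (axy * ayz) • u0 + (axy * byz) • u2 + (bxy * axz) • u1 +
      (bxy * bxz) • u12 := by
    rw [h0A, map_add, map_smul, map_smul, h0B, h1B]
    module
  have hAB : A (B u0) = (ayz * axy) • u0 + (ayz * bxy) • u1 + (byz * axz) • u2 +
      (byz * bxz) • u21 := by
    rw [h0B, map_add, map_smul, map_smul, h0A, h2A]
    module
  rw [hBA, hAB]
  simp only [map_add, map_smul, h0A, h0B, h12A, h21B]
  linear_combination (norm := module) axy • h2A + axz • h1A - ayz • h1B - axz • h2B + e0 • u0 +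
    e1 • u1 + e2 • u2

theorem Generic.sigmaOp_braid (i : ℕ) (h : i + 2 < n) :
    sigmaOp q v Λ i (by omega) * sigmaOp q v Λ (i + 1) h * sigmaOp q v Λ i (by omega) =
      sigmaOp q v Λ (i + 1) h * sigmaOp q v Λ i (by omega) * sigmaOp q v Λ (i + 1) h := by
  refine tableauSpace_hom_ext fun T hT => ?_
  set x := T ⟨i, by omega⟩ with hx
  set y := T ⟨i + 1, by omega⟩ with hy
  set z := T ⟨i + 2, h⟩ with hz
  have hi : i + 1 < n := by omega
  have eS0 : (T ∘ swapSucc i hi) ⟨i, by omega⟩ = y := by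
    rw [Function.comp_apply, swapSucc_apply_left]
  have eS1 : (T ∘ swapSucc i hi) ⟨i + 1, by omega⟩ = x := by
    rw [Function.comp_apply, swapSucc_apply_right]
  have eS2 : (T ∘ swapSucc i hi) ⟨i + 1 + 1, h⟩ = z := by
    rw [Function.comp_apply, swapSucc_apply_of_ne _ _ _ (by simp; omega) (by simp)]
  have eR0 : (T ∘ swapSucc (i + 1) h) ⟨i, by omega⟩ = x := by
    rw [Function.comp_apply, swapSucc_apply_of_ne _ _ _ (by simp) (by simp; omega)]
  have eR1 : (T ∘ swapSucc (i + 1) h) ⟨i + 1, by omega⟩ = z := by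
    rw [Function.comp_apply, swapSucc_apply_left]
  have eR2 : (T ∘ swapSucc (i + 1) h) ⟨i + 1 + 1, h⟩ = y := by
    rw [Function.comp_apply, swapSucc_apply_right]
  have eSR0 : ((T ∘ swapSucc i hi) ∘ swapSucc (i + 1) h) ⟨i, by omega⟩ = y := by
    rw [Function.comp_apply, swapSucc_apply_of_ne _ _ _ (by simp) (by simp; omega), eS0]
  have eSR1 : ((T ∘ swapSucc i hi) ∘ swapSucc (i + 1) h) ⟨i + 1, by omega⟩ = z := by
    rw [Function.comp_apply, swapSucc_apply_left, eS2]
  have eRS1 : ((T ∘ swapSucc (i + 1) h) ∘ swapSucc i hi) ⟨i + 1, by omega⟩ = x := by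
    rw [Function.comp_apply, swapSucc_apply_right, eR0]
  have eRS2 : ((T ∘ swapSucc (i + 1) h) ∘ swapSucc i hi) ⟨i + 1 + 1, h⟩ = y := by
    rw [Function.comp_apply, swapSucc_apply_of_ne _ _ _ (by simp; omega) (by simp), eR2]
  have hxy : content q v x ≠ content q v y := G.content_ne hT hi
  have hyz : content q v y ≠ content q v z := G.content_ne hT h
  -- If one pair is out of line, exchanging it makes `x` and `z` consecutive in a standard tableau,
  -- so their contents differ.
  have hxz : ¬ MNode.InLine x y ∨ ¬ MNode.InLine y z → content q v x ≠ content q v z := by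
    rintro (hl | hl)
    · have := G.content_ne (hT.swap hi hl) h
      rwa [eS1, eS2] at this
    · have := G.content_ne (hT.swap h hl) hi
      rwa [eR0, eR1] at this
  have hS : ¬ MNode.InLine x y → IsStandard Λ (T ∘ swapSucc i hi) := hT.swap hi
  have hR : ¬ MNode.InLine y z → IsStandard Λ (T ∘ swapSucc (i + 1) h) := hT.swap h
  have bxy := G.offCoef_mul hT i hi
  have byz := G.offCoef_mul hT (i + 1) h
  change sigmaOp q v Λ i hi (sigmaOp q v Λ (i + 1) h (sigmaOp q v Λ i hi (tabVec K Λ T))) =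
    sigmaOp q v Λ (i + 1) h (sigmaOp q v Λ i hi (sigmaOp q v Λ (i + 1) h (tabVec K Λ T)))
  refine braid_of_sixVectors (u1 := tabVec K Λ (T ∘ swapSucc i hi))
    (u2 := tabVec K Λ (T ∘ swapSucc (i + 1) h))
    (u12 := tabVec K Λ ((T ∘ swapSucc i hi) ∘ swapSucc (i + 1) h))
    (u21 := tabVec K Λ ((T ∘ swapSucc (i + 1) h) ∘ swapSucc i hi))
    (u121 := tabVec K Λ (((T ∘ swapSucc i hi) ∘ swapSucc (i + 1) h) ∘ swapSucc i hi))
    (axy := diagCoef q v x y) (ayx := diagCoef q v y x) (axz := diagCoef q v x z)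
    (ayz := diagCoef q v y z) (azy := diagCoef q v z y) (bxy := offCoef q v x y)
    (byx := offCoef q v y x) (bxz := offCoef q v x z) (byz := offCoef q v y z)
    (bzy := offCoef q v z y) ?_ ?_ ?_ ?_ ?_ ?_ ?_ ?_ ?_ ?_ ?_
  · exact sigmaOp_tabVec hT i hi
  · exact sigmaOp_tabVec hT (i + 1) h
  · exact offCoef_smul_sigmaOp hT i hi
  · by_cases hl : MNode.InLine x y
    · simp [offCoef_of_inLine hl]
    · rw [sigmaOp_tabVec (hS hl), eS1, eS2]
  · exact offCoef_smul_sigmaOp hT (i + 1) h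
  · by_cases hl : MNode.InLine y z
    · simp [offCoef_of_inLine hl]
    · rw [sigmaOp_tabVec (hR hl), eR0, eR1]
  · by_cases hl : MNode.InLine x y
    · simp [offCoef_of_inLine hl]
    by_cases hl' : MNode.InLine x z
    · simp [offCoef_of_inLine hl']
    · rw [sigmaOp_tabVec ((hS hl).swap h (by rwa [eS1, eS2])), eSR0, eSR1]
  · by_cases hl : MNode.InLine y z
    · simp [offCoef_of_inLine hl]
    by_cases hl' : MNode.InLine x z
    · simp [offCoef_of_inLine hl']
    · rw [sigmaOp_tabVec ((hR hl).swap hi (by rwa [eR0, eR1])), eRS1, eRS2, swapSucc_braid i h]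
  -- With both pairs in line the three nodes lie in one row or one column, the off-diagonal
  -- coefficients vanish and the two diagonal ones agree; the contents of `x` and `z` need not be
  -- distinct here. Otherwise the denominators can be cleared.
  · by_cases hl : MNode.InLine x y ∧ MNode.InLine y z
    · rw [offCoef_of_inLine hl.1, offCoef_of_inLine hl.2,
        diagCoef_of_diagonal G.q_ne (G.v_ne _) hl.1.1,
        diagCoef_of_diagonal G.q_ne (G.v_ne _) hl.2.1, hT.same_direction h hl.1 hl.2]
      ring
    · have hxz' := hxz (not_and_or.1 hl)
      rw [bxy, byz]
      have e1 : content q v y - content q v x ≠ 0 := sub_ne_zero.2 hxy.symm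
      have e2 : content q v z - content q v y ≠ 0 := sub_ne_zero.2 hyz.symm
      have e3 : content q v z - content q v x ≠ 0 := sub_ne_zero.2 hxz'.symm
      change diagCoef q v x y ^ 2 * diagCoef q v y z +
          (1 + (q - q⁻¹) * diagCoef q v x y - diagCoef q v x y ^ 2) * diagCoef q v x z =
        diagCoef q v y z ^ 2 * diagCoef q v x y +
          (1 + (q - q⁻¹) * diagCoef q v y z - diagCoef q v y z ^ 2) * diagCoef q v x z
      unfold diagCoef
      generalize q - q⁻¹ = c
      field_simp
      ring
  · by_cases hl : MNode.InLine x y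
    · rw [offCoef_of_inLine hl]; ring
    · rw [diagCoef_three hxy hyz (hxz (.inl hl))]
  · by_cases hl : MNode.InLine y z
    · rw [offCoef_of_inLine hl]; ring
    · have e1 := diagCoef_three hxy hyz (hxz (.inr hl))
      have e2 := diagCoef_add hxy
      have e3 := diagCoef_add hyz
      linear_combination offCoef q v y z * (diagCoef q v x z * (e2 - e3) - e1)

end Operators

/-! ### The representations V_Λ. -/

section Representation

variable {K : Type u} [Field K] {m n : ℕ} {q : K} {v : Fin m → K}

/-- Nodes in line are comparable, and comparability fixes the order of their numbers in any standard
tableau. So the zero built into `offCoef` matches the zero vector in the definition of V_Λ. -/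
theorem IsStandard.not_isStandard_swap {Λ M : MPartition m n} {T : Fin n → MNode m}
    (hT : IsStandard Λ T) {i : ℕ} (h : i + 1 < n)
    (hl : MNode.InLine (T ⟨i, by omega⟩) (T ⟨i + 1, h⟩)) :
    ¬ IsStandard M (T ∘ swapSucc i h) := by
  intro hS
  have key : ∀ a b : Fin n, (T a).1 = (T b).1 → (T a).2.1 ≤ (T b).2.1 → (T a).2.2 ≤ (T b).2.2 →
      T a ≠ T b → a < b ∧ swapSucc i h a < swapSucc i h b := fun a b h1 h2 h3 hne =>
    ⟨hT.lt_of_le h1 h2 h3 hne, hS.lt_of_le (by simpa) (by simpa) (by simpa) (by simpa)⟩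
  have hne : T ⟨i, by omega⟩ ≠ T ⟨i + 1, h⟩ := fun e => by
    simpa [Fin.ext_iff] using hT.injective e
  have k1 := key ⟨i, by omega⟩ ⟨i + 1, h⟩ hl.1
  have k2 := key ⟨i + 1, h⟩ ⟨i, by omega⟩ hl.1.symm
  rw [swapSucc_apply_left, swapSucc_apply_right] at k1 k2
  simp only [Fin.lt_def] at k1 k2
  obtain ⟨-, hl | hl⟩ := hl
  · rcases le_total (T ⟨i, by omega⟩).2.2 (T ⟨i + 1, h⟩).2.2 with h' | h'
    · have := k1 hl.le h' hne; omega
    · have := k2 hl.symm.le h' hne.symm; omega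
  · rcases le_total (T ⟨i, by omega⟩).2.1 (T ⟨i + 1, h⟩).2.1 with h' | h'
    · have := k1 h' hl.le hne; omega
    · have := k2 h' hl.symm.le hne.symm; omega

/-- The operators by which the generators act in the seminormal form. -/
noncomputable def genOp (q : K) (v : Fin m → K) (Λ : MPartition m n) :
    Gen n → Module.End K (TableauSpace K Λ)
  | Gen.tau h => contentOp q v Λ ⟨0, h⟩
  | Gen.sigma i h => sigmaOp q v Λ i h

theorem lift_genOp_freeTau (Λ : MPartition m n) (h : 0 < n) :
    FreeAlgebra.lift K (genOp q v Λ) (freeTau K h) = contentOp q v Λ ⟨0, h⟩ :=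
  FreeAlgebra.lift_ι_apply _ _

theorem lift_genOp_freeSigma (Λ : MPartition m n) (i : ℕ) (h : i + 1 < n) :
    FreeAlgebra.lift K (genOp q v Λ) (freeSigma K i h) = sigmaOp q v Λ i h :=
  FreeAlgebra.lift_ι_apply _ _

/-- The smallest entry sits in the corner of some component p and has content v_p, so one factor
vanishes on each tableau. -/
theorem contentOp_zero_cyclotomic (Λ : MPartition m n) (h : 0 < n) :
    (List.ofFn fun j : Fin m => contentOp q v Λ ⟨0, h⟩ - algebraMap K _ (v j)).prod = 0 := by
  have key : ∀ (l : List (Fin m)) (T : Fin n → MNode m), IsStandard Λ T →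
      (l.map fun j => contentOp q v Λ ⟨0, h⟩ - algebraMap K _ (v j)).prod (tabVec K Λ T) =
        (l.map fun j => content q v (T ⟨0, h⟩) - v j).prod • tabVec K Λ T := by
    intro l T hT
    induction l with
    | nil => simp
    | cons a l ih =>
      rw [List.map_cons, List.prod_cons, Module.End.mul_apply, ih, map_smul, LinearMap.sub_apply,
        contentOp_tabVec hT, Module.algebraMap_end_apply, ← sub_smul, smul_smul, List.map_cons,
        List.prod_cons, mul_comm]
  refine tableauSpace_hom_ext fun T hT => ?_
  rw [List.ofFn_eq_map, key _ T hT]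
  have h0 : content q v (T ⟨0, h⟩) = v (T ⟨0, h⟩).1 := by
    rw [hT.zero_eq h]
    simp [content]
  rw [List.prod_eq_zero, zero_smul, LinearMap.zero_apply]
  exact List.mem_map.2 ⟨(T ⟨0, h⟩).1, List.mem_finRange _, by rw [h0, sub_self]⟩

theorem Generic.lift_genOp_rel (G : Generic n q v) (Λ : MPartition m n)
    {a b : FreeAlgebra K (Gen n)} (h : Rel n q v a b) :
    FreeAlgebra.lift K (genOp q v Λ) a = FreeAlgebra.lift K (genOp q v Λ) b := by
  cases h with
  | braid i h =>
    simp only [map_mul, lift_genOp_freeSigma]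
    exact G.sigmaOp_braid i h
  | far i j hi hj hij =>
    simp only [map_mul, lift_genOp_freeSigma]
    exact sigmaOp_far i j hi hj hij
  | tauBraid h =>
    simp only [map_mul, lift_genOp_freeSigma, lift_genOp_freeTau]
    -- Here σ_1τσ_1 is the content operator of the second entry, and diagonal operators commute.
    have h1 := G.sigmaOp_contentOp_sigmaOp (Λ := Λ) 0 h
    have h2 := contentOp_comm (q := q) (v := v) (Λ := Λ) ⟨0, by omega⟩ ⟨1, h⟩
    calc _ = contentOp q v Λ ⟨0, by omega⟩ * (sigmaOp q v Λ 0 h *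
          contentOp q v Λ ⟨0, by omega⟩ * sigmaOp q v Λ 0 h) := by simp only [mul_assoc]
      _ = contentOp q v Λ ⟨0 + 1, h⟩ * contentOp q v Λ ⟨0, by omega⟩ := by rw [h1]; exact h2
      _ = _ := by rw [← h1]
  | tauFar i hi h =>
    simp only [map_mul, lift_genOp_freeSigma, lift_genOp_freeTau]
    exact contentOp_comm_sigmaOp _ i hi (by simp; omega) (by simp)
  | quad i h =>
    simp only [map_mul, map_add, map_smul, map_one, lift_genOp_freeSigma]
    exact G.sigmaOp_quad i h
  | cyclo h =>
    rw [map_zero, map_list_prod, List.map_ofFn, ← contentOp_zero_cyclotomic (q := q) (v := v) Λ h]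
    simp only [Function.comp_def, map_sub, AlgHom.commutes, lift_genOp_freeTau]

/-- The seminormal representation `V_Λ`. -/
noncomputable def Generic.rep (G : Generic n q v) (Λ : MPartition m n) :
    Hecke n q v →ₐ[K] Module.End K (TableauSpace K Λ) :=
  RingQuot.liftAlgHom K ⟨FreeAlgebra.lift K (genOp q v Λ), fun _ _ h => G.lift_genOp_rel Λ h⟩

variable (G : Generic n q v) (Λ : MPartition m n)
include G

theorem Generic.rep_mk (x : FreeAlgebra K (Gen n)) :
    G.rep Λ (CyclotomicHecke.mk n q v x) = FreeAlgebra.lift K (genOp q v Λ) x :=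
  RingQuot.liftAlgHom_mkAlgHom_apply K _ _ x

theorem Generic.rep_tau (h : 0 < n) : G.rep Λ (tau q v h) = contentOp q v Λ ⟨0, h⟩ := by
  rw [← mk_freeTau, G.rep_mk, lift_genOp_freeTau]

theorem Generic.rep_sigma (i : ℕ) (h : i + 1 < n) :
    G.rep Λ (sigma q v i h) = sigmaOp q v Λ i h := by
  rw [← mk_freeSigma, G.rep_mk, lift_genOp_freeSigma]

theorem Generic.rep_JM (i : ℕ) (h : i < n) : G.rep Λ (JM q v i h) = contentOp q v Λ ⟨i, h⟩ := by
  induction i with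
  | zero => exact G.rep_tau Λ h
  | succ i ih =>
    rw [JM, map_mul, map_mul, ih, G.rep_sigma, G.sigmaOp_contentOp_sigmaOp]

variable {Λ}

omit G in
theorem offCoef_smul_tabVec {T : Fin n → MNode m} (hT : IsStandard Λ T) (i : ℕ) (h : i + 1 < n) :
    offCoef q v (T ⟨i, by omega⟩) (T ⟨i + 1, h⟩) • tabVec K Λ (T ∘ swapSucc i h) =
      ((q * content q v (T ⟨i + 1, h⟩) - q⁻¹ * content q v (T ⟨i, by omega⟩)) /
        (content q v (T ⟨i + 1, h⟩) - content q v (T ⟨i, by omega⟩))) •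
          tabVec K Λ (T ∘ swapSucc i h) := by
  by_cases hl : MNode.InLine (T ⟨i, by omega⟩) (T ⟨i + 1, h⟩)
  · have : tabVec K Λ (T ∘ swapSucc i h) = 0 := dif_neg (hT.not_isStandard_swap h hl)
    rw [this, smul_zero, smul_zero]
  · rw [offCoef_of_not_inLine hl]

theorem Generic.isSeminormal_rep : IsSeminormal Λ (G.rep Λ) where
  tau h T hT := by rw [G.rep_tau, contentOp_tabVec hT]
  sigma i h T hT := by
    rw [G.rep_sigma, sigmaOp_tabVec hT, offCoef_smul_tabVec hT]
    rfl

theorem Generic.eq_rep {ρ : Hecke n q v →ₐ[K] Module.End K (TableauSpace K Λ)}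
    (hρ : IsSeminormal Λ ρ) : ρ = G.rep Λ := by
  refine Hecke.algHom_ext (fun h => tableauSpace_hom_ext fun T hT => ?_)
    fun i h => tableauSpace_hom_ext fun T hT => ?_
  · rw [hρ.tau h T hT, G.isSeminormal_rep.tau h T hT]
  · rw [hρ.sigma i h T hT, G.isSeminormal_rep.sigma i h T hT]

theorem Generic.existsUnique_rep :
    ∃! ρ : Hecke n q v →ₐ[K] Module.End K (TableauSpace K Λ), IsSeminormal Λ ρ :=
  ⟨G.rep Λ, G.isSeminormal_rep, fun _ h => G.eq_rep h⟩

end Representation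

/-! ### The inequality Σ f_λ² ≥ m^n n!. -/

section Counting

/-! The Young lattice of `m`-partitions, given by their finite sets of `m`-nodes. -/

variable {m : ℕ}

/-- The finite set `D` of `m`-nodes is an `m`-tuple of diagrams. -/
def IsLow (D : Finset (MNode m)) : Prop :=
  ∀ α ∈ D, ∀ r s, r ≤ α.2.1 → s ≤ α.2.2 → (α.1, r, s) ∈ D

theorem IsLow.lt_card {D : Finset (MNode m)} (hD : IsLow D) {α : MNode m} (hα : α ∈ D) :
    α.2.1 < D.card ∧ α.2.2 < D.card := by
  constructor
  · have h : (Finset.range (α.2.1 + 1)).image (fun r => (α.1, r, α.2.2)) ⊆ D := by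
      intro x hx
      obtain ⟨r, hr, rfl⟩ := Finset.mem_image.1 hx
      exact hD α hα r _ (Nat.lt_succ_iff.1 (Finset.mem_range.1 hr)) le_rfl
    have := Finset.card_le_card h
    rw [Finset.card_image_of_injective _ (fun a b h => by simpa using h), Finset.card_range] at this
    omega
  · have h : (Finset.range (α.2.2 + 1)).image (fun s => (α.1, α.2.1, s)) ⊆ D := by
      intro x hx
      obtain ⟨s, hs, rfl⟩ := Finset.mem_image.1 hx
      exact hD α hα _ s le_rfl (Nat.lt_succ_iff.1 (Finset.mem_range.1 hs))
    have := Finset.card_le_card h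
    rw [Finset.card_image_of_injective _ (fun a b h => by simpa using h), Finset.card_range] at this
    omega

open Classical in
/-- The nodes that can be removed from `D`. -/
noncomputable def removableNodes (D : Finset (MNode m)) : Finset (MNode m) :=
  D.filter fun α => IsLow (D.erase α)

open Classical in
/-- The nodes that can be added to `D`, a diagram with `k` nodes. -/
noncomputable def addableNodes (k : ℕ) (D : Finset (MNode m)) : Finset (MNode m) :=
  (Finset.univ ×ˢ Finset.range (k + 1) ×ˢ Finset.range (k + 1)).filter
    fun α => α ∉ D ∧ IsLow (insert α D)

theorem mem_removableNodes {D : Finset (MNode m)} {α : MNode m} :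
    α ∈ removableNodes D ↔ α ∈ D ∧ IsLow (D.erase α) := by
  simp [removableNodes]

theorem mem_addableNodes {k : ℕ} {D : Finset (MNode m)} (hk : D.card = k) {α : MNode m} :
    α ∈ addableNodes k D ↔ α ∉ D ∧ IsLow (insert α D) := by
  classical
  rw [addableNodes, Finset.mem_filter]
  refine and_iff_right_of_imp fun ⟨h1, h2⟩ => ?_
  have := h2.lt_card (Finset.mem_insert_self α D)
  rw [Finset.card_insert_of_notMem h1, hk] at this
  simpa using this

theorem IsLow.exists_not_mem {D : Finset (MNode m)} (hD : IsLow D) (p : Fin m) (r : ℕ) :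
    ∃ s, (p, r, s) ∉ D :=
  ⟨D.card, fun h => (hD.lt_card h).2.false⟩

open Classical in
/-- The length of the row `r` of the component `p`. -/
noncomputable def IsLow.rowLength {D : Finset (MNode m)} (hD : IsLow D) (p : Fin m) (r : ℕ) : ℕ :=
  Nat.find (hD.exists_not_mem p r)

theorem IsLow.mem_iff {D : Finset (MNode m)} (hD : IsLow D) {p : Fin m} {r s : ℕ} :
    (p, r, s) ∈ D ↔ s < hD.rowLength p r := by
  classical
  constructor
  · intro h
    by_contra hs
    exact Nat.find_spec (hD.exists_not_mem p r) (hD _ h r _ le_rfl (not_lt.1 hs))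
  · intro h
    by_contra hs
    exact Nat.find_min (hD.exists_not_mem p r) h hs

theorem IsLow.insert_rowLength {D : Finset (MNode m)} (hD : IsLow D) {p : Fin m} {r : ℕ}
    (hr : ∀ r' < r, (p, r', hD.rowLength p r) ∈ D) :
    (p, r, hD.rowLength p r) ∉ D ∧ IsLow (insert (p, r, hD.rowLength p r) D) := by
  refine ⟨fun h => (hD.mem_iff.1 h).false, ?_⟩
  intro α hα r' s' hr' hs'
  rcases Finset.mem_insert.1 hα with rfl | hα
  · dsimp only at hr' hs' ⊢
    rcases hr'.eq_or_lt with rfl | hr'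
    · rcases hs'.eq_or_lt with rfl | hs'
      · exact Finset.mem_insert_self _ _
      · exact Finset.mem_insert_of_mem (hD.mem_iff.2 hs')
    · exact Finset.mem_insert_of_mem (hD _ (hr r' hr') r' s' le_rfl hs')
  · exact Finset.mem_insert_of_mem (hD α hα r' s' hr' hs')

/-- A removable node in row r leaves row r + 1 shorter than row r, so the end of row r + 1 is
addable. This map is injective, as a row has at most one removable node, and it misses the end of
the top row of each of the m components. -/
theorem card_removableNodes_add_le {D : Finset (MNode m)} (hD : IsLow D) {k : ℕ}
    (hk : D.card = k) : (removableNodes D).card + m ≤ (addableNodes k D).card := by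
  classical
  set g : MNode m → MNode m := fun β => (β.1, β.2.1 + 1, hD.rowLength β.1 (β.2.1 + 1))
  set h : Fin m → MNode m := fun p => (p, 0, hD.rowLength p 0)
  have hsub : (removableNodes D).image g ∪ Finset.univ.image h ⊆ addableNodes k D := by
    refine Finset.union_subset ?_ ?_ <;> intro x hx <;>
      obtain ⟨β, hβ, rfl⟩ := Finset.mem_image.1 hx <;> rw [mem_addableNodes hk]
    · refine hD.insert_rowLength fun r' hr' => ?_
      obtain ⟨h1, h2⟩ := mem_removableNodes.1 hβ
      refine hD β h1 r' _ (Nat.lt_succ_iff.1 hr') ?_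
      by_contra hlt
      have h3 := hD.mem_iff.2 (not_le.1 hlt)
      exact Finset.notMem_erase β D
        (h2 _ (Finset.mem_erase.2 ⟨fun e => by simpa using congrArg (fun z => z.2.1) e, h3⟩)
          β.2.1 β.2.2 (Nat.le_succ _) le_rfl)
    · exact hD.insert_rowLength fun r' hr' => absurd hr' (Nat.not_lt_zero _)
  have hdisj : Disjoint ((removableNodes D).image g) (Finset.univ.image h) := by
    rw [Finset.disjoint_left]
    intro x hx hx'
    obtain ⟨β, -, rfl⟩ := Finset.mem_image.1 hx
    obtain ⟨p, -, e⟩ := Finset.mem_image.1 hx'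
    simpa [g, h] using congrArg (fun z => z.2.1) e
  have hg : Set.InjOn g (removableNodes D : Set (MNode m)) := by
    have key : ∀ β ∈ removableNodes D, ∀ γ ∈ removableNodes D, β.1 = γ.1 → β.2.1 = γ.2.1 →
        γ.2.2 ≤ β.2.2 := by
      intro β hβ γ hγ h1 h2
      obtain ⟨h3, h4⟩ := mem_removableNodes.1 hβ
      by_contra hlt
      refine Finset.notMem_erase β D (?_ : (β.1, β.2.1, β.2.2) ∈ D.erase β)
      rw [h1]
      refine h4 γ (Finset.mem_erase.2 ⟨fun e => hlt (by rw [e]), (mem_removableNodes.1 hγ).1⟩)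
        _ _ h2.le (not_le.1 hlt).le
    intro β hβ γ hγ e
    have h1 : β.1 = γ.1 := (congrArg Prod.fst e :)
    have h2 : β.2.1 = γ.2.1 := Nat.succ_injective (congrArg (fun z => z.2.1) e :)
    exact Prod.ext h1 (Prod.ext h2 (le_antisymm (key γ hγ β hβ h1.symm h2.symm)
      (key β hβ γ hγ h1 h2)))
  have hh : Function.Injective h := fun p p' e => congrArg Prod.fst e
  have := Finset.card_le_card hsub
  rwa [Finset.card_union_of_disjoint hdisj, Finset.card_image_of_injOn hg,
    Finset.card_image_of_injective _ hh, Finset.card_univ, Fintype.card_fin] at this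

/-- The number of standard tableaux of a diagram with `k` nodes, by recursion over the position of
the largest entry. -/
noncomputable def numTableaux : ℕ → Finset (MNode m) → ℕ
  | 0, _ => 1
  | k + 1, D => ∑ α ∈ removableNodes D, numTableaux k (D.erase α)

/-- The relation DU - UD = m of the up and down operators, of which only an inequality is needed.
Adding α and then removing β ≠ α equals removing β first; the induction hypothesis applies to D
minus β, and the surplus of addable over removable nodes supplies the additional m. -/
theorem sum_addable_ge {k : ℕ} {D : Finset (MNode m)} (hD : IsLow D) (hk : D.card = k) :
    m * (k + 1) * numTableaux k D ≤ ∑ α ∈ addableNodes k D, numTableaux (k + 1) (insert α D) := by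
  classical
  induction k generalizing D with
  | zero =>
    have h1 := card_removableNodes_add_le hD hk
    calc m * (0 + 1) * numTableaux 0 D = m := by simp [numTableaux]
      _ ≤ ∑ α ∈ addableNodes 0 D, 1 := by simp; omega
      _ ≤ _ := by
        refine Finset.sum_le_sum fun α hα => ?_
        obtain ⟨h2, h3⟩ := (mem_addableNodes hk).1 hα
        have h4 : α ∈ removableNodes (insert α D) :=
          mem_removableNodes.2 ⟨Finset.mem_insert_self _ _, by rwa [Finset.erase_insert h2]⟩
        exact Finset.single_le_sum (f := fun β => numTableaux 0 ((insert α D).erase β))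
          (fun _ _ => Nat.zero_le _) h4
  | succ k ih =>
    set N := numTableaux (k + 1) D with hN
    set A := addableNodes (k + 1) D with hA
    set R := removableNodes D with hR
    have hcard : R.card + m ≤ A.card := card_removableNodes_add_le hD hk
    have hRc : ∀ β ∈ R, (D.erase β).card = k := fun β hβ => by
      rw [Finset.card_erase_of_mem (mem_removableNodes.1 hβ).1, hk]; rfl
    -- Removing α again contributes `N`; among the other removals only those β are kept for which α
    -- can also be added after β is removed.
    have step1 : ∀ α ∈ A, N + ∑ β ∈ R with α ∈ (addableNodes k (D.erase β)).erase β,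
        numTableaux (k + 1) (insert α (D.erase β)) ≤ numTableaux (k + 2) (insert α D) := by
      intro α hα
      obtain ⟨h2, h3⟩ := (mem_addableNodes hk).1 hα
      have h4 : α ∈ removableNodes (insert α D) :=
        mem_removableNodes.2 ⟨Finset.mem_insert_self _ _, by rwa [Finset.erase_insert h2]⟩
      change _ ≤ ∑ β ∈ removableNodes (insert α D), numTableaux (k + 1) ((insert α D).erase β)
      rw [← Finset.add_sum_erase _ _ h4, Finset.erase_insert h2]
      refine Nat.add_le_add_left ?_ _
      have h5 : ∀ β ∈ R.filter (fun β => α ∈ (addableNodes k (D.erase β)).erase β),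
          (insert α D).erase β = insert α (D.erase β) := by
        intro β hβ
        obtain ⟨-, hβ2⟩ := Finset.mem_filter.1 hβ
        exact Finset.erase_insert_of_ne (Finset.mem_erase.1 hβ2).1
      calc _ = ∑ β ∈ R with α ∈ (addableNodes k (D.erase β)).erase β,
            numTableaux (k + 1) ((insert α D).erase β) :=
            Finset.sum_congr rfl fun β hβ => by rw [h5 β hβ]
        _ ≤ _ := by
          refine Finset.sum_le_sum_of_subset fun β hβ => ?_
          have e := h5 β hβ
          obtain ⟨hβ1, hβ2⟩ := Finset.mem_filter.1 hβ
          obtain ⟨hβ3, hβ4⟩ := Finset.mem_erase.1 hβ2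
          rw [mem_addableNodes (hRc β hβ1)] at hβ4
          refine Finset.mem_erase.2 ⟨hβ3.symm, mem_removableNodes.2
            ⟨Finset.mem_insert_of_mem (mem_removableNodes.1 hβ1).1, ?_⟩⟩
          rw [e]
          exact hβ4.2
    have step2 : ∀ β ∈ R, A.filter (fun α => α ∈ (addableNodes k (D.erase β)).erase β) =
        (addableNodes k (D.erase β)).erase β := by
      intro β hβ
      ext α
      rw [Finset.mem_filter]
      refine and_iff_right_of_imp fun hα => ?_
      obtain ⟨h1, h2⟩ := Finset.mem_erase.1 hα
      rw [mem_addableNodes (hRc β hβ)] at h2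
      refine (mem_addableNodes hk).2 ⟨fun h => h2.1 (Finset.mem_erase.2 ⟨h1, h⟩), ?_⟩
      intro γ hγ r s hr hs
      rcases Finset.mem_insert.1 hγ with rfl | hγ
      · have := h2.2 γ (Finset.mem_insert_self _ _) r s hr hs
        exact Finset.insert_subset_insert _ (Finset.erase_subset _ _) this
      · exact Finset.mem_insert_of_mem (hD γ hγ r s hr hs)
    -- The summand α = β restores `D` and contributes the separate `N`.
    have step3 : ∀ β ∈ R, m * (k + 1) * numTableaux k (D.erase β) ≤
        ∑ α ∈ (addableNodes k (D.erase β)).erase β,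
          numTableaux (k + 1) (insert α (D.erase β)) + N := by
      intro β hβ
      obtain ⟨h1, h2⟩ := mem_removableNodes.1 hβ
      have h3 : β ∈ addableNodes k (D.erase β) :=
        (mem_addableNodes (hRc β hβ)).2 ⟨Finset.notMem_erase _ _, by rwa [Finset.insert_erase h1]⟩
      have := ih h2 (hRc β hβ)
      rwa [← Finset.sum_erase_add _ _ h3, Finset.insert_erase h1] at this
    have step4 : A.card * N + ∑ β ∈ R, ∑ α ∈ (addableNodes k (D.erase β)).erase β,
          numTableaux (k + 1) (insert α (D.erase β)) ≤
        ∑ α ∈ A, numTableaux (k + 2) (insert α D) := by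
      refine le_trans (le_of_eq ?_) (Finset.sum_le_sum step1)
      rw [Finset.sum_add_distrib, Finset.sum_const, smul_eq_mul]
      congr 1
      simp_rw [Finset.sum_filter]
      rw [Finset.sum_comm]
      refine Finset.sum_congr rfl fun β hβ => ?_
      rw [← Finset.sum_filter, step2 β hβ]
    have step5 := Finset.sum_le_sum step3
    rw [← Finset.mul_sum, Finset.sum_add_distrib, Finset.sum_const, smul_eq_mul] at step5
    have hN' : ∑ β ∈ R, numTableaux k (D.erase β) = N := rfl
    rw [hN'] at step5
    have step6 := Nat.mul_le_mul_right N hcard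
    calc m * (k + 1 + 1) * N = m * (k + 1) * N + m * N := by ring
      _ ≤ _ := by
        rw [add_mul] at step6
        refine le_trans ?_ step4
        omega

open Classical in
/-- The diagrams with `k` nodes. -/
noncomputable def lowSets (m k : ℕ) : Finset (Finset (MNode m)) :=
  (Finset.univ ×ˢ Finset.range k ×ˢ Finset.range k).powerset.filter
    fun D => IsLow D ∧ D.card = k

theorem mem_lowSets {k : ℕ} {D : Finset (MNode m)} :
    D ∈ lowSets m k ↔ IsLow D ∧ D.card = k := by
  classical
  rw [lowSets, Finset.mem_filter]
  refine and_iff_right_of_imp fun ⟨h1, h2⟩ => Finset.mem_powerset.2 fun α hα => ?_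
  have := h1.lt_card hα
  rw [h2] at this
  simpa using this

/-- Expanding one factor of the square by removal of a node gives a sum over the edges between sizes
k and k + 1. Regrouped by the smaller diagram, it is bounded below by `sum_addable_ge`. -/
theorem le_sum_sq_numTableaux (k : ℕ) :
    m ^ k * k.factorial ≤ ∑ D ∈ lowSets m k, numTableaux k D ^ 2 := by
  classical
  induction k with
  | zero =>
    have h : (∅ : Finset (MNode m)) ∈ lowSets m 0 := by simp [mem_lowSets, IsLow]
    exact Finset.single_le_sum (f := fun D => numTableaux 0 D ^ 2) (fun _ _ => Nat.zero_le _) h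
  | succ k ih =>
    have e : ∑ D ∈ lowSets m (k + 1), numTableaux (k + 1) D ^ 2 =
        ∑ D ∈ lowSets m k, ∑ α ∈ addableNodes k D,
          numTableaux (k + 1) (insert α D) * numTableaux k D := by
      have : ∀ D ∈ lowSets m (k + 1), numTableaux (k + 1) D ^ 2 =
          ∑ β ∈ removableNodes D, numTableaux (k + 1) D * numTableaux k (D.erase β) :=
        fun D _ => by rw [sq, ← Finset.mul_sum]; rfl
      rw [Finset.sum_congr rfl this, Finset.sum_sigma', Finset.sum_sigma']
      refine Finset.sum_bij' (fun x _ => ⟨x.1.erase x.2, x.2⟩) (fun x _ => ⟨insert x.2 x.1, x.2⟩)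
        ?_ ?_ ?_ ?_ ?_
      · rintro ⟨D, β⟩ hx
        obtain ⟨h1, h2⟩ := Finset.mem_sigma.1 hx
        obtain ⟨h1, h1'⟩ := mem_lowSets.1 h1
        obtain ⟨h2, h2'⟩ := mem_removableNodes.1 h2
        have hc : (D.erase β).card = k := by rw [Finset.card_erase_of_mem h2, h1']; rfl
        refine Finset.mem_sigma.2 ⟨mem_lowSets.2 ⟨h2', hc⟩, (mem_addableNodes hc).2
          ⟨Finset.notMem_erase _ _, ?_⟩⟩
        dsimp only at h2 ⊢
        rwa [Finset.insert_erase h2]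
      · rintro ⟨D, β⟩ hx
        obtain ⟨h1, h2⟩ := Finset.mem_sigma.1 hx
        obtain ⟨h1, h1'⟩ := mem_lowSets.1 h1
        obtain ⟨h2, h2'⟩ := (mem_addableNodes h1').1 h2
        refine Finset.mem_sigma.2 ⟨mem_lowSets.2 ⟨h2', ?_⟩, mem_removableNodes.2
          ⟨Finset.mem_insert_self _ _, ?_⟩⟩
        · dsimp only at h2 h1' ⊢
          rw [Finset.card_insert_of_notMem h2, h1']
        · dsimp only at h2 ⊢
          rwa [Finset.erase_insert h2]
      · rintro ⟨D, β⟩ hx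
        have h2 := (mem_removableNodes.1 (Finset.mem_sigma.1 hx).2).1
        dsimp only at h2 ⊢
        rw [Finset.insert_erase h2]
      · rintro ⟨D, β⟩ hx
        obtain ⟨h1, h2⟩ := Finset.mem_sigma.1 hx
        have h2 := ((mem_addableNodes (mem_lowSets.1 h1).2).1 h2).1
        dsimp only at h2 ⊢
        rw [Finset.erase_insert h2]
      · rintro ⟨D, β⟩ hx
        have h2 := (mem_removableNodes.1 (Finset.mem_sigma.1 hx).2).1
        dsimp only at h2 ⊢
        rw [Finset.insert_erase h2]
    rw [e]
    calc m ^ (k + 1) * (k + 1).factorial = m * (k + 1) * (m ^ k * k.factorial) := by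
          rw [Nat.factorial_succ]; ring
      _ ≤ m * (k + 1) * ∑ D ∈ lowSets m k, numTableaux k D ^ 2 := Nat.mul_le_mul_left _ ih
      _ = ∑ D ∈ lowSets m k, m * (k + 1) * numTableaux k D * numTableaux k D := by
          rw [Finset.mul_sum]
          exact Finset.sum_congr rfl fun D _ => by ring
      _ ≤ _ := by
          refine Finset.sum_le_sum fun D hD => ?_
          rw [← Finset.sum_mul]
          exact Nat.mul_le_mul_right _ (sum_addable_ge (mem_lowSets.1 hD).1 (mem_lowSets.1 hD).2)

end Counting

/-! ### Removing the largest entry of a standard tableau. -/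

section Restriction

variable {m n : ℕ}

theorem MPartition.mem_remove {Λ : MPartition m (n + 1)} {α : MNode m} (h : Λ.IsRemovable α)
    {β : MNode m} : β.2 ∈ (Λ.remove α h).diag β.1 ↔ β.2 ∈ Λ.diag β.1 ∧ β ≠ α := by
  change β.2 ∈ Function.update Λ.diag α.1 _ β.1 ↔ _
  by_cases hp : β.1 = α.1
  · rw [hp, Function.update_self]
    change β.2 ∈ (Λ.diag α.1).cells.erase α.2 ↔ _
    rw [Finset.mem_erase, YoungDiagram.mem_cells, and_comm]
    refine and_congr_right fun _ => not_congr ⟨fun h => Prod.ext hp h, fun h => by rw [h]⟩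
  · rw [Function.update_of_ne hp]
    exact (and_iff_left fun h => hp (by rw [h])).symm

theorem IsStandard.isRemovable_last {Λ : MPartition m (n + 1)} {T : Fin (n + 1) → MNode m}
    (hT : IsStandard Λ T) : Λ.IsRemovable (T (Fin.last n)) := by
  refine ⟨hT.mem _, ?_⟩
  intro x y hyx hx
  rw [Finset.mem_coe, Finset.mem_erase, YoungDiagram.mem_cells] at hx ⊢
  refine ⟨?_, (Λ.diag _).isLowerSet hyx hx.2⟩
  rintro rfl
  obtain ⟨i, hi⟩ := hT.exists_eq (α := ((T (Fin.last n)).1, x)) hx.2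
  have := hT.lt_of_le (i := Fin.last n) (j := i) (by rw [hi]) (by rw [hi]; exact hyx.1)
    (by rw [hi]; exact hyx.2) (fun h => hx.1 (by rw [h, hi]))
  exact absurd this (Fin.le_last i).not_gt

theorem IsStandard.restrict {Λ : MPartition m (n + 1)} {T : Fin (n + 1) → MNode m}
    (hT : IsStandard Λ T) {α : MNode m} (hα : T (Fin.last n) = α) (h : Λ.IsRemovable α) :
    IsStandard (Λ.remove α h) (T ∘ Fin.castSucc) := by
  refine ⟨⟨?_, ?_, ?_⟩, ?_, ?_⟩
  · intro i _
    refine (MPartition.mem_remove h).2 ⟨hT.mem _, ?_⟩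
    rw [← hα]
    exact fun e => (Fin.castSucc_lt_last i).ne (hT.injective e)
  · exact (hT.injective.comp (Fin.castSucc_injective n)).injOn
  · intro β hβ
    obtain ⟨h1, h2⟩ := (MPartition.mem_remove h).1 hβ
    obtain ⟨i, rfl⟩ := hT.exists_eq h1
    have hi : i ≠ Fin.last n := by
      rintro rfl
      exact h2 hα
    exact ⟨i.castPred hi, trivial, by simp⟩
  · exact fun i j h1 h2 h3 => Fin.castSucc_lt_castSucc_iff.1 (hT.row _ _ h1 h2 h3)
  · exact fun i j h1 h2 h3 => Fin.castSucc_lt_castSucc_iff.1 (hT.col _ _ h1 h2 h3)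

theorem IsStandard.snoc {Λ : MPartition m (n + 1)} {α : MNode m} (h : Λ.IsRemovable α)
    {T : Fin n → MNode m} (hT : IsStandard (Λ.remove α h) T) :
    IsStandard Λ (Fin.snoc T α : Fin (n + 1) → MNode m) := by
  have hmem : ∀ i, (T i).2 ∈ Λ.diag (T i).1 ∧ T i ≠ α := fun i =>
    (MPartition.mem_remove h).1 (hT.mem i)
  -- A removable node is maximal: no remaining node of its component lies weakly below and to the
  -- right of it.
  have hmax : ∀ i, α.1 = (T i).1 → α.2 ≤ (T i).2 → False := by
    intro i h1 h2
    have h3 := hmem i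
    have h4 : (T i).2 ∈ (((Λ.diag α.1).cells.erase α.2 : Finset (ℕ × ℕ)) : Set (ℕ × ℕ)) := by
      rw [Finset.mem_coe, Finset.mem_erase, YoungDiagram.mem_cells, h1]
      exact ⟨fun e => h3.2 (Prod.ext h1.symm e), h3.1⟩
    have h5 := h.2 h2 h4
    simp at h5
  refine ⟨⟨?_, ?_, ?_⟩, ?_, ?_⟩
  · intro i _
    induction i using Fin.lastCases with
    | last => simpa using h.1
    | cast i => simpa using (hmem i).1
  · refine (Set.injOn_univ).2 ?_
    rw [Fin.snoc_injective_iff]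
    refine ⟨hT.injective, ?_⟩
    rintro ⟨i, hi⟩
    exact (hmem i).2 hi
  · intro β hβ
    by_cases hβα : β = α
    · exact ⟨Fin.last n, trivial, by simp [hβα]⟩
    · obtain ⟨i, rfl⟩ := hT.exists_eq ((MPartition.mem_remove h).2 ⟨hβ, hβα⟩)
      exact ⟨i.castSucc, trivial, by simp⟩
  · intro i j
    induction i using Fin.lastCases with
    | last =>
      induction j using Fin.lastCases with
      | last => simp
      | cast j =>
        simp only [Fin.snoc_last, Fin.snoc_castSucc]
        exact fun h1 h2 h3 => (hmax j h1 ⟨h2.le, h3.le⟩).elim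
    | cast i =>
      induction j using Fin.lastCases with
      | last => exact fun _ _ _ => Fin.castSucc_lt_last i
      | cast j =>
        simp only [Fin.snoc_castSucc, Fin.castSucc_lt_castSucc_iff]
        exact hT.row i j
  · intro i j
    induction i using Fin.lastCases with
    | last =>
      induction j using Fin.lastCases with
      | last => simp
      | cast j =>
        simp only [Fin.snoc_last, Fin.snoc_castSucc]
        exact fun h1 h2 h3 => (hmax j h1 ⟨h3.le, h2.le⟩).elim
    | cast i =>
      induction j using Fin.lastCases with
      | last => exact fun _ _ _ => Fin.castSucc_lt_last i
      | cast j =>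
        simp only [Fin.snoc_castSucc, Fin.castSucc_lt_castSucc_iff]
        exact hT.col i j

/-- A standard tableau is given by the position of its largest entry and by the standard tableau of
the smaller entries. -/
def StdTableau.restrict {Λ : MPartition m (n + 1)} (T : StdTableau Λ) :
    Σ α : {α : MNode m // Λ.IsRemovable α}, StdTableau (Λ.remove α.1 α.2) :=
  ⟨⟨T.fill (Fin.last n), T.isStandard.isRemovable_last⟩,
    StdTableau.of (T.isStandard.restrict rfl T.isStandard.isRemovable_last)⟩

/-- Keeping the removed node as a variable allows substitution in place of a transport between
dependent types. -/
theorem StdTableau.restrict_eq {Λ : MPartition m (n + 1)} {T : StdTableau Λ}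
    {α : {α : MNode m // Λ.IsRemovable α}} {S : StdTableau (Λ.remove α.1 α.2)}
    (h1 : T.fill (Fin.last n) = α.1) (h2 : T.fill ∘ Fin.castSucc = S.fill) :
    T.restrict = ⟨α, S⟩ := by
  obtain ⟨α, h⟩ := α
  dsimp only at h1
  subst h1
  exact Sigma.ext rfl (heq_of_eq (StdTableau.ext h2))

/-- Restriction is a bijection from the standard tableaux of `Λ` to those of all `Λ \ {α}`. -/
def stdTableauEquiv (Λ : MPartition m (n + 1)) :
    StdTableau Λ ≃ Σ α : {α : MNode m // Λ.IsRemovable α}, StdTableau (Λ.remove α.1 α.2) where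
  toFun := StdTableau.restrict
  invFun x := StdTableau.of (x.2.isStandard.snoc x.1.2)
  left_inv T := StdTableau.ext (Fin.snoc_init_self T.fill)
  right_inv := by
    rintro ⟨α, S⟩
    exact StdTableau.restrict_eq (Fin.snoc_last (α := fun _ => MNode m) _ _)
      (funext fun i => Fin.snoc_castSucc (α := fun _ => MNode m) _ _ i)

end Restriction

/-! ### Translation between m-partitions and finite sets of nodes. -/

section ShapeCount

variable {m n : ℕ}

instance (Λ : MPartition m n) : Finite (StdTableau Λ) := by
  classical
  have hf : {α : MNode m | α.2 ∈ Λ.diag α.1}.Finite := by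
    refine ((Finset.univ.sigma fun p => (Λ.diag p).cells).image
      fun x : (Σ _ : Fin m, ℕ × ℕ) => (x.1, x.2)).finite_toSet.subset ?_
    intro α hα
    exact Finset.mem_coe.2 (Finset.mem_image.2 ⟨⟨α.1, α.2⟩, by simpa using hα, rfl⟩)
  have := hf.to_subtype
  refine Finite.of_injective (β := Fin n → {α : MNode m | α.2 ∈ Λ.diag α.1})
    (fun T i => ⟨T.fill i, T.isStandard.mem i⟩) fun T S h => StdTableau.ext (funext fun i => ?_)
  exact congrArg Subtype.val (congrFun h i)

noncomputable instance (Λ : MPartition m n) : Fintype (StdTableau Λ) := Fintype.ofFinite _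

noncomputable instance (Λ : MPartition m n) : DecidableEq (StdTableau Λ) := Classical.decEq _

open Classical in
/-- The set of `m`-nodes of an `m`-partition. -/
noncomputable def MPartition.nodes (Λ : MPartition m n) : Finset (MNode m) :=
  Finset.univ.biUnion fun p => (Λ.diag p).cells.image (Prod.mk p)

theorem MPartition.mem_nodes {Λ : MPartition m n} {α : MNode m} :
    α ∈ Λ.nodes ↔ α.2 ∈ Λ.diag α.1 := by
  simp only [nodes, Finset.mem_biUnion, Finset.mem_univ, true_and, Finset.mem_image,
    YoungDiagram.mem_cells]
  constructor
  · rintro ⟨p, x, hx, rfl⟩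
    exact hx
  · exact fun h => ⟨α.1, α.2, h, rfl⟩

theorem MPartition.isLow_nodes (Λ : MPartition m n) : IsLow Λ.nodes := by
  intro α hα r s hr hs
  rw [mem_nodes] at hα ⊢
  exact (Λ.diag α.1).isLowerSet (show (r, s) ≤ α.2 from ⟨hr, hs⟩) hα

theorem MPartition.card_nodes (Λ : MPartition m n) : Λ.nodes.card = n := by
  classical
  rw [nodes, Finset.card_biUnion]
  · refine (Finset.sum_congr rfl fun p _ => ?_).trans Λ.size
    rw [Finset.card_image_of_injective _ (Prod.mk_right_injective p)]
  · intro p _ p' _ hne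
    simp only [Function.onFun]
    rw [Finset.disjoint_left]
    intro x hx hx'
    obtain ⟨a, -, rfl⟩ := Finset.mem_image.1 hx
    obtain ⟨b, -, e⟩ := Finset.mem_image.1 hx'
    exact hne (congrArg Prod.fst e).symm

theorem MPartition.nodes_injective : Function.Injective (MPartition.nodes (m := m) (n := n)) := by
  rintro ⟨d, hd⟩ ⟨e, he⟩ h
  congr
  funext p
  ext x
  have := congrArg (fun D => (p, x) ∈ D) h
  simpa only [mem_nodes, eq_iff_iff, YoungDiagram.mem_cells] using this

open Classical in
/-- The `m`-partition with a given set of `m`-nodes. -/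
noncomputable def MPartition.ofNodes (D : Finset (MNode m)) (hD : IsLow D) (hn : D.card = n) :
    MPartition m n where
  diag p := ⟨(D.filter fun α => α.1 = p).image Prod.snd, by
    intro x y hyx hx
    simp only [Finset.coe_image, Set.mem_image, Finset.mem_coe, Finset.mem_filter] at hx ⊢
    obtain ⟨α, ⟨h1, rfl⟩, rfl⟩ := hx
    exact ⟨(α.1, y), ⟨hD α h1 y.1 y.2 hyx.1 hyx.2, rfl⟩, rfl⟩⟩
  size := by
    rw [← hn, Finset.card_eq_sum_card_fiberwise (f := Prod.fst) (t := Finset.univ)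
      (fun _ _ => Finset.mem_coe.2 (Finset.mem_univ _))]
    refine Finset.sum_congr rfl fun p _ => Finset.card_image_of_injOn ?_
    intro a ha b hb h
    simp only [Finset.coe_filter, Set.mem_ofPred_eq] at ha hb
    exact Prod.ext (ha.2.trans hb.2.symm) h

theorem MPartition.nodes_ofNodes (D : Finset (MNode m)) (hD : IsLow D) (hn : D.card = n) :
    (MPartition.ofNodes D hD hn).nodes = D := by
  classical
  ext α
  rw [mem_nodes]
  change α.2 ∈ (D.filter fun β => β.1 = α.1).image Prod.snd ↔ _
  rw [Finset.mem_image]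
  constructor
  · rintro ⟨β, hβ, e⟩
    obtain ⟨h1, h2⟩ := Finset.mem_filter.1 hβ
    rwa [← Prod.ext h2 e]
  · exact fun h => ⟨α, Finset.mem_filter.2 ⟨h, rfl⟩, rfl⟩

/-- `m`-partitions of `n` and their sets of nodes. -/
noncomputable def nodesEquiv (m n : ℕ) : MPartition m n ≃ {D // D ∈ lowSets m n} where
  toFun Λ := ⟨Λ.nodes, mem_lowSets.2 ⟨Λ.isLow_nodes, Λ.card_nodes⟩⟩
  invFun D := MPartition.ofNodes D.1 (mem_lowSets.1 D.2).1 (mem_lowSets.1 D.2).2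
  left_inv _ := MPartition.nodes_injective (MPartition.nodes_ofNodes _ _ _)
  right_inv _ := Subtype.ext (MPartition.nodes_ofNodes _ _ _)

noncomputable instance : Fintype (MPartition m n) := Fintype.ofEquiv _ (nodesEquiv m n).symm

noncomputable instance : DecidableEq (MPartition m n) := Classical.decEq _

theorem MPartition.isRemovable_iff {Λ : MPartition m (n + 1)} {α : MNode m} :
    Λ.IsRemovable α ↔ α ∈ removableNodes Λ.nodes := by
  rw [mem_removableNodes, MPartition.mem_nodes]
  refine and_congr_right fun hα => ⟨fun h => ?_, fun h => ?_⟩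
  · intro β hβ r s hr hs
    rw [Finset.mem_erase, MPartition.mem_nodes] at hβ ⊢
    refine ⟨?_, (Λ.diag β.1).isLowerSet (show (r, s) ≤ β.2 from ⟨hr, hs⟩) hβ.2⟩
    rintro rfl
    have h1 : β.2 ∈ (((Λ.diag β.1).cells.erase (r, s) : Finset (ℕ × ℕ)) : Set (ℕ × ℕ)) := by
      rw [Finset.mem_coe, Finset.mem_erase, YoungDiagram.mem_cells]
      exact ⟨fun e => hβ.1 (Prod.ext rfl e), hβ.2⟩
    have h2 := h (show (r, s) ≤ β.2 from ⟨hr, hs⟩) h1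
    simp at h2
  · intro x y hyx hx
    rw [Finset.mem_coe, Finset.mem_erase, YoungDiagram.mem_cells] at hx ⊢
    have := h (α.1, x)
      (Finset.mem_erase.2 ⟨fun e => hx.1 (by rw [← e]), MPartition.mem_nodes.2 hx.2⟩)
      y.1 y.2 hyx.1 hyx.2
    rw [Finset.mem_erase, MPartition.mem_nodes] at this
    exact ⟨fun e => this.1 (by rw [← Prod.mk.eta (p := α), ← e]), this.2⟩

theorem MPartition.nodes_remove {Λ : MPartition m (n + 1)} {α : MNode m} (h : Λ.IsRemovable α) :
    (Λ.remove α h).nodes = Λ.nodes.erase α := by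
  ext β
  rw [mem_nodes, mem_remove, Finset.mem_erase, mem_nodes, and_comm]

instance (Λ : MPartition m (n + 1)) : Finite {α : MNode m // Λ.IsRemovable α} :=
  Set.Finite.to_subtype ((removableNodes Λ.nodes).finite_toSet.subset
    fun _ h => MPartition.isRemovable_iff.1 h)

noncomputable instance (Λ : MPartition m (n + 1)) : Fintype {α : MNode m // Λ.IsRemovable α} :=
  Fintype.ofFinite _

theorem card_stdTableau (Λ : MPartition m n) :
    Fintype.card (StdTableau Λ) = numTableaux n Λ.nodes := by
  induction n with
  | zero =>
    have h : IsStandard Λ Fin.elim0 := by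
      refine ⟨⟨fun i => i.elim0, fun i => i.elim0, fun α hα => ?_⟩, fun i => i.elim0,
        fun i => i.elim0⟩
      have h1 := Finset.card_eq_zero.1 Λ.card_nodes
      have h2 := MPartition.mem_nodes.2 hα
      rw [h1] at h2
      simp at h2
    rw [numTableaux, Fintype.card_eq_one_iff]
    exact ⟨StdTableau.of h, fun T => StdTableau.ext (funext fun i => i.elim0)⟩
  | succ n ih =>
    rw [Fintype.card_congr (stdTableauEquiv Λ), Fintype.card_sigma, numTableaux]
    simp_rw [ih, MPartition.nodes_remove]
    refine Finset.sum_bij' (fun α _ => α.1)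
      (fun α hα => ⟨α, MPartition.isRemovable_iff.2 hα⟩) ?_ ?_ ?_ ?_ ?_
    · exact fun α _ => MPartition.isRemovable_iff.1 α.2
    · simp
    · simp
    · simp
    · simp

theorem le_sum_sq_card (m n : ℕ) :
    m ^ n * n.factorial ≤ ∑ Λ : MPartition m n, Fintype.card (StdTableau Λ) ^ 2 := by
  refine (le_sum_sq_numTableaux n).trans (le_of_eq ?_)
  simp_rw [card_stdTableau]
  rw [← Finset.sum_coe_sort, ← (nodesEquiv m n).sum_comp]
  rfl

end ShapeCount

/-! ### Algebras of functions on a finite set. -/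

section Separation

/-- A subalgebra of the functions on a finite set that separates points contains all functions. -/
theorem subalgebra_eq_top_of_separates {K ι : Type*} [Field K] [Finite ι]
    (F : Subalgebra K (ι → K)) (h : ∀ s t, s ≠ t → ∃ f ∈ F, f s ≠ f t) : F = ⊤ := by
  classical
  cases nonempty_fintype ι
  -- A rescaled separating function is 1 at t and 0 at s; the product over all s ≠ t is the
  -- indicator of t.
  have hsep : ∀ s t, ∃ g ∈ F, s ≠ t → g t = 1 ∧ g s = 0 := by
    intro s t
    by_cases hst : s = t
    · exact ⟨0, zero_mem F, fun h => absurd hst h⟩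
    · obtain ⟨f, hf, hne⟩ := h s t hst
      refine ⟨(f t - f s)⁻¹ • (f - algebraMap K _ (f s)),
        F.smul_mem (sub_mem hf (F.algebraMap_mem _)) _, fun _ => ?_⟩
      simp [inv_mul_cancel₀ (sub_ne_zero.2 hne.symm)]
  choose g hg hg' using hsep
  have hind : ∀ t, (Pi.single t 1 : ι → K) ∈ F := by
    intro t
    have : (Pi.single t 1 : ι → K) = ∏ s ∈ Finset.univ.erase t, g s t := by
      funext r
      rw [Finset.prod_apply]
      by_cases hr : r = t
      · subst hr
        rw [Pi.single_eq_same]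
        exact (Finset.prod_eq_one fun s hs => (hg' s r (Finset.ne_of_mem_erase hs)).1).symm
      · rw [Pi.single_eq_of_ne hr]
        exact (Finset.prod_eq_zero (f := fun s => g s t r)
          (Finset.mem_erase.2 ⟨hr, Finset.mem_univ r⟩) (hg' r t hr).2).symm
    rw [this]
    exact prod_mem fun s _ => hg s t
  refine eq_top_iff.2 fun f _ => ?_
  have : f = ∑ t, f t • (Pi.single t 1 : ι → K) := by
    funext r
    simp [Pi.single_apply]
  rw [this]
  exact sum_mem fun t _ => F.smul_mem (hind t) _

end Separation

/-! ### Matrix units and the isomorphism with the product of the End V_Λ. -/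

section MatrixUnits

variable {K : Type u} [Field K] {m n : ℕ} {q : K} {v : Fin m → K}

/-- All standard `m`-tableaux with `n` entries. -/
abbrev Tableau (m n : ℕ) : Type := Σ Λ : MPartition m n, StdTableau Λ

/-- The subalgebra of `H(m,1,n)` generated by the Jucys-Murphy elements. -/
noncomputable def jmAlgebra (n : ℕ) (q : K) (v : Fin m → K) : Subalgebra K (Hecke n q v) :=
  Algebra.adjoin K (Set.range fun i : Fin n => JM q v (i : ℕ) i.2)

variable (G : Generic n q v)
include G

/-- The element `x` acts in all `V_Λ` diagonally with eigenvalues `c`. -/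
def Generic.ActsBy (x : Hecke n q v) (c : Tableau m n → K) : Prop :=
  ∀ (Λ : MPartition m n) (T : StdTableau Λ),
    G.rep Λ x (Finsupp.single T 1) = c ⟨Λ, T⟩ • Finsupp.single T 1

variable {G}

theorem Generic.ActsBy.add {x y : Hecke n q v} {c d : Tableau m n → K} (hx : G.ActsBy x c)
    (hy : G.ActsBy y d) : G.ActsBy (x + y) (c + d) := fun Λ T => by
  rw [map_add, LinearMap.add_apply, hx, hy, Pi.add_apply, add_smul]

theorem Generic.ActsBy.mul {x y : Hecke n q v} {c d : Tableau m n → K} (hx : G.ActsBy x c)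
    (hy : G.ActsBy y d) : G.ActsBy (x * y) (c * d) := fun Λ T => by
  rw [map_mul, Module.End.mul_apply, hy, map_smul, hx, Pi.mul_apply, mul_comm, mul_smul]

variable (G)

theorem Generic.actsBy_algebraMap (a : K) :
    G.ActsBy (algebraMap K _ a) (algebraMap K _ a) := fun Λ T => by
  rw [AlgHom.commutes, Module.algebraMap_end_apply]
  rfl

theorem Generic.actsBy_JM (i : Fin n) :
    G.ActsBy (JM q v i i.2) fun x => content q v (x.2.fill i) := fun Λ T => by
  rw [G.rep_JM, ← tabVec_fill, contentOp_tabVec T.isStandard]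

theorem Generic.tableau_ext {x y : Tableau m n}
    (h : ∀ i, content q v (x.2.fill i) = content q v (y.2.fill i)) : x = y := by
  obtain ⟨Λ, T⟩ := x
  obtain ⟨M, S⟩ := y
  have h1 : T.fill = S.fill := G.eq_of_contents_eq T.isStandard S.isStandard h
  have h2 : Λ = M := T.isStandard.shape_unique (h1 ▸ S.isStandard)
  subst h2
  rw [StdTableau.ext h1]

/-- Every diagonal action is that of a polynomial in the Jucys-Murphy elements. -/
theorem Generic.exists_actsBy (c : Tableau m n → K) : ∃ x ∈ jmAlgebra n q v, G.ActsBy x c := by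
  let F : Subalgebra K (Tableau m n → K) :=
    { carrier := {c | ∃ x ∈ jmAlgebra n q v, G.ActsBy x c}
      mul_mem' := fun ⟨x, hx, hx'⟩ ⟨y, hy, hy'⟩ => ⟨x * y, mul_mem hx hy, hx'.mul hy'⟩
      add_mem' := fun ⟨x, hx, hx'⟩ ⟨y, hy, hy'⟩ => ⟨x + y, add_mem hx hy, hx'.add hy'⟩
      algebraMap_mem' := fun a => ⟨_, Subalgebra.algebraMap_mem _ a, G.actsBy_algebraMap a⟩ }
  have hF : F = ⊤ := by
    refine subalgebra_eq_top_of_separates F fun x y hxy => ?_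
    by_contra! hne
    refine hxy (G.tableau_ext fun i => hne (fun z => content q v (z.2.fill i)) ?_)
    exact ⟨_, Algebra.subset_adjoin ⟨i, rfl⟩, G.actsBy_JM i⟩
  have : c ∈ F := hF ▸ Algebra.mem_top
  exact this

/-- Every element of the algebra generated by the Jucys-Murphy elements acts diagonally. -/
theorem Generic.exists_actsBy_of_mem {x : Hecke n q v} (hx : x ∈ jmAlgebra n q v) :
    ∃ c, G.ActsBy x c := by
  induction hx using Algebra.adjoin_induction with
  | mem x hx =>
    obtain ⟨i, rfl⟩ := hx
    exact ⟨_, G.actsBy_JM i⟩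
  | algebraMap a => exact ⟨_, G.actsBy_algebraMap a⟩
  | add x y _ _ hx hy =>
    obtain ⟨c, hc⟩ := hx
    obtain ⟨d, hd⟩ := hy
    exact ⟨_, hc.add hd⟩
  | mul x y _ _ hx hy =>
    obtain ⟨c, hc⟩ := hx
    obtain ⟨d, hd⟩ := hy
    exact ⟨_, hc.mul hd⟩

/-- The element `x` acts in `V_Λ` by sending `T` to `w` and all other tableaux to `0`, and in the
other modules by `0`. -/
def Generic.IsColumn (x : Hecke n q v) {Λ : MPartition m n} (T : StdTableau Λ)
    (w : TableauSpace K Λ) : Prop :=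
  (∀ R, G.rep Λ x (Finsupp.single R 1) = if R = T then w else 0) ∧ ∀ M ≠ Λ, G.rep M x = 0

variable {G}

theorem Generic.IsColumn.mul {x : Hecke n q v} {Λ : MPartition m n} {T : StdTableau Λ}
    {w : TableauSpace K Λ} (h : G.IsColumn x T w) (y : Hecke n q v) :
    G.IsColumn (y * x) T (G.rep Λ y w) := by
  refine ⟨fun R => ?_, fun M hM => by rw [map_mul, h.2 M hM, mul_zero]⟩
  rw [map_mul, Module.End.mul_apply, h.1]
  split_ifs <;> simp

theorem Generic.IsColumn.add {x y : Hecke n q v} {Λ : MPartition m n} {T : StdTableau Λ}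
    {w z : TableauSpace K Λ} (hx : G.IsColumn x T w) (hy : G.IsColumn y T z) :
    G.IsColumn (x + y) T (w + z) := by
  refine ⟨fun R => ?_, fun M hM => by rw [map_add, hx.2 M hM, hy.2 M hM, add_zero]⟩
  rw [map_add, LinearMap.add_apply, hx.1, hy.1]
  split_ifs <;> simp

theorem Generic.IsColumn.smul {x : Hecke n q v} {Λ : MPartition m n} {T : StdTableau Λ}
    {w : TableauSpace K Λ} (hx : G.IsColumn x T w) (a : K) : G.IsColumn (a • x) T (a • w) := by
  refine ⟨fun R => ?_, fun M hM => by rw [map_smul, hx.2 M hM, smul_zero]⟩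
  rw [map_smul, LinearMap.smul_apply, hx.1]
  split_ifs <;> simp

variable (G)

/-- The indicator function of one tableau among those of all shapes is a diagonal action, so the
diagonal matrix unit comes from the Jucys-Murphy algebra. -/
theorem Generic.exists_isColumn_self {Λ : MPartition m n} (T : StdTableau Λ) :
    ∃ x, G.IsColumn x T (Finsupp.single T 1) := by
  obtain ⟨x, -, hx⟩ := G.exists_actsBy (Pi.single ⟨Λ, T⟩ 1)
  refine ⟨x, fun R => ?_, fun M hM => ?_⟩
  · rw [hx]
    split_ifs with h
    · rw [h, Pi.single_eq_same, one_smul]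
    · rw [Pi.single_eq_of_ne, zero_smul]
      intro e
      exact h (by simpa using e)
  · refine tableauSpace_hom_ext fun R hR => ?_
    rw [tabVec_of_isStandard hR, hx, Pi.single_eq_of_ne, zero_smul, LinearMap.zero_apply]
    exact fun e => hM (congrArg Sigma.fst e)

omit G in
theorem StdTableau.swap_ne {Λ : MPartition m n} (S : StdTableau Λ) {i : ℕ} (h : i + 1 < n)
    (hS : IsStandard Λ (S.fill ∘ swapSucc i h)) : StdTableau.of hS ≠ S := by
  intro e
  have h1 := congrFun (congrArg StdTableau.fill e) ⟨i, by omega⟩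
  rw [StdTableau.fill_of, Function.comp_apply, swapSucc_apply_left] at h1
  have := S.isStandard.injective h1
  simp [Fin.ext_iff] at this

/-- Apply σ_i, project onto the exchanged tableau with its diagonal matrix unit, and divide by the
off-diagonal coefficient, which is nonzero by `Generic.content_ne_mul`. -/
theorem Generic.exists_isColumn_swap {Λ : MPartition m n} {S T : StdTableau Λ}
    (hST : ∃ x, G.IsColumn x T (Finsupp.single S 1)) {i : ℕ} (h : i + 1 < n)
    (hl : ¬ MNode.InLine (S.fill ⟨i, by omega⟩) (S.fill ⟨i + 1, h⟩)) :
    ∃ x, G.IsColumn x T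
      (Finsupp.single (StdTableau.of (S.isStandard.swap h hl)) (1 : K)) := by
  obtain ⟨x, hx⟩ := hST
  obtain ⟨e, he⟩ := G.exists_isColumn_self (StdTableau.of (S.isStandard.swap h hl))
  have hb : offCoef q v (S.fill ⟨i, by omega⟩) (S.fill ⟨i + 1, h⟩) ≠ 0 := by
    rw [offCoef_of_not_inLine hl]
    refine div_ne_zero ?_ (sub_ne_zero.2 (G.content_ne S.isStandard h).symm)
    intro h0
    have hl' : ¬ MNode.InLine ((S.fill ∘ swapSucc i h) ⟨i, by omega⟩)
        ((S.fill ∘ swapSucc i h) ⟨i + 1, h⟩) := by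
      rw [Function.comp_apply, swapSucc_apply_left, Function.comp_apply, swapSucc_apply_right]
      exact fun e => hl e.symm
    refine G.content_ne_mul S.isStandard h hl ?_
    have hq := G.q_ne
    field_simp at h0
    linear_combination -h0
  have key := ((hx.mul (sigma q v i h)).mul e).smul
    (offCoef q v (S.fill ⟨i, by omega⟩) (S.fill ⟨i + 1, h⟩))⁻¹
  suffices e1 : (offCoef q v (S.fill ⟨i, by omega⟩) (S.fill ⟨i + 1, h⟩))⁻¹ •
      G.rep Λ e (G.rep Λ (sigma q v i h) (Finsupp.single S 1)) =
        Finsupp.single (StdTableau.of (S.isStandard.swap h hl)) 1 from ⟨_, e1 ▸ key⟩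
  rw [G.rep_sigma, ← tabVec_fill, sigmaOp_tabVec S.isStandard,
    tabVec_of_isStandard (S.isStandard.swap h hl), tabVec_fill, map_add, map_smul, map_smul, he.1,
    he.1, if_pos rfl, if_neg (S.swap_ne h _).symm, smul_zero, zero_add, smul_smul,
    inv_mul_cancel₀ hb, one_smul]

omit G in
theorem IsStandard.le_of_inLine {Λ : MPartition m n} {T : Fin n → MNode m} (hT : IsStandard Λ T)
    {i j : Fin n} (hij : i < j) (hl : MNode.InLine (T i) (T j)) :
    (T i).2.1 ≤ (T j).2.1 ∧ (T i).2.2 ≤ (T j).2.2 := by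
  have hne : T j ≠ T i := fun e => hij.ne' (hT.injective e)
  have key : (T j).2.1 ≤ (T i).2.1 → (T j).2.2 ≤ (T i).2.2 → False := fun h1 h2 =>
    lt_asymm hij (hT.lt_of_le hl.1.symm h1 h2 hne)
  rcases hl.2 with h | h
  · exact ⟨h.le, (le_total _ _).resolve_right (key h.symm.le)⟩
  · exact ⟨(le_total _ _).resolve_right fun h' => key h' h.symm.le, h.le⟩

omit G in
/-- If two standard tableaux of the same shape differ, then two consecutive numbers of the one
appear in the opposite order in the other. -/
theorem StdTableau.exists_descent {Λ : MPartition m n} {R S : StdTableau Λ} {p : MNode m → ℕ}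
    (hp : ∀ k, p (S.fill k) = k) (hne : R ≠ S) :
    ∃ (i : ℕ) (h : i + 1 < n), p (R.fill ⟨i + 1, h⟩) < p (R.fill ⟨i, by omega⟩) := by
  have hR : ∀ i, ∃ k, S.fill k = R.fill i := fun i => S.isStandard.exists_eq (R.isStandard.mem i)
  choose f hf using hR
  by_contra! hle
  refine hne (StdTableau.ext ?_)
  cases n with
  | zero => exact funext fun i => i.elim0
  | succ n =>
    have hinj : Function.Injective f := fun a b h => R.isStandard.injective (by rw [← hf, ← hf, h])
    -- Without a descent the relabelling is a strictly increasing map of `Fin (n + 1)` into itself,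
    -- hence the identity.
    have hmono : StrictMono f := by
      refine Fin.strictMono_iff_lt_succ.2 fun i => lt_of_le_of_ne ?_ fun h => ?_
      · have := hle i (by omega)
        rw [← hf, ← hf, hp, hp] at this
        exact this
      · exact (Fin.castSucc_lt_succ (i := i)).ne (hinj h)
    funext i
    have : f i = i := le_antisymm hmono.apply_le hmono.le_apply
    rw [← hf, this]

/-- Admissible exchanges connect all tableaux of a shape: as long as a reachable tableau differs
from `S`, some exchange brings it closer to `S`. -/
theorem Generic.exists_isColumn_single {Λ : MPartition m n} (S T : StdTableau Λ) :
    ∃ x, G.IsColumn x T (Finsupp.single S (1 : K)) := by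
  classical
  set p : MNode m → ℕ := Function.extend S.fill (fun k => (k : ℕ)) 0
  have hp : ∀ k, p (S.fill k) = k := fun k => S.isStandard.injective.extend_apply _ _ k
  set A : Finset (StdTableau Λ) :=
    Finset.univ.filter fun R => ∃ x, G.IsColumn x T (Finsupp.single R (1 : K)) with hA
  have hTA : T ∈ A := by simpa [hA] using G.exists_isColumn_self T
  -- `p` reads off the number that `S` puts on a node. Exchanging a descent of `R` raises this
  -- weighted sum by p(R i) - p(R (i+1)) > 0, so a maximizer has no admissible descent.
  obtain ⟨R, hRA, hmax⟩ := Finset.exists_max_image A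
    (fun R => ∑ k : Fin n, (k : ℤ) * p (R.fill k)) ⟨T, hTA⟩
  have hR := (Finset.mem_filter.1 hRA).2
  by_cases hRS : R = S
  · rwa [← hRS]
  exfalso
  obtain ⟨i, h, hlt⟩ := StdTableau.exists_descent hp hRS
  -- Nodes in line are ordered alike by `R` and `S`, so a descent is never in line.
  have hl : ¬ MNode.InLine (R.fill ⟨i, by omega⟩) (R.fill ⟨i + 1, h⟩) := by
    intro hl
    obtain ⟨h1, h2⟩ := R.isStandard.le_of_inLine (by simp [Fin.lt_def]) hl
    obtain ⟨a, ha⟩ := S.isStandard.exists_eq (R.isStandard.mem ⟨i, by omega⟩)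
    obtain ⟨b, hb⟩ := S.isStandard.exists_eq (R.isStandard.mem ⟨i + 1, h⟩)
    rw [← ha, ← hb, hp, hp] at hlt
    refine lt_asymm hlt (S.isStandard.lt_of_le ?_ ?_ ?_ ?_) <;> rw [ha, hb]
    · exact hl.1
    · exact h1
    · exact h2
    · exact fun e => by simpa [Fin.ext_iff] using R.isStandard.injective e
  have hmem : StdTableau.of (R.isStandard.swap h hl) ∈ A := by
    simpa [hA] using G.exists_isColumn_swap hR h hl
  have hle := hmax _ hmem
  have e1 : ∑ k : Fin n, (k : ℤ) * p ((R.fill ∘ swapSucc i h) k) =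
      ∑ k : Fin n, ((swapSucc i h k : ℕ) : ℤ) * p (R.fill k) := by
    rw [← Equiv.sum_comp (swapSucc i h)]
    simp
  have e2 : ∑ k : Fin n, (((swapSucc i h k : ℕ) : ℤ) - k) * p (R.fill k) =
      ∑ k ∈ {⟨i, by omega⟩, ⟨i + 1, h⟩}, (((swapSucc i h k : ℕ) : ℤ) - k) * p (R.fill k) := by
    refine (Finset.sum_subset (Finset.subset_univ _) fun k _ hk => ?_).symm
    simp only [Finset.mem_insert, Finset.mem_singleton, not_or, Fin.ext_iff] at hk
    rw [swapSucc_apply_of_ne i h k hk.1 hk.2, sub_self, zero_mul]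
  rw [Finset.sum_pair (by simp [Fin.ext_iff]), swapSucc_apply_left, swapSucc_apply_right] at e2
  simp only [sub_mul, Finset.sum_sub_distrib] at e2
  rw [StdTableau.fill_of, e1] at hle
  push_cast at e2
  have hlt' : (p (R.fill ⟨i + 1, h⟩) : ℤ) < p (R.fill ⟨i, by omega⟩) := by exact_mod_cast hlt
  linarith

theorem Generic.exists_isColumn {Λ : MPartition m n} (T : StdTableau Λ) (w : TableauSpace K Λ) :
    ∃ x, G.IsColumn x T w := by
  induction w using Finsupp.induction_linear with
  | zero => exact ⟨0, fun R => by simp, fun M _ => by simp⟩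
  | add w z hw hz =>
    obtain ⟨x, hx⟩ := hw
    obtain ⟨y, hy⟩ := hz
    exact ⟨_, hx.add hy⟩
  | single S a =>
    obtain ⟨x, hx⟩ := G.exists_isColumn_single S T
    refine ⟨a • x, ?_⟩
    have := hx.smul a
    rwa [Finsupp.smul_single, smul_eq_mul, mul_one] at this

/-- The action on all the `V_Λ`. -/
noncomputable def Generic.repAll :
    Hecke n q v →ₐ[K] ∀ Λ : MPartition m n, Module.End K (TableauSpace K Λ) :=
  AlgHom.pi fun Λ => G.rep Λ

theorem Generic.repAll_surjective : Function.Surjective G.repAll := by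
  intro f
  have hc : ∀ x : Tableau m n, ∃ y, G.IsColumn y x.2 (f x.1 (Finsupp.single x.2 1)) :=
    fun x => G.exists_isColumn x.2 _
  choose y hy using hc
  refine ⟨∑ x, y x, funext fun Λ => ?_⟩
  change G.rep Λ (∑ x, y x) = f Λ
  refine tableauSpace_hom_ext fun T hT => ?_
  rw [tabVec_of_isStandard hT, map_sum, LinearMap.sum_apply,
    Finset.sum_eq_single (⟨Λ, StdTableau.of hT⟩ : Tableau m n)]
  · exact ((hy ⟨Λ, StdTableau.of hT⟩).1 _).trans (if_pos rfl)
  · rintro ⟨M, R⟩ - hne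
    by_cases hM : Λ = M
    · subst hM
      refine ((hy ⟨Λ, R⟩).1 _).trans (if_neg ?_)
      rintro rfl
      exact hne rfl
    · rw [(hy ⟨M, R⟩).2 Λ hM, LinearMap.zero_apply]
  · exact fun h => absurd (Finset.mem_univ _) h

/-- The chain m^n n! ≥ dim H ≥ Σ f_λ² ≥ m^n n! forces equality, and a surjection between spaces of
equal finite dimension is injective. -/
theorem Generic.repAll_bijective : Function.Bijective G.repAll := by
  refine ⟨?_, G.repAll_surjective⟩
  have h1 : Module.finrank K (∀ Λ : MPartition m n, Module.End K (TableauSpace K Λ)) =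
      ∑ Λ : MPartition m n, Fintype.card (StdTableau Λ) ^ 2 := by
    rw [Module.finrank_pi_fintype]
    refine Finset.sum_congr rfl fun Λ _ => ?_
    rw [Module.finrank_linearMap, Module.finrank_finsupp_self, sq]
  have h2 := LinearMap.finrank_le_finrank_of_surjective (f := G.repAll.toLinearMap)
    G.repAll_surjective
  have h3 : Module.finrank K (Hecke n q v) =
      Module.finrank K (∀ Λ : MPartition m n, Module.End K (TableauSpace K Λ)) :=
    le_antisymm (finrank_hecke_le.trans ((le_sum_sq_card m n).trans h1.ge)) h2
  let f : Hecke n q v →ₗ[K] ∀ Λ : MPartition m n, Module.End K (TableauSpace K Λ) :=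
    G.repAll.toLinearMap
  exact (LinearMap.injective_iff_surjective_of_finrank_eq_finrank (K := K) (V := Hecke n q v)
    (V₂ := ∀ Λ : MPartition m n, Module.End K (TableauSpace K Λ)) h3 (f := f)).2
      G.repAll_surjective

/-- The algebra `H(m,1,n)` is the product of the matrix algebras `End V_Λ`. -/
noncomputable def Generic.repEquiv :
    Hecke n q v ≃ₐ[K] ∀ Λ : MPartition m n, Module.End K (TableauSpace K Λ) :=
  AlgEquiv.ofBijective G.repAll G.repAll_bijective

theorem Generic.rep_repEquiv_symm (f : ∀ Λ : MPartition m n, Module.End K (TableauSpace K Λ))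
    (Λ : MPartition m n) : G.rep Λ (G.repEquiv.symm f) = f Λ :=
  congrFun (G.repEquiv.apply_symm_apply f) Λ

theorem Generic.ext {x y : Hecke n q v} (h : ∀ Λ, G.rep Λ x = G.rep Λ y) : x = y :=
  G.repAll_bijective.1 (funext h)

variable {G}

theorem Generic.ActsBy.eq {x y : Hecke n q v} {c : Tableau m n → K} (hx : G.ActsBy x c)
    (hy : G.ActsBy y c) : x = y := by
  refine G.ext fun Λ => tableauSpace_hom_ext fun T hT => ?_
  rw [tabVec_of_isStandard hT, hx, hy]

theorem Generic.ActsBy.mul_comm {x y : Hecke n q v} {c d : Tableau m n → K} (hx : G.ActsBy x c)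
    (hy : G.ActsBy y d) : x * y = y * x :=
  (hx.mul hy).eq (_root_.mul_comm c d ▸ hy.mul hx)

end MatrixUnits

/-! ### Classification of the irreducible modules. -/

section Irreducible

variable {K : Type u} [Field K]

/-- The identity map from the space of a representation to the corresponding module. -/
def RepMod.of {A : Type*} [Ring A] [Algebra K A] {V : Type*} [AddCommGroup V]
    [Module K V] (ρ : A →ₐ[K] Module.End K V) : V ≃+ RepMod ρ := AddEquiv.refl V

theorem RepMod.smul_of {A : Type*} [Ring A] [Algebra K A] {V : Type*} [AddCommGroup V]
    [Module K V] (ρ : A →ₐ[K] Module.End K V) (a : A) (x : V) :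
    a • RepMod.of ρ x = RepMod.of ρ (ρ a x) := rfl

/-- A `K`-linear map that commutes with the actions, as a homomorphism of modules. -/
def RepMod.hom {A : Type*} [Ring A] [Algebra K A] {V W : Type*} [AddCommGroup V]
    [Module K V] [AddCommGroup W] [Module K W] (ρ : A →ₐ[K] Module.End K V)
    (θ : A →ₐ[K] Module.End K W) (f : V →ₗ[K] W) (h : ∀ a x, f (ρ a x) = θ a (f x)) :
    RepMod ρ →ₗ[A] RepMod θ where
  toFun := f
  map_add' := f.map_add
  map_smul' := h

variable {m n : ℕ} {q : K} {v : Fin m → K}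

theorem IsLow.exists_removable {D : Finset (MNode m)} (hD : IsLow D) (hne : D.Nonempty) :
    (removableNodes D).Nonempty := by
  obtain ⟨α, hα, hmax⟩ := Finset.exists_max_image D (fun α => α.2.1 + α.2.2) hne
  refine ⟨α, mem_removableNodes.2 ⟨hα, fun β hβ r s hr hs => ?_⟩⟩
  obtain ⟨h1, h2⟩ := Finset.mem_erase.1 hβ
  refine Finset.mem_erase.2 ⟨?_, hD β h2 r s hr hs⟩
  rintro rfl
  have := hmax β h2
  dsimp only at hr hs this
  exact h1 (Prod.ext rfl (Prod.ext (by dsimp only; omega) (by dsimp only; omega)))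

theorem numTableaux_pos {k : ℕ} {D : Finset (MNode m)} (hD : IsLow D) (hk : D.card = k) :
    0 < numTableaux k D := by
  induction k generalizing D with
  | zero => exact one_pos
  | succ k ih =>
    obtain ⟨α, hα⟩ := hD.exists_removable (Finset.card_pos.1 (by omega))
    obtain ⟨h1, h2⟩ := mem_removableNodes.1 hα
    exact Finset.sum_pos' (fun _ _ => Nat.zero_le _)
      ⟨α, hα, ih h2 (by rw [Finset.card_erase_of_mem h1, hk]; rfl)⟩

instance (Λ : MPartition m n) : Nonempty (StdTableau Λ) := by
  rw [← Fintype.card_pos_iff, card_stdTableau]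
  exact numTableaux_pos Λ.isLow_nodes Λ.card_nodes

variable (G : Generic n q v)
include G

theorem Generic.exists_rep_eq {Λ : MPartition m n} (f : Module.End K (TableauSpace K Λ)) :
    ∃ x, G.rep Λ x = f ∧ ∀ M ≠ Λ, G.rep M x = 0 :=
  ⟨G.repEquiv.symm (Pi.single Λ f), by rw [G.rep_repEquiv_symm, Pi.single_eq_same],
    fun M hM => by rw [G.rep_repEquiv_symm, Pi.single_eq_of_ne hM]⟩

theorem Generic.isSimpleModule (Λ : MPartition m n) :
    IsSimpleModule (Hecke n q v) (RepMod (G.rep Λ)) := by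
  rw [isSimpleModule_iff_toSpanSingleton_surjective]
  refine ⟨inferInstanceAs (Nontrivial (TableauSpace K Λ)), fun x hx y => ?_⟩
  change TableauSpace K Λ at x y
  obtain ⟨T, hT⟩ := Finsupp.ne_iff.1 (show x ≠ 0 from hx)
  -- The rank one operator that reads the nonzero coordinate of `x` at `T` and returns `y`.
  obtain ⟨a, ha, -⟩ := G.exists_rep_eq ((x T)⁻¹ • (Finsupp.lapply T).smulRight y)
  refine ⟨a, ?_⟩
  change G.rep Λ a x = y
  rw [ha]
  simp only [LinearMap.smul_apply, LinearMap.smulRight_apply, Finsupp.lapply_apply, smul_smul]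
  rw [inv_mul_cancel₀ hT, one_smul]

theorem Generic.shape_eq_of_equiv {Λ M : MPartition m n}
    (h : Nonempty (RepMod (G.rep Λ) ≃ₗ[Hecke n q v] RepMod (G.rep M))) : Λ = M := by
  obtain ⟨e⟩ := h
  by_contra hne
  obtain ⟨a, ha, ha'⟩ := G.exists_rep_eq (Λ := M) 1
  obtain ⟨T⟩ := (inferInstance : Nonempty (StdTableau M))
  set x : TableauSpace K Λ :=
    (RepMod.of (G.rep Λ)).symm (e.symm (RepMod.of (G.rep M) (Finsupp.single T 1))) with hx
  have h0 : e (RepMod.of (G.rep Λ) x) = RepMod.of (G.rep M) (Finsupp.single T 1) := by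
    rw [hx, AddEquiv.apply_symm_apply, LinearEquiv.apply_symm_apply]
  have h1 := congrArg (a • ·) h0
  rw [← map_smul, RepMod.smul_of, RepMod.smul_of, ha, ha' Λ hne, LinearMap.zero_apply, map_zero,
    map_zero, Module.End.one_apply, eq_comm, EmbeddingLike.map_eq_zero_iff] at h1
  simp at h1

/-- The elements of `H(m,1,n)` that send `T` to a given vector of `V_Λ` and all other tableaux to
zero. -/
noncomputable def Generic.column {Λ : MPartition m n} (T : StdTableau Λ) :
    TableauSpace K Λ →ₗ[K] Hecke n q v :=
  G.repEquiv.symm.toLinearMap ∘ₗ LinearMap.single K _ Λ ∘ₗ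
    LinearMap.smulRightₗ (Finsupp.lapply T)

theorem Generic.rep_column_self {Λ : MPartition m n} (T : StdTableau Λ) (w : TableauSpace K Λ) :
    G.rep Λ (G.column T w) = (Finsupp.lapply T).smulRight w := by
  refine (G.rep_repEquiv_symm _ Λ).trans ?_
  rw [LinearMap.comp_apply, LinearMap.single_apply, Pi.single_eq_same]
  rfl

theorem Generic.rep_column_of_ne {Λ : MPartition m n} (T : StdTableau Λ) (w : TableauSpace K Λ)
    {M : MPartition m n} (hM : M ≠ Λ) : G.rep M (G.column T w) = 0 := by
  refine (G.rep_repEquiv_symm _ M).trans ?_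
  rw [LinearMap.comp_apply, LinearMap.single_apply, Pi.single_eq_of_ne hM]

/-- This makes `column T` a homomorphism of left modules from V_Λ to the regular module. -/
theorem Generic.mul_column {Λ : MPartition m n} (T : StdTableau Λ) (a : Hecke n q v)
    (w : TableauSpace K Λ) : a * G.column T w = G.column T (G.rep Λ a w) := by
  refine G.ext fun M => ?_
  by_cases hM : M = Λ
  · subst hM
    rw [map_mul, G.rep_column_self, G.rep_column_self]
    refine LinearMap.ext fun x => ?_
    rw [Module.End.mul_apply, LinearMap.smulRight_apply, LinearMap.smulRight_apply, map_smul]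
  · rw [map_mul, G.rep_column_of_ne T _ hM, G.rep_column_of_ne T _ hM, mul_zero]

theorem Generic.sum_column : ∑ x : Tableau m n, G.column x.2 (Finsupp.single x.2 1) = 1 := by
  refine G.ext fun Λ => tableauSpace_hom_ext fun T hT => ?_
  rw [tabVec_of_isStandard hT, map_sum, LinearMap.sum_apply, map_one, Module.End.one_apply,
    Finset.sum_eq_single (⟨Λ, StdTableau.of hT⟩ : Tableau m n)]
  · rw [G.rep_column_self]
    simp
  · rintro ⟨M, R⟩ - hne
    by_cases hM : Λ = M
    · subst hM
      rw [G.rep_column_self, LinearMap.smulRight_apply, Finsupp.lapply_apply,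
        Finsupp.single_eq_of_ne, zero_smul]
      rintro rfl
      exact hne rfl
    · rw [G.rep_column_of_ne _ _ hM, LinearMap.zero_apply]
  · exact fun h => absurd (Finset.mem_univ _) h

/-- The diagonal matrix units sum to 1, so one of them does not kill a given nonzero x. Then w ↦
`column T w` · x is a nonzero homomorphism from V_Λ, and Schur's lemma makes it bijective. No
finiteness of the module is needed. -/
theorem Generic.exists_equiv_of_isSimpleModule {V : Type w} [AddCommGroup V] [Module K V]
    (θ : Hecke n q v →ₐ[K] Module.End K V) [IsSimpleModule (Hecke n q v) (RepMod θ)] :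
    ∃ Λ : MPartition m n, Nonempty (RepMod θ ≃ₗ[Hecke n q v] RepMod (G.rep Λ)) := by
  have hnt : Nontrivial V := IsSimpleModule.nontrivial (Hecke n q v) (RepMod θ)
  obtain ⟨x, hx⟩ := exists_ne (0 : V)
  have hex : ∃ y : Tableau m n, θ (G.column y.2 (Finsupp.single y.2 1)) x ≠ 0 := by
    by_contra! h
    refine hx ?_
    have h1 := congrArg (fun a => θ a x) G.sum_column
    simp only [map_sum, LinearMap.sum_apply, map_one, Module.End.one_apply] at h1
    rw [← h1]
    exact Finset.sum_eq_zero fun y _ => h y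
  obtain ⟨⟨Λ, T⟩, hT⟩ := hex
  refine ⟨Λ, ?_⟩
  have := G.isSimpleModule Λ
  let f : RepMod (G.rep Λ) →ₗ[Hecke n q v] RepMod θ :=
    RepMod.hom (G.rep Λ) θ ((LinearMap.applyₗ x) ∘ₗ θ.toLinearMap ∘ₗ G.column T)
      fun a w => by
        change θ (G.column T (G.rep Λ a w)) _ = θ a (θ (G.column T w) _)
        rw [← G.mul_column, map_mul, Module.End.mul_apply]
  have hf : f ≠ 0 := fun h => hT (DFunLike.congr_fun h (Finsupp.single T 1 : TableauSpace K Λ))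
  exact ⟨(LinearEquiv.ofBijective f (LinearMap.bijective_of_ne_zero hf)).symm⟩

end Irreducible

/-! ### Multiplicity-free direct sums. -/

section MultiplicityFree

variable {A M ι : Type*} [Ring A] [AddCommGroup M] [Module A M] [Finite ι]
  {N : ι → Type*} [∀ i, AddCommGroup (N i)] [∀ i, Module A (N i)] [∀ i, IsSimpleModule A (N i)]

theorem exists_isIrredDecomp_of_equiv (e : M ≃ₗ[A] DirectSum ι N) :
    ∃ (k : ℕ) (S : Fin k → Submodule A M), IsIrredDecomp A M S := by
  have : IsSemisimpleModule A (DirectSum ι N) :=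
    inferInstanceAs (IsSemisimpleModule A (Π₀ i, N i))
  have : Module.Finite A (DirectSum ι N) := inferInstanceAs (Module.Finite A (Π₀ i, N i))
  have : IsSemisimpleModule A M := .congr e
  have : Module.Finite A M := Module.Finite.equiv e.symm
  obtain ⟨s, h1, h2, h3⟩ := IsSemisimpleModule.exists_sSupIndep_sSup_simples_eq_top A M
  have h4 : iSupIndep fun x : s => (x : Submodule A M) := (sSupIndep_iff s).1 h1
  have hsimple : ∀ x : s, IsSimpleModule A (x : Submodule A M) := fun x => h3 x x.2
  have hfin : Finite s := WellFoundedGT.finite_of_iSupIndep h4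
    fun x => (Submodule.nontrivial_iff_ne_bot).1 (IsSimpleModule.nontrivial A _)
  refine ⟨Nat.card s, fun i => ((Finite.equivFin s).symm i : Submodule A M), ?_,
    fun i => hsimple _⟩
  refine DirectSum.isInternal_submodule_of_iSupIndep_of_iSup_eq_top
    (h4.comp (Finite.equivFin s).symm.injective) ?_
  rw [(Finite.equivFin s).symm.iSup_comp (g := fun x : s => (x : Submodule A M)), ← sSup_eq_iSup',
    h2]

/-- A finite direct sum of pairwise non-isomorphic irreducible modules is multiplicity-free. -/
theorem isMultiplicityFree_of_equiv (e : M ≃ₗ[A] DirectSum ι N)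
    (hN : ∀ i j, Nonempty (N i ≃ₗ[A] N j) → i = j) : IsMultiplicityFree A M := by
  refine ⟨exists_isIrredDecomp_of_equiv e, fun k S hS i j hij => ?_⟩
  obtain ⟨hint, hsimple⟩ := hS
  have := hsimple
  let p : ∀ t i, S t →ₗ[A] N i := fun t i => DirectSum.component A ι N i ∘ₗ e.toLinearMap ∘ₗ
    (S t).subtype
  have hp : ∀ t i, p t i ≠ 0 → Nonempty (S t ≃ₗ[A] N i) := fun t i h =>
    ⟨LinearEquiv.ofBijective _ (LinearMap.bijective_of_ne_zero h)⟩
  have hex : ∀ t, ∃ i, p t i ≠ 0 := by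
    intro t
    by_contra! h
    have hnt := IsSimpleModule.nontrivial A (S t)
    obtain ⟨x, hx⟩ := exists_ne (0 : S t)
    refine hx (Subtype.ext (e.injective ?_))
    rw [Submodule.coe_zero, map_zero]
    exact DFinsupp.ext fun i => DFunLike.congr_fun (h i) x
  obtain ⟨f⟩ := hij
  obtain ⟨a, ha⟩ := hex i
  obtain ⟨ea⟩ := hp i a ha
  -- A simple summand has a nonzero component only in the one `N a` isomorphic to it, and isomorphic
  -- summands share this `a`. Both map onto `N a`, so they have a nonzero vector in common, against
  -- directness of the sum.
  have hi : ∀ b, p i b ≠ 0 → b = a := fun b hb => by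
    obtain ⟨eb⟩ := hp i b hb
    exact hN b a ⟨eb.symm.trans ea⟩
  have hj : ∀ b, p j b ≠ 0 → b = a := fun b hb => by
    obtain ⟨eb⟩ := hp j b hb
    exact hN b a ⟨eb.symm.trans (f.symm.trans ea)⟩
  have hja : p j a ≠ 0 := by
    obtain ⟨b, hb⟩ := hex j
    rwa [← hj b hb]
  by_contra hne
  have hnt := IsSimpleModule.nontrivial A (N a)
  obtain ⟨y, hy⟩ := exists_ne (0 : N a)
  obtain ⟨x, hx⟩ := (LinearMap.bijective_of_ne_zero ha).2 y
  obtain ⟨z, hz⟩ := (LinearMap.bijective_of_ne_zero hja).2 y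
  have hxz : (x : M) = z := by
    refine e.injective (DFinsupp.ext fun b => ?_)
    by_cases hb : b = a
    · subst hb
      exact hx.trans hz.symm
    · have h1 : p i b = 0 := by_contra fun h => hb (hi b h)
      have h2 : p j b = 0 := by_contra fun h => hb (hj b h)
      exact (DFunLike.congr_fun h1 x).trans (DFunLike.congr_fun h2 z).symm
  have hdisj := hint.submodule_iSupIndep.pairwiseDisjoint hne
  have h0 : (x : M) = 0 := Submodule.disjoint_def.1 hdisj _ x.2 (hxz ▸ z.2)
  refine hy ?_
  rw [← hx, show x = 0 from Subtype.ext h0, map_zero]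

end MultiplicityFree

/-! ### The branching rule and injectivity of the inclusion. -/

section Branching

variable {K : Type u} [Field K] {m n : ℕ} {q : K} {v : Fin m → K}

/-- The standard tableau of shape `Λ` obtained by putting the largest number at `α`. -/
def extendTableau {Λ : MPartition m (n + 1)} (α : {α : MNode m // Λ.IsRemovable α})
    (S : StdTableau (Λ.remove α.1 α.2)) : StdTableau Λ :=
  (stdTableauEquiv Λ).symm ⟨α, S⟩

theorem extendTableau_castSucc {Λ : MPartition m (n + 1)}
    (α : {α : MNode m // Λ.IsRemovable α}) (S : StdTableau (Λ.remove α.1 α.2)) (i : Fin n) :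
    (extendTableau α S).fill i.castSucc = S.fill i :=
  Fin.snoc_castSucc (α := fun _ => MNode m) _ _ i

theorem extendTableau_last {Λ : MPartition m (n + 1)}
    (α : {α : MNode m // Λ.IsRemovable α}) (S : StdTableau (Λ.remove α.1 α.2)) :
    (extendTableau α S).fill (Fin.last n) = α.1 :=
  Fin.snoc_last (α := fun _ => MNode m) _ _

theorem exists_extendTableau {Λ : MPartition m (n + 1)} (T : StdTableau Λ) :
    ∃ α S, T = extendTableau α S :=
  ⟨_, _, ((stdTableauEquiv Λ).symm_apply_apply T).symm⟩

theorem extendTableau_inj {Λ : MPartition m (n + 1)}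
    (α : {α : MNode m // Λ.IsRemovable α}) {S S' : StdTableau (Λ.remove α.1 α.2)} :
    extendTableau α S = extendTableau α S' ↔ S = S' := by
  rw [extendTableau, extendTableau, EmbeddingLike.apply_eq_iff_eq]
  simp

/-- The embedding of `V_{Λ \ {α}}` into `V_Λ`. -/
noncomputable def branchMap {Λ : MPartition m (n + 1)} (α : {α : MNode m // Λ.IsRemovable α}) :
    TableauSpace K (Λ.remove α.1 α.2) →ₗ[K] TableauSpace K Λ :=
  Finsupp.lmapDomain K K (extendTableau α)

theorem branchMap_single {Λ : MPartition m (n + 1)} (α : {α : MNode m // Λ.IsRemovable α})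
    (S : StdTableau (Λ.remove α.1 α.2)) (a : K) :
    branchMap α (Finsupp.single S a) = Finsupp.single (extendTableau α S) a :=
  Finsupp.mapDomain_single

theorem branchMap_apply_self {Λ : MPartition m (n + 1)} (α : {α : MNode m // Λ.IsRemovable α})
    (w : TableauSpace K (Λ.remove α.1 α.2)) (S : StdTableau (Λ.remove α.1 α.2)) :
    branchMap α w (extendTableau α S) = w S :=
  Finsupp.mapDomain_apply (fun _ _ h => (extendTableau_inj α).1 h) w S

theorem branchMap_apply_of_ne {Λ : MPartition m (n + 1)} {α β : {α : MNode m // Λ.IsRemovable α}}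
    (h : α ≠ β) (w : TableauSpace K (Λ.remove α.1 α.2)) (S : StdTableau (Λ.remove β.1 β.2)) :
    branchMap α w (extendTableau β S) = 0 := by
  refine Finsupp.mapDomain_of_notMem_range w _ ?_
  rintro ⟨R, hR⟩
  have := congrArg (fun T => StdTableau.fill T (Fin.last n)) hR
  simp only [extendTableau_last] at this
  exact h (Subtype.ext this)

theorem branchMap_injective {Λ : MPartition m (n + 1)} (α : {α : MNode m // Λ.IsRemovable α}) :
    Function.Injective (branchMap (K := K) α) :=
  Finsupp.mapDomain_injective fun _ _ h => (extendTableau_inj α).1 h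

variable (G : Generic (n + 1) q v) (G' : Generic n q v)

/-- The embedding of `V_{Λ \ {α}}` into `V_Λ` commutes with the action of `H(m,1,n)`. -/
theorem branchMap_rep {Λ : MPartition m (n + 1)} (α : {α : MNode m // Λ.IsRemovable α})
    (a : Hecke n q v) (w : TableauSpace K (Λ.remove α.1 α.2)) :
    branchMap α (G'.rep (Λ.remove α.1 α.2) a w) = G.rep Λ (incl n q v a) (branchMap α w) := by
  refine Hecke.intertwines _ ((G.rep Λ).comp (incl n q v)) (branchMap α) ?_ ?_ a w
  · intro h w
    rw [AlgHom.comp_apply, incl_tau, G.rep_tau, G'.rep_tau, ← LinearMap.comp_apply,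
      ← LinearMap.comp_apply]
    refine LinearMap.congr_fun (tableauSpace_hom_ext fun T hT => ?_) w
    rw [LinearMap.comp_apply, LinearMap.comp_apply, contentOp_tabVec hT, map_smul,
      tabVec_of_isStandard hT, branchMap_single, ← tabVec_fill,
      contentOp_tabVec (StdTableau.isStandard _)]
    exact congrArg (content q v · • _)
      (extendTableau_castSucc α (StdTableau.of hT) ⟨0, h⟩).symm
  · intro i h w
    rw [AlgHom.comp_apply, incl_sigma, G.rep_sigma, G'.rep_sigma, ← LinearMap.comp_apply,
      ← LinearMap.comp_apply]
    refine LinearMap.congr_fun (tableauSpace_hom_ext fun T hT => ?_) w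
    have e0 : (extendTableau α (StdTableau.of hT)).fill ⟨i, by omega⟩ = T ⟨i, by omega⟩ :=
      extendTableau_castSucc α (StdTableau.of hT) ⟨i, by omega⟩
    have e1 : (extendTableau α (StdTableau.of hT)).fill ⟨i + 1, by omega⟩ = T ⟨i + 1, h⟩ :=
      extendTableau_castSucc α (StdTableau.of hT) ⟨i + 1, h⟩
    rw [LinearMap.comp_apply, LinearMap.comp_apply, sigmaOp_tabVec hT, map_add, map_smul, map_smul,
      tabVec_of_isStandard hT, branchMap_single, ← tabVec_fill,
      sigmaOp_tabVec (StdTableau.isStandard _), e0, e1]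
    congr 1
    by_cases hl : MNode.InLine (T ⟨i, by omega⟩) (T ⟨i + 1, h⟩)
    · rw [offCoef_of_inLine hl, zero_smul, zero_smul]
    · rw [tabVec_of_isStandard (hT.swap h hl), branchMap_single, ← tabVec_fill]
      congr 2
      funext j
      -- The generators of the smaller algebra never move the largest entry, so exchange and
      -- extension commute.
      induction j using Fin.lastCases with
      | last =>
        rw [extendTableau_last, Function.comp_apply,
          swapSucc_apply_of_ne _ _ _ (by simp; omega) (by simp; omega), extendTableau_last]
      | cast j =>
        have hs : swapSucc i (by omega) j.castSucc = (swapSucc i h j).castSucc := by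
          by_cases h1 : (j : ℕ) = i
          · have e : j = ⟨i, by omega⟩ := Fin.ext h1
            rw [e, swapSucc_apply_left]
            exact swapSucc_apply_left i _
          by_cases h2 : (j : ℕ) = i + 1
          · have e : j = ⟨i + 1, h⟩ := Fin.ext h2
            rw [e, swapSucc_apply_right]
            exact swapSucc_apply_right i _
          rw [swapSucc_apply_of_ne i h j h1 h2, swapSucc_apply_of_ne i _ j.castSucc h1 h2]
        rw [extendTableau_castSucc, Function.comp_apply, hs, extendTableau_castSucc]
        rfl

/-- The map from the direct sum of the `V_{Λ \ {α}}` to `V_Λ`. -/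
noncomputable def branchSum (Λ : MPartition m (n + 1)) :
    (DirectSum {α : MNode m // Λ.IsRemovable α} fun α => RepMod (G'.rep (Λ.remove α.1 α.2)))
      →ₗ[Hecke n q v] RepMod ((G.rep Λ).comp (incl n q v)) :=
  DirectSum.toModule _ _ _ fun α =>
    RepMod.hom (G'.rep (Λ.remove α.1 α.2)) ((G.rep Λ).comp (incl n q v)) (branchMap α)
      (branchMap_rep G G' α)

theorem branchSum_of {Λ : MPartition m (n + 1)} (α : {α : MNode m // Λ.IsRemovable α})
    (y : TableauSpace K (Λ.remove α.1 α.2)) :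
    branchSum G G' Λ (DirectSum.of (fun α : {α : MNode m // Λ.IsRemovable α} =>
      RepMod (G'.rep (Λ.remove α.1 α.2))) α (RepMod.of _ y)) = RepMod.of _ (branchMap α y) :=
  DirectSum.toModule_lof (Hecke n q v) (φ := fun α =>
    RepMod.hom (G'.rep (Λ.remove α.1 α.2)) ((G.rep Λ).comp (incl n q v)) (branchMap α)
      (branchMap_rep G G' α)) α (RepMod.of _ y)

/-- The coefficient of an element of the module of a representation at a standard tableau. -/
noncomputable def RepMod.coeff {A : Type*} [Ring A] [Algebra K A] {Λ : MPartition m n}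
    (ρ : A →ₐ[K] Module.End K (TableauSpace K Λ)) (T : StdTableau Λ) : RepMod ρ →+ K :=
  (Finsupp.applyAddHom T).comp (RepMod.of ρ).symm.toAddMonoidHom

theorem RepMod.coeff_of {A : Type*} [Ring A] [Algebra K A] {Λ : MPartition m n}
    (ρ : A →ₐ[K] Module.End K (TableauSpace K Λ)) (T : StdTableau Λ) (w : TableauSpace K Λ) :
    RepMod.coeff ρ T (RepMod.of ρ w) = w T := rfl

/-- Every tableau extends exactly one smaller tableau at exactly one node, so coefficients are
preserved one by one; injectivity follows. -/
theorem branchSum_apply {Λ : MPartition m (n + 1)}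
    (x : DirectSum {α : MNode m // Λ.IsRemovable α} fun α => RepMod (G'.rep (Λ.remove α.1 α.2)))
    (α : {α : MNode m // Λ.IsRemovable α}) (S : StdTableau (Λ.remove α.1 α.2)) :
    RepMod.coeff _ (extendTableau α S) (branchSum G G' Λ x) = RepMod.coeff _ S (x α) := by
  induction x using DirectSum.induction_on with
  | zero => rw [map_zero, map_zero, DirectSum.zero_apply, map_zero]
  | of β y =>
    obtain ⟨y, rfl⟩ := (RepMod.of _).surjective y
    rw [branchSum_of, RepMod.coeff_of]
    by_cases h : β = α
    · subst h
      rw [branchMap_apply_self, DirectSum.of_eq_same, RepMod.coeff_of]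
    · rw [branchMap_apply_of_ne h, DirectSum.of_eq_of_ne _ _ _ (Ne.symm h), map_zero]
  | add x y hx hy =>
    rw [map_add, map_add, hx, hy, DirectSum.add_apply, map_add]

theorem branchSum_bijective (Λ : MPartition m (n + 1)) :
    Function.Bijective (branchSum G G' Λ) := by
  constructor
  · rw [injective_iff_map_eq_zero]
    intro x hx
    refine DFinsupp.ext fun α => (RepMod.of (G'.rep (Λ.remove α.1 α.2))).symm.injective
      (Finsupp.ext fun S => ?_)
    have := branchSum_apply G G' x α S
    rw [hx, map_zero] at this
    exact this.symm
  · suffices ∀ w : TableauSpace K Λ, ∃ x, branchSum G G' Λ x = RepMod.of _ w from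
      fun y => this ((RepMod.of _).symm y)
    intro w
    induction w using Finsupp.induction_linear with
    | zero => exact ⟨0, by rw [map_zero, map_zero]⟩
    | add w z hw hz =>
      obtain ⟨x, hx⟩ := hw
      obtain ⟨y, hy⟩ := hz
      exact ⟨x + y, by rw [map_add, map_add, hx, hy]⟩
    | single T a =>
      obtain ⟨α, S, rfl⟩ := exists_extendTableau T
      exact ⟨_, (branchSum_of G G' α (Finsupp.single S a)).trans
        (congrArg (RepMod.of _) (branchMap_single α S a))⟩

/-- The branching rule. -/
noncomputable def branchEquiv (Λ : MPartition m (n + 1)) :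
    RepMod ((G.rep Λ).comp (incl n q v)) ≃ₗ[Hecke n q v]
      DirectSum {α : MNode m // Λ.IsRemovable α} fun α => RepMod (G'.rep (Λ.remove α.1 α.2)) :=
  (LinearEquiv.ofBijective (branchSum G G' Λ) (branchSum_bijective G G' Λ)).symm

theorem MPartition.remove_injective {Λ : MPartition m (n + 1)}
    {α β : {α : MNode m // Λ.IsRemovable α}}
    (h : Λ.remove α.1 α.2 = Λ.remove β.1 β.2) : α = β := by
  have h1 : β.1 ∈ Λ.nodes := MPartition.mem_nodes.2 β.2.1
  have h2 := congrArg MPartition.nodes h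
  rw [MPartition.nodes_remove, MPartition.nodes_remove] at h2
  by_contra hne
  have h3 : β.1 ∈ Λ.nodes.erase α.1 := Finset.mem_erase.2 ⟨fun e => hne (Subtype.ext e.symm), h1⟩
  rw [h2] at h3
  exact Finset.notMem_erase _ _ h3

/-- There are at least m addable nodes, hence at least one. -/
theorem MPartition.exists_remove_eq (hm : 1 ≤ m) (Λ : MPartition m n) :
    ∃ (M : MPartition m (n + 1)) (α : {α : MNode m // M.IsRemovable α}),
      M.remove α.1 α.2 = Λ := by
  have h1 := card_removableNodes_add_le Λ.isLow_nodes Λ.card_nodes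
  obtain ⟨α, hα⟩ := Finset.card_pos.1 (show 0 < (addableNodes n Λ.nodes).card by omega)
  obtain ⟨h2, h3⟩ := (mem_addableNodes Λ.card_nodes).1 hα
  have h4 : (insert α Λ.nodes).card = n + 1 := by
    rw [Finset.card_insert_of_notMem h2, Λ.card_nodes]
  have h5 := MPartition.nodes_ofNodes (insert α Λ.nodes) h3 h4
  have h6 : (MPartition.ofNodes (insert α Λ.nodes) h3 h4).IsRemovable α := by
    rw [MPartition.isRemovable_iff, h5, mem_removableNodes, Finset.erase_insert h2]
    exact ⟨Finset.mem_insert_self _ _, Λ.isLow_nodes⟩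
  refine ⟨_, ⟨α, h6⟩, MPartition.nodes_injective ?_⟩
  rw [MPartition.nodes_remove, h5, Finset.erase_insert h2]

-- An element of the kernel acts by zero on every V_M, hence on every V_{M∖α}. All shapes of the
-- smaller size are of this form, and the representations are jointly faithful.
include G in
theorem incl_injective (hm : 1 ≤ m) : Function.Injective (incl n q v) := by
  rw [injective_iff_map_eq_zero]
  intro x hx
  have G' : Generic n q v := G.mono n.le_succ
  refine G'.ext fun Λ => ?_
  obtain ⟨M, α, rfl⟩ := MPartition.exists_remove_eq hm Λ
  refine LinearMap.ext fun w => branchMap_injective α ?_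
  rw [branchMap_rep G G', hx, map_zero, map_zero, LinearMap.zero_apply, LinearMap.zero_apply,
    map_zero]

include G in
theorem isMultiplicityFree_restriction {V : Type w} [AddCommGroup V] [Module K V]
    (θ : Hecke (n + 1) q v →ₐ[K] Module.End K V)
    [IsSimpleModule (Hecke (n + 1) q v) (RepMod θ)] :
    IsMultiplicityFree (Hecke n q v) (RepMod (θ.comp (incl n q v))) := by
  have G' : Generic n q v := G.mono n.le_succ
  obtain ⟨Λ, ⟨e⟩⟩ := G.exists_equiv_of_isSimpleModule θ
  let e' : RepMod (θ.comp (incl n q v)) ≃ₗ[Hecke n q v] RepMod ((G.rep Λ).comp (incl n q v)) :=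
    { toFun := e
      invFun := e.symm
      left_inv := e.left_inv
      right_inv := e.right_inv
      map_add' := e.map_add
      map_smul' := fun a x => e.map_smul (incl n q v a) x }
  have := fun α : {α : MNode m // Λ.IsRemovable α} => G'.isSimpleModule (Λ.remove α.1 α.2)
  exact isMultiplicityFree_of_equiv (e'.trans (branchEquiv G G' Λ)) fun α β h =>
    MPartition.remove_injective (G'.shape_eq_of_equiv h)

end Branching

/-! ### The centralizer and the Jucys-Murphy subalgebra. -/

section Centralizer

variable {K : Type u} [Field K] {m n : ℕ} {q : K} {v : Fin m → K}

theorem contentOp_apply {Λ : MPartition m n} (j : Fin n) (w : TableauSpace K Λ)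
    (R : StdTableau Λ) : contentOp q v Λ j w R = content q v (R.fill j) * w R := by
  induction w using Finsupp.induction_linear with
  | zero => simp
  | add w z hw hz => rw [map_add, Finsupp.add_apply, hw, hz, Finsupp.add_apply, mul_add]
  | single T a =>
    rw [show Finsupp.single T a = a • tabVec K Λ T.fill by
      rw [tabVec_fill, Finsupp.smul_single, smul_eq_mul, mul_one], map_smul,
      contentOp_tabVec T.isStandard, tabVec_fill]
    by_cases h : R = T
    · subst h
      simp [mul_comm]
    · simp [Finsupp.single_eq_of_ne h]

/-- The diagonal coefficients of the action of `x`. -/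
noncomputable def Generic.diagonalCoeff (G : Generic n q v) (x : Hecke n q v) :
    Tableau m n → K := fun y => G.rep y.1 x (Finsupp.single y.2 1) y.2

/-- Commuting with the J_j preserves their joint eigenspaces; when the contents indexed by `P`
separate the tableaux of each shape, these are lines. Separation between different shapes is not
required. -/
theorem Generic.actsBy_of_commute (G : Generic n q v) {x : Hecke n q v} {P : Set (Fin n)}
    (hx : ∀ j ∈ P, x * JM q v j j.2 = JM q v j j.2 * x)
    (hsep : ∀ (Λ : MPartition m n) (R T : StdTableau Λ),
      (∀ j ∈ P, content q v (R.fill j) = content q v (T.fill j)) → R = T) :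
    G.ActsBy x (G.diagonalCoeff x) := by
  intro Λ T
  refine Finsupp.ext fun R => ?_
  by_cases h : R = T
  · subst h
    simp [diagonalCoeff]
  · obtain ⟨j, hj, hne⟩ : ∃ j ∈ P, content q v (R.fill j) ≠ content q v (T.fill j) := by
      by_contra! h'
      exact h (hsep Λ R T h')
    have h1 := congrArg (fun f => f (Finsupp.single T 1) R) (congrArg (G.rep Λ) (hx j hj))
    simp only [map_mul, Module.End.mul_apply, G.rep_JM, contentOp_apply] at h1
    rw [← tabVec_fill, contentOp_tabVec T.isStandard, map_smul, Finsupp.smul_apply, smul_eq_mul,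
      tabVec_fill] at h1
    have h2 : G.rep Λ x (Finsupp.single T 1) R = 0 := by
      by_contra h0
      exact hne (mul_right_cancel₀ h0 h1).symm
    rw [h2, Finsupp.smul_apply, Finsupp.single_eq_of_ne h, smul_zero]

/-- Anything that commutes with all J_i acts diagonally, and every diagonal action already comes
from a polynomial in the J_i. -/
theorem Generic.maximal_jmAlgebra (G : Generic n q v) :
    Maximal (fun B : Subalgebra K (Hecke n q v) => ∀ x ∈ B, ∀ y ∈ B, x * y = y * x)
      (jmAlgebra n q v) := by
  refine ⟨fun x hx y hy => ?_, fun B hB hle x hx => ?_⟩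
  · obtain ⟨c, hc⟩ := G.exists_actsBy_of_mem hx
    obtain ⟨d, hd⟩ := G.exists_actsBy_of_mem hy
    exact hc.mul_comm hd
  · have h1 : G.ActsBy x (G.diagonalCoeff x) := by
      refine G.actsBy_of_commute (P := Set.univ)
        (fun j _ => hB x hx _ (hle (Algebra.subset_adjoin ⟨j, rfl⟩))) fun Λ R T h => ?_
      exact StdTableau.ext (G.eq_of_contents_eq R.isStandard T.isStandard fun i => h i trivial)
    obtain ⟨y, hy, hy'⟩ := G.exists_actsBy (G.diagonalCoeff x)
    rwa [h1.eq hy']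

theorem incl_JM (i : ℕ) (h : i < n) : incl n q v (JM q v i h) = JM q v i (by omega) := by
  induction i with
  | zero => exact incl_tau q v h
  | succ i ih => rw [JM, map_mul, map_mul, ih, incl_sigma, JM]

theorem Generic.ActsBy.sum {G : Generic n q v} {ι : Type*} (s : Finset ι) {x : ι → Hecke n q v}
    {c : ι → Tableau m n → K} (h : ∀ i ∈ s, G.ActsBy (x i) (c i)) :
    G.ActsBy (∑ i ∈ s, x i) (∑ i ∈ s, c i) := fun Λ T => by
  rw [map_sum, LinearMap.sum_apply, Finset.sum_apply, Finset.sum_smul]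
  exact Finset.sum_congr rfl fun i hi => h i hi Λ T

theorem Generic.ActsBy.aeval {G : Generic n q v} {x : Hecke n q v} {c : Tableau m n → K}
    (h : G.ActsBy x c) (P : Polynomial K) :
    G.ActsBy (Polynomial.aeval x P) fun y => P.eval (c y) := fun Λ T => by
  have h1 : (G.rep Λ x).HasEigenvector (c ⟨Λ, T⟩) (Finsupp.single T 1) :=
    ⟨Module.End.mem_eigenspace_iff.2 (h Λ T), by simp⟩
  rw [← Polynomial.aeval_algHom_apply, Module.End.aeval_apply_of_hasEigenvector h1]

/-- Interpolation of a function that is constant on the fibres of `f`. -/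
theorem exists_polynomial_eval_eq {ι : Type*} [Finite ι] (f c : ι → K)
    (h : ∀ i j, f i = f j → c i = c j) : ∃ P : Polynomial K, ∀ i, P.eval (f i) = c i := by
  classical
  cases nonempty_fintype ι
  refine ⟨Lagrange.interpolate (Finset.univ.image f) id (Function.extend f c 0), fun i => ?_⟩
  have h1 := Lagrange.eval_interpolate_at_node (v := id) (Function.extend f c 0)
    (Set.injOn_id _) (Finset.mem_image_of_mem f (Finset.mem_univ i))
  have h2 : Function.FactorsThrough c f := fun i j hij => h i j hij
  rw [id, h2.extend_apply] at h1
  exact h1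

/-- The shape of a standard tableau without its largest entry. -/
def subShape (x : Tableau m (n + 1)) : MPartition m n :=
  x.1.remove _ (stdTableauEquiv x.1 x.2).1.2

theorem subShape_extendTableau {Λ : MPartition m (n + 1)}
    (α : {α : MNode m // Λ.IsRemovable α}) (S : StdTableau (Λ.remove α.1 α.2)) :
    subShape ⟨Λ, extendTableau α S⟩ = Λ.remove α.1 α.2 := by
  have h : (stdTableauEquiv Λ (extendTableau α S)).1 = α := by
    rw [extendTableau, Equiv.apply_symm_apply]
  have key : ∀ β : {α : MNode m // Λ.IsRemovable α}, β = α →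
      Λ.remove β.1 β.2 = Λ.remove α.1 α.2 := by
    rintro _ rfl
    rfl
  exact key _ h

variable (G : Generic (n + 1) q v) (G' : Generic n q v)
include G G'

theorem actsBy_incl_of_scalar {x : Hecke n q v} {c : MPartition m n → K}
    (hx : ∀ Λ, G'.rep Λ x = c Λ • 1) : G.ActsBy (incl n q v x) fun y => c (subShape y) := by
  intro Λ T
  obtain ⟨α, S, rfl⟩ := exists_extendTableau T
  change _ = c (subShape ⟨Λ, extendTableau α S⟩) • _
  rw [subShape_extendTableau, ← branchMap_single, ← branchMap_rep G G', hx, LinearMap.smul_apply,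
    Module.End.one_apply, map_smul]

/-- The elements J_1, …, J_n of the smaller algebra suffice for separation: they determine the
tableau below the largest entry, and within a fixed shape the last node is then the only one left.
-/
theorem actsBy_of_mem_centralizer {x : Hecke (n + 1) q v}
    (hx : x ∈ Subalgebra.centralizer K ((incl n q v).range : Set (Hecke (n + 1) q v))) :
    G.ActsBy x (G.diagonalCoeff x) := by
  refine G.actsBy_of_commute (P := Set.range Fin.castSucc) ?_ ?_
  · rintro _ ⟨j, rfl⟩
    have : incl n q v (JM q v j j.2) * x = x * incl n q v (JM q v j j.2) :=
      (Subalgebra.mem_centralizer_iff K).1 hx _ ⟨JM q v j j.2, rfl⟩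
    rw [incl_JM] at this
    exact this.symm
  · intro Λ R T h
    obtain ⟨α, S, rfl⟩ := exists_extendTableau R
    obtain ⟨β, S', rfl⟩ := exists_extendTableau T
    have h1 : S.fill = S'.fill := by
      refine G'.eq_of_contents_eq S.isStandard S'.isStandard fun i => ?_
      simpa only [extendTableau_castSucc] using h _ ⟨i, rfl⟩
    have h2 := S.isStandard.shape_unique (h1 ▸ S'.isStandard)
    obtain rfl := MPartition.remove_injective h2
    rw [StdTableau.ext h1]

theorem centralizer_commutative {x y : Hecke (n + 1) q v}
    (hx : x ∈ Subalgebra.centralizer K ((incl n q v).range : Set (Hecke (n + 1) q v)))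
    (hy : y ∈ Subalgebra.centralizer K ((incl n q v).range : Set (Hecke (n + 1) q v))) :
    x * y = y * x :=
  (actsBy_of_mem_centralizer G G' hx).mul_comm (actsBy_of_mem_centralizer G G' hy)

/-- The eigenvalue of an element of the centralizer depends only on the largest entry and on the
shape of the remaining tableau. -/
theorem diagonalCoeff_congr {x : Hecke (n + 1) q v}
    (hx : x ∈ Subalgebra.centralizer K ((incl n q v).range : Set (Hecke (n + 1) q v)))
    {y z : Tableau m (n + 1)} (h1 : subShape y = subShape z)
    (h2 : content q v (y.2.fill (Fin.last n)) = content q v (z.2.fill (Fin.last n))) :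
    G.diagonalCoeff x y = G.diagonalCoeff x z := by
  have hdiag := actsBy_of_mem_centralizer G G' hx
  obtain ⟨Λ, T⟩ := y
  obtain ⟨M, R⟩ := z
  obtain ⟨α, S, rfl⟩ := exists_extendTableau T
  obtain ⟨β, R, rfl⟩ := exists_extendTableau R
  rw [subShape_extendTableau, subShape_extendTableau] at h1
  have hS' : IsStandard (Λ.remove α.1 α.2) R.fill := by
    rw [h1]
    exact R.isStandard
  -- The lower tableau of the second argument, extended by the node α, has the same contents as the
  -- second argument and so coincides with it. Both tableaux now lie over the same α.
  have e1 : (⟨Λ, extendTableau α (StdTableau.of hS')⟩ : Tableau m (n + 1)) =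
      ⟨M, extendTableau β R⟩ := by
    refine G.tableau_ext fun i => ?_
    induction i using Fin.lastCases with
    | last => simpa only [extendTableau_last] using h2
    | cast i => simp only [extendTableau_castSucc, StdTableau.fill_of]
  rw [← e1]
  generalize StdTableau.of hS' = S'
  -- A matrix unit of the smaller algebra carries one lower tableau to the other; commuting with it
  -- forces equal eigenvalues.
  set a := G'.column S (Finsupp.single S' 1)
  have ha : G.rep Λ (incl n q v a) (Finsupp.single (extendTableau α S) 1) =
      Finsupp.single (extendTableau α S') 1 := by
    rw [← branchMap_single, ← branchMap_rep G G', G'.rep_column_self, ← branchMap_single]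
    simp
  have h3 : incl n q v a * x = x * incl n q v a :=
    (Subalgebra.mem_centralizer_iff K).1 hx _ ⟨a, rfl⟩
  have h4 := congrArg (fun f => f (Finsupp.single (extendTableau α S) 1) (extendTableau α S'))
    (congrArg (G.rep Λ) h3)
  simp only [map_mul, Module.End.mul_apply] at h4
  rw [hdiag, map_smul, ha, hdiag] at h4
  simpa using h4

/-- With z_μ the central idempotent of H(m,1,n) for the shape μ, and P_μ a polynomial interpolating
the eigenvalues of x in terms of the last content over the tableaux with lower shape μ, one has x =
Σ_μ z_μ P_μ(J_{n+1}): both sides are diagonal with the same eigenvalues. -/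
theorem mem_adjoin_of_mem_centralizer {x : Hecke (n + 1) q v}
    (hx : x ∈ Subalgebra.centralizer K ((incl n q v).range : Set (Hecke (n + 1) q v))) :
    x ∈ Algebra.adjoin K
        (incl n q v '' (Subalgebra.center K (Hecke n q v) : Set (Hecke n q v)) ∪
          {JM q v n (Nat.lt_succ_self n)}) := by
  have hpoly : ∀ μ : MPartition m n, ∃ P : Polynomial K, ∀ y : {y : Tableau m (n + 1) //
      subShape y = μ}, P.eval (content q v (y.1.2.fill (Fin.last n))) = G.diagonalCoeff x y.1 :=
    fun μ => exists_polynomial_eval_eq _ _ fun y z h =>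
      diagonalCoeff_congr G G' hx (y.2.trans z.2.symm) h
  choose P hP using hpoly
  set z : MPartition m n → Hecke n q v := fun μ => G'.repEquiv.symm (Pi.single μ 1) with hz
  have hz1 : ∀ μ Λ, G'.rep Λ (z μ) = (if Λ = μ then (1 : K) else 0) • 1 := by
    intro μ Λ
    rw [hz, G'.rep_repEquiv_symm]
    split_ifs with h
    · rw [h, Pi.single_eq_same, one_smul]
    · rw [Pi.single_eq_of_ne h, zero_smul]
  have hz2 : ∀ μ, z μ ∈ Subalgebra.center K (Hecke n q v) := by
    intro μ
    rw [Subalgebra.mem_center_iff]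
    intro b
    refine G'.ext fun Λ => ?_
    rw [map_mul, map_mul, hz1, mul_smul_comm, smul_mul_assoc, one_mul, mul_one]
  have hJ : G.ActsBy (JM q v n (Nat.lt_succ_self n))
      fun y => content q v (y.2.fill (Fin.last n)) := G.actsBy_JM (Fin.last n)
  have hw := Generic.ActsBy.sum Finset.univ fun μ (_ : μ ∈ Finset.univ) =>
    (actsBy_incl_of_scalar G G' (hz1 μ)).mul (hJ.aeval (P μ))
  have e : G.diagonalCoeff x = ∑ μ : MPartition m n,
      (fun y => if subShape y = μ then (1 : K) else 0) *
        fun y => (P μ).eval (content q v (y.2.fill (Fin.last n))) := by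
    funext y
    rw [Finset.sum_apply, Finset.sum_eq_single (subShape y)]
    · rw [Pi.mul_apply, if_pos rfl, one_mul]
      exact (hP (subShape y) ⟨y, rfl⟩).symm
    · intro μ _ hμ
      rw [Pi.mul_apply, if_neg hμ.symm, zero_mul]
    · exact fun h => absurd (Finset.mem_univ _) h
  rw [← e] at hw
  rw [(actsBy_of_mem_centralizer G G' hx).eq hw]
  refine sum_mem fun μ _ => mul_mem ?_ ?_
  · exact Algebra.subset_adjoin (Or.inl ⟨z μ, hz2 μ, rfl⟩)
  · exact Algebra.adjoin_mono (Set.subset_union_right) (Polynomial.aeval_mem_adjoin_singleton K _)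

omit G' in
theorem JM_mem_centralizer : JM q v n (Nat.lt_succ_self n) ∈
    Subalgebra.centralizer K ((incl n q v).range : Set (Hecke (n + 1) q v)) := by
  rw [Subalgebra.mem_centralizer_iff]
  rintro _ ⟨a, rfl⟩
  change incl n q v a * _ = _ * incl n q v a
  refine G.ext fun Λ => LinearMap.ext fun w => ?_
  rw [map_mul, map_mul, G.rep_JM]
  refine (Hecke.intertwines ((G.rep Λ).comp (incl n q v)) ((G.rep Λ).comp (incl n q v))
    (contentOp q v Λ ⟨n, Nat.lt_succ_self n⟩) ?_ ?_ a w).symm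
  · intro h w
    rw [AlgHom.comp_apply, incl_tau, G.rep_tau, ← Module.End.mul_apply, contentOp_comm]
    rfl
  · intro i h w
    rw [AlgHom.comp_apply, incl_sigma, G.rep_sigma, ← Module.End.mul_apply,
      contentOp_comm_sigmaOp _ _ _ (by simp; omega) (by simp; omega)]
    rfl

theorem centralizer_eq_adjoin :
    Subalgebra.centralizer K ((incl n q v).range : Set (Hecke (n + 1) q v)) =
      Algebra.adjoin K
        (incl n q v '' (Subalgebra.center K (Hecke n q v) : Set (Hecke n q v)) ∪
          {JM q v n (Nat.lt_succ_self n)}) := by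
  refine le_antisymm (fun x hx => mem_adjoin_of_mem_centralizer G G' hx)
    (Algebra.adjoin_le ?_)
  rintro _ (⟨z, hz, rfl⟩ | rfl)
  · rw [SetLike.mem_coe, Subalgebra.mem_centralizer_iff]
    rintro _ ⟨a, rfl⟩
    change incl n q v a * incl n q v z = incl n q v z * incl n q v a
    rw [← map_mul, ← map_mul, Subalgebra.mem_center_iff.1 hz a]
  · exact JM_mem_centralizer G

end Centralizer

/-! ### Translation of the assumptions and the main theorem. -/

theorem generic_of_assumptions {K : Type u} [Field K] {m n : ℕ} {q : K} {v : Fin m → K}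
    (hq : q ≠ 0) (hq2 : q ^ 2 ≠ 1)
    (h1 : ∀ N : ℕ, N < n + 1 → ∑ i ∈ Finset.range (N + 1), q ^ (2 * i) ≠ 0)
    (h2 : ∀ (i : ℤ) (j k : Fin m), j ≠ k → -((n : ℤ) + 1) < i → i < (n : ℤ) + 1 →
      q ^ (2 * i) * v j - v k ≠ 0)
    (h3 : ∀ j, v j ≠ 0) : Generic (n + 1) q v where
  q_ne := hq
  pow_ne d hd hdn h := by
    obtain ⟨N, rfl⟩ : ∃ N, d = N + 1 := ⟨d - 1, by omega⟩
    refine h1 N (by omega) ?_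
    simp_rw [pow_mul] at h ⊢
    -- If q^{2(N+1)} = 1, the geometric sum up to N vanishes because q² ≠ 1.
    rw [geom_sum_eq hq2, h, sub_self, zero_div]
  sep i j k hjk hi := by
    obtain ⟨hi1, hi2⟩ := abs_lt.1 hi
    push_cast at hi1 hi2
    exact sub_ne_zero.1 (h2 i j k hjk hi1 hi2)
  v_ne := h3

end CyclotomicHecke

theorem mainTheorem8 {K : Type u} [Field K] {m : ℕ} (hm : 1 ≤ m) (n : ℕ)
    (q : K) (hq : q ≠ 0) (hq2 : q ^ 2 ≠ 1) (v : Fin m → K)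
    (h1 : ∀ N : ℕ, N < n + 1 → ∑ i ∈ Finset.range (N + 1), q ^ (2 * i) ≠ 0)
    (h2 : ∀ (i : ℤ) (j k : Fin m), j ≠ k → -((n : ℤ) + 1) < i → i < (n : ℤ) + 1 →
      q ^ (2 * i) * v j - v k ≠ 0)
    (h3 : ∀ j, v j ≠ 0) :
    -- `H(m,1,n)` is a subalgebra of `H(m,1,n+1)`
    Function.Injective (incl n q v) ∧
    -- at every level `k ≤ n + 1` the `V_Λ` are the irreducible representations
    (∀ k : ℕ, k ≤ n + 1 →
      (∀ Λ : MPartition m k,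
        ∃! ρ : Hecke k q v →ₐ[K] Module.End K (TableauSpace K Λ), IsSeminormal Λ ρ) ∧
      (∀ (Λ : MPartition m k) (ρ : Hecke k q v →ₐ[K] Module.End K (TableauSpace K Λ)),
        IsSeminormal Λ ρ → IsSimpleModule (Hecke k q v) (RepMod ρ)) ∧
      (∀ (Λ M : MPartition m k) (ρ : Hecke k q v →ₐ[K] Module.End K (TableauSpace K Λ))
        (ρ' : Hecke k q v →ₐ[K] Module.End K (TableauSpace K M)),
        IsSeminormal Λ ρ → IsSeminormal M ρ' →
          Nonempty (RepMod ρ ≃ₗ[Hecke k q v] RepMod ρ') → Λ = M) ∧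
      (∀ (V : Type w) [AddCommGroup V] [Module K V] (θ : Hecke k q v →ₐ[K] Module.End K V),
        IsSimpleModule (Hecke k q v) (RepMod θ) →
          ∃ (Λ : MPartition m k) (ρ : Hecke k q v →ₐ[K] Module.End K (TableauSpace K Λ)),
            IsSeminormal Λ ρ ∧ Nonempty (RepMod θ ≃ₗ[Hecke k q v] RepMod ρ))) ∧
    -- the branching rule for `V_Λ`
    (∀ (Λ : MPartition m (n + 1))
      (ρ : Hecke (n + 1) q v →ₐ[K] Module.End K (TableauSpace K Λ))
      (ρ' : ∀ α : {α : MNode m // Λ.IsRemovable α},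
        Hecke n q v →ₐ[K] Module.End K (TableauSpace K (Λ.remove α.1 α.2))),
      IsSeminormal Λ ρ → (∀ α, IsSeminormal (Λ.remove α.1 α.2) (ρ' α)) →
        Nonempty (RepMod (ρ.comp (incl n q v)) ≃ₗ[Hecke n q v]
          DirectSum {α : MNode m // Λ.IsRemovable α} fun α => RepMod (ρ' α))) ∧
    -- every irreducible representation has a multiplicity-free restriction
    (∀ (V : Type w) [AddCommGroup V] [Module K V]
      (θ : Hecke (n + 1) q v →ₐ[K] Module.End K V),
      IsSimpleModule (Hecke (n + 1) q v) (RepMod θ) →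
        IsMultiplicityFree (Hecke n q v) (RepMod (θ.comp (incl n q v)))) ∧
    -- the centralizer of `H(m,1,n)` in `H(m,1,n+1)` is commutative
    (∀ x ∈ Subalgebra.centralizer K ((incl n q v).range : Set (Hecke (n + 1) q v)),
      ∀ y ∈ Subalgebra.centralizer K ((incl n q v).range : Set (Hecke (n + 1) q v)),
        x * y = y * x) ∧
    -- and is generated by the center of `H(m,1,n)` and the last Jucys-Murphy element
    Subalgebra.centralizer K ((incl n q v).range : Set (Hecke (n + 1) q v)) =
      Algebra.adjoin K
        (incl n q v '' (Subalgebra.center K (Hecke n q v) : Set (Hecke n q v)) ∪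
          {JM q v n (Nat.lt_succ_self n)}) ∧
    -- the Jucys-Murphy elements generate a maximal commutative subalgebra
    Maximal (fun B : Subalgebra K (Hecke (n + 1) q v) => ∀ x ∈ B, ∀ y ∈ B, x * y = y * x)
      (Algebra.adjoin K (Set.range fun i : Fin (n + 1) => JM q v (i : ℕ) i.2)) := by
  have G : Generic (n + 1) q v := generic_of_assumptions hq hq2 h1 h2 h3
  have G' : Generic n q v := G.mono n.le_succ
  refine ⟨incl_injective G hm, fun k hk => ?_, ?_, ?_, fun x hx y hy =>
    centralizer_commutative G G' hx hy, centralizer_eq_adjoin G G', G.maximal_jmAlgebra⟩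
  · have Gk : Generic k q v := G.mono hk
    refine ⟨fun Λ => Gk.existsUnique_rep, fun Λ ρ hρ => ?_, fun Λ M ρ ρ' hρ hρ' h => ?_,
      fun V _ _ θ hθ => ?_⟩
    · rw [Gk.eq_rep hρ]
      exact Gk.isSimpleModule Λ
    · rw [Gk.eq_rep hρ, Gk.eq_rep hρ'] at h
      exact Gk.shape_eq_of_equiv h
    · obtain ⟨Λ, h⟩ := Gk.exists_equiv_of_isSimpleModule θ
      exact ⟨Λ, Gk.rep Λ, Gk.isSeminormal_rep, h⟩
  · intro Λ ρ ρ' hρ hρ'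
    -- The seminormal formulas determine the representation, so the given ones are the constructed
    -- ones.
    obtain rfl := G.eq_rep hρ
    obtain rfl : ρ' = fun α : {α : MNode m // Λ.IsRemovable α} =>
        G'.rep (Λ.remove α.1 α.2) := funext fun α => G'.eq_rep (hρ' α)
    exact ⟨branchEquiv G G' Λ⟩
  · intro V _ _ θ hθ
    exact isMultiplicityFree_restriction G θ
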